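/- Let $k$ be a field of characteristic zero, $R=k[x_1,x_2,x_3]$, $S=k[y_1,y_2,y_3]$, and let $R$ act on $S$ by $x_i\circ F=\partial F/\partial y_i$; write $\operatorname{Ann}(F,G)=\{p\in R: p\circ F=p\circ G=0\}$. For $e\ge 0$ let $\mathcal F_e$ be the family of algebras $R/\operatorname{Ann}(F,G)$, where $F,G\in S$ are linearly independent forms of degree $e$ such that $l_1\circ F=(l_1l_2)\circ G=0$ for some nonzero, not necessarily distinct, linear forms $l_1,l_2\in R$. Identifying $R/\operatorname{Ann}(F,G)$ with the plane $\langle F,G\rangle$, regard $\mathcal F_e$ as a subset of the Grassmannian $\operatorname{Gr}(2,S_e)$ of two-dimensional subspaces of the space $S_e$ of forms of degree $e$, with its Zariski topology (on $k$-points, via the Plücker embedding). Let $h^{(e)}=(h_0,\dots,h_e)$ with $h_d=\min\{2d+1,\;e+2,\;3(e-d)+2\}$. A graded artinian algebra $A=R/I=\bigoplus_{i=0}^e A_i$, $A_e\neq0$, has $h$-vector $(\dim_k A_0,\dots,\dim_k A_e)$; it is level if its socle $\{a\in A: x_1a=x_2a=x_3a=0\}$ is zero in all degrees less than $e$; it has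 the Weak Lefschetz Property if there is a linear form $l$ such that multiplication by $l$ from $A_i$ to $A_{i+1}$ has maximal rank for $i=0,\dots,e-1$. 1. For every $e\ge1$ the generic element of $\mathcal F_e$ has $h$-vector $h^{(e)}$: there is a Zariski-open $U\subseteq \operatorname{Gr}(2,S_e)$ such that $U\cap\mathcal F_e$ is nonempty and dense in $\mathcal F_e$ and all of its elements have $h$-vector $h^{(e)}$. 2. For every $e\ge 6$, every artinian level algebra $R/I$ with $h$-vector $h^{(e)}$ belongs to $\mathcal F_e$. 3. For every $e\ge 6$, $\mathcal F_e$ is an irreducible variety of dimension $3(e+1)$: as a subset of $\operatorname{Gr}(2,S_e)$ it is irreducible and has (Krull) dimension $3(e+1)$, and it is Zariski closed if $k$ is algebraically closed. 4. For every odd $e\ge 9$ and every even $e\ge12$, no artinian level algebra $R/I$ with $h$-vector $h^{(e)}$ has the Weak Lefschetz Property. -/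

import Mathlib

open MvPolynomial

namespace LevelAlg

variable (k : Type*) [Field k]

/-- The polynomial ring in three variables over `k`. It serves both as the ring
`R = k[x₁, x₂, x₃]` and as the module `S = k[y₁, y₂, y₃]` on which `R` acts by differentiation. -/
abbrev Poly : Type _ := MvPolynomial (Fin 3) k

/-- The differential operator `∂₁^(m 0) ∂₂^(m 1) ∂₃^(m 2)` on `S`. -/
noncomputable def monomialDiff (m : Fin 3 →₀ ℕ) : Module.End k (Poly k) :=
  (pderiv (R := k) (0 : Fin 3)).toLinearMap ^ m 0 *
    (pderiv (R := k) (1 : Fin 3)).toLinearMap ^ m 1 *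
    (pderiv (R := k) (2 : Fin 3)).toLinearMap ^ m 2

theorem pderiv_commute (i j : Fin 3) :
    Commute ((pderiv (R := k) i).toLinearMap : Module.End k (Poly k))
      (pderiv (R := k) j).toLinearMap := by
  have h : ⁅(pderiv i : Derivation k (Poly k) (Poly k)),
      (pderiv j : Derivation k (Poly k) (Poly k))⁆ = 0 := by
    apply MvPolynomial.derivation_ext
    intro l
    rw [Derivation.commutator_apply]
    simp only [pderiv_X, Derivation.coe_zero, Pi.zero_apply]
    rcases eq_or_ne l i with h1 | h1 <;> rcases eq_or_ne l j with h2 | h2 <;>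
      simp [Pi.single_apply, h1, h2] <;> split_ifs <;> simp
  apply LinearMap.ext
  intro f
  have := congrArg (fun D : Derivation k (Poly k) (Poly k) => D f) h
  simp only [Derivation.commutator_apply, Derivation.coe_zero, Pi.zero_apply] at this
  exact sub_eq_zero.mp this

/-- `monomialDiff` is multiplicative in the exponent, since partial derivatives commute. -/
noncomputable def monomialDiffHom :
    Multiplicative (Fin 3 →₀ ℕ) →* Module.End k (Poly k) where
  toFun m := monomialDiff k m.toAdd
  map_one' := by simp [monomialDiff]
  map_mul' a b := by
    have c01 := pderiv_commute k 0 1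
    have c02 := pderiv_commute k 0 2
    have c12 := pderiv_commute k 1 2
    simp only [monomialDiff, toAdd_mul, Finsupp.add_apply, pow_add]
    generalize (pderiv (R := k) (0 : Fin 3)).toLinearMap = A at *
    generalize (pderiv (R := k) (1 : Fin 3)).toLinearMap = B at *
    generalize (pderiv (R := k) (2 : Fin 3)).toLinearMap = C at *
    generalize a.toAdd = a
    generalize b.toAdd = b
    have h01 := (c01.pow_pow (b 0) (a 1)).eq
    have h02 := (c02.pow_pow (b 0) (a 2)).eq
    have h12 := (c12.pow_pow (b 1) (a 2)).eq
    calc A ^ a 0 * A ^ b 0 * (B ^ a 1 * B ^ b 1) * (C ^ a 2 * C ^ b 2)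
        = A ^ a 0 * (A ^ b 0 * B ^ a 1) * (B ^ b 1 * C ^ a 2) * C ^ b 2 := by
          simp only [mul_assoc]
      _ = A ^ a 0 * B ^ a 1 * (A ^ b 0 * C ^ a 2) * B ^ b 1 * C ^ b 2 := by
          rw [h01, h12]; simp only [mul_assoc]
      _ = _ := by rw [h02]; simp only [mul_assoc]

/-- The action `p ∘ F` of `R` on `S`: `xᵢ` acts as `∂/∂yᵢ`, so that `p` acts as the constant
coefficient differential operator `p(∂/∂y₁, ∂/∂y₂, ∂/∂y₃)`. -/
noncomputable def diff : Poly k →ₐ[k] Module.End k (Poly k) :=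
  AddMonoidAlgebra.lift k (Module.End k (Poly k)) (Fin 3 →₀ ℕ) (monomialDiffHom k)

theorem diff_X (i : Fin 3) (F : Poly k) : diff k (X i) F = pderiv i F := by
  have : diff k (X i) = monomialDiff k (Finsupp.single i 1) := by
    have h := AddMonoidAlgebra.lift_single (monomialDiffHom k) (Finsupp.single i 1) (1 : k)
    rw [one_smul] at h
    exact h
  rw [this]
  fin_cases i <;> simp [monomialDiff]

variable {k}

/-- The annihilator in `R` of the inverse system module generated by the elements of `W`:
the polynomials `p` with `p ∘ F = 0` for all `F ∈ W`. -/
noncomputable def Ann (W : Submodule k (Poly k)) : Ideal (Poly k) where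
  carrier := {p | ∀ F ∈ W, diff k p F = 0}
  zero_mem' := by intro F _; simp
  add_mem' := by
    intro p q hp hq F hF
    simp [hp F hF, hq F hF]
  smul_mem' := by
    intro c p hp F hF
    simp [hp F hF]

/-- The degree `d` part `A_d` of `A = R/I`: the image of the forms of degree `d`. -/
noncomputable def gradedPart (I : Ideal (Poly k)) (d : ℕ) : Submodule k (Poly k ⧸ I) :=
  (homogeneousSubmodule (Fin 3) k d).map (Ideal.Quotient.mkₐ k I).toLinearMap

/-- The Hilbert function `d ↦ dim_k A_d` of `A = R/I`. -/
noncomputable def hilb (I : Ideal (Poly k)) (d : ℕ) : ℕ :=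
  Module.finrank k (gradedPart I d)

/-- `A = R/I` has `h`-vector `(h 0, …, h e)`; that is, `dim_k A_d = h d` for `d ≤ e`,
`A_d = 0` for `d > e`, and `h e ≠ 0`. -/
def HasHVector (I : Ideal (Poly k)) (e : ℕ) (h : ℕ → ℕ) : Prop :=
  (∀ d ≤ e, hilb I d = h d) ∧ (∀ d, e < d → hilb I d = 0) ∧ h e ≠ 0

/-- The socle of `A = R/I`: the elements killed by the classes of `x₁, x₂, x₃`. -/
noncomputable def socle (I : Ideal (Poly k)) : Submodule k (Poly k ⧸ I) where
  carrier := {a | ∀ i : Fin 3, a * Ideal.Quotient.mk I (X i) = 0}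
  zero_mem' := by intro i; simp
  add_mem' := by
    intro a b ha hb i
    rw [add_mul, ha i, hb i, add_zero]
  smul_mem' := by
    intro c a ha i
    rw [smul_mul_assoc, ha i, smul_zero]

/-- The ideal `I` is homogeneous. -/
def IsHomog (I : Ideal (Poly k)) : Prop :=
  ∀ p ∈ I, ∀ n, homogeneousComponent n p ∈ I

/-- `A = R/I` is an artinian level graded algebra of socle degree `e`: the ideal `I` is
homogeneous, `e` is the last degree in which `A` is nonzero, and the socle of `A` vanishes in all
degrees below `e`. -/
def IsLevel (I : Ideal (Poly k)) (e : ℕ) : Prop :=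
  IsHomog I ∧ gradedPart I e ≠ ⊥ ∧ (∀ d, e < d → gradedPart I d = ⊥) ∧
    ∀ d < e, socle I ⊓ gradedPart I d = ⊥

/-- Multiplication by (the class of) `l`, as a linear map `A_i → A`. When `l` is a linear form
its range is contained in `A_{i+1}`. -/
noncomputable def mulMap (I : Ideal (Poly k)) (l : Poly k) (i : ℕ) :
    gradedPart I i →ₗ[k] Poly k ⧸ I :=
  (LinearMap.mulLeft k (Ideal.Quotient.mk I l)).domRestrict (gradedPart I i)

/-- The Weak Lefschetz Property of `A = R/I` of socle degree `e`: for some linear form `l`, each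
multiplication map `·l : A_i → A_{i+1}`, `0 ≤ i < e`, has maximal rank. -/
def HasWLP (I : Ideal (Poly k)) (e : ℕ) : Prop :=
  ∃ l : Poly k, l.IsHomogeneous 1 ∧ ∀ i < e,
    Module.finrank k (LinearMap.range (mulMap I l i)) = min (hilb I i) (hilb I (i + 1))

/-- The sequence `h^(e)_d = min {2d+1, e+2, 3(e-d)+2}`, for `0 ≤ d ≤ e`. -/
def hSeq (e d : ℕ) : ℕ := min (min (2 * d + 1) (e + 2)) (3 * (e - d) + 2)

variable (k)

/-- The Grassmannian of two-dimensional subspaces of the space `S_e` of forms of degree `e`. -/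
def Gr (e : ℕ) : Type _ :=
  {W : Submodule k (Poly k) // W ≤ homogeneousSubmodule (Fin 3) k e ∧ Module.finrank k W = 2}

variable {k}

/-- The Plücker coordinates of the pair `(F, G)`: the `2 × 2` minors of the matrix of the
coefficients of `F` and `G`. (For forms of degree `e`, the coordinates indexed by exponents of
other degrees are zero.) -/
noncomputable def pluecker (F G : Poly k) : (Fin 3 →₀ ℕ) × (Fin 3 →₀ ℕ) → k :=
  fun mn => coeff mn.1 F * coeff mn.2 G - coeff mn.2 F * coeff mn.1 G

/-- The set of points of the Grassmannian at which the polynomial `P` in the Plücker coordinates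
does not vanish. For homogeneous `P` the choice of the basis `F, G` does not matter. -/
def basicOpen (e : ℕ) (P : MvPolynomial ((Fin 3 →₀ ℕ) × (Fin 3 →₀ ℕ)) k) : Set (Gr k e) :=
  {W | ∃ F G : Poly k, W.1 = Submodule.span k {F, G} ∧ eval (pluecker F G) P ≠ 0}

/-- The Zariski topology of the Grassmannian, as a subset of projective space through the Plücker
embedding: the sets of non-vanishing of homogeneous polynomials are a basis of open sets. -/
instance zariski (e : ℕ) : TopologicalSpace (Gr k e) :=
  TopologicalSpace.generateFrom
    {U | ∃ (n : ℕ) (P : MvPolynomial ((Fin 3 →₀ ℕ) × (Fin 3 →₀ ℕ)) k),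
      P.IsHomogeneous n ∧ U = basicOpen e P}

variable (k)

/-- The family `𝓕_e`, as a subset of the Grassmannian: the planes `⟨F, G⟩ ⊆ S_e` with
`l₁ ∘ F = (l₁ l₂) ∘ G = 0` for some nonzero linear forms `l₁, l₂`. The plane `⟨F, G⟩` stands for
the algebra `R/Ann(F, G)`. -/
def family (e : ℕ) : Set (Gr k e) :=
  {W | ∃ F G l₁ l₂ : Poly k, W.1 = Submodule.span k {F, G} ∧
    l₁ ≠ 0 ∧ l₁.IsHomogeneous 1 ∧ l₂ ≠ 0 ∧ l₂.IsHomogeneous 1 ∧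
    diff k l₁ F = 0 ∧ diff k (l₁ * l₂) G = 0}

end LevelAlg

/-! By Macaulay duality, a level algebra of socle degree `e` with two-dimensional top degree is
`R/Ann W` for a plane `W = ⟨F, G⟩` of forms of degree `e`, and its Hilbert function in degree `e -
j` is the dimension of the space of derivatives of order `j` of `W` (`IsLevel.exists_eq_Ann`,
`hilb_Ann`).

Membership in the family needs few entries of the `h`-vector (`mem_family_of_hilb`). From `h_2 = 5`
comes a quadric `q` killing `W`, from `h_{e-1} = 5` a linear relation `l ∘ F + m ∘ G = 0`, and
`h_{e-2} = 8` leaves a four-dimensional space of quadratic relations. It contains the plane of all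
`(aq, bq)` and the three-dimensional space of all `(xl, xm)`. These must meet, so `q` splits and
`l`, `m` are proportional.

The Weak Lefschetz Property fails because, where the Hilbert function is `e + 2`, the derivatives of
`W` include all forms of degree `d + 1` killed by `l₁`. These are binary forms, and a linear form
maps their `(d + 2)`-dimensional space to one of dimension `d + 1`. The resulting kernel dually
obstructs surjectivity (`exists_killed_invSys`, `not_hasWLP_of_killed`).

A general member of the family is, up to a linear substitution, `f(X₀, X₁)`, `g(X₀, X₁) + h(X₂,
X₁)`. Normalizing leaves `3e + 3` free parameters, and these normal forms are dense
(`family_subset_closure_nfSet`), whence irreducibility. The dimension is at most `3e + 3` because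
the cone over the family has its coordinate ring inside a polynomial ring in `3e + 4` variables
(`topologicalKrullDim_le`). It is at least that because freeing the parameters one at a time gives a
strictly increasing chain, each step being detected by a polynomial in the Plücker coordinates.

For the generic `h`-vector, `hilb_le_hSeq` bounds the Hilbert function on the whole family, an
explicit pair of a binomial and a monomial attains the bound, and attaining it is an open condition.
Closedness is elimination of the direction `l₁`: projection from a projective space is closed
(`exists_eval_ne_zero_forall_eq_zero`). -/

namespace LevelAlg

section

variable {k : Type*} [Field k]

/-! ### The action by differentiation in coordinates -/

/-- The product of the factorials of the exponents. -/
def expFactorial (m : Fin 3 →₀ ℕ) : ℕ := ∏ i, (m i).factorial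

theorem expFactorial_add_single (m : Fin 3 →₀ ℕ) (i : Fin 3) :
    expFactorial (m + Finsupp.single i 1) = (m i + 1) * expFactorial m := by
  unfold expFactorial
  rw [← Finset.mul_prod_erase _ _ (Finset.mem_univ i),
    ← Finset.mul_prod_erase _ (fun j => (m j).factorial) (Finset.mem_univ i), ← mul_assoc]
  congr 1
  · simp [Nat.factorial_succ]
  · refine Finset.prod_congr rfl fun j hj => ?_
    have : j ≠ i := (Finset.mem_erase.mp hj).1
    simp [this.symm]

theorem expFactorial_cast_ne_zero [CharZero k] (m : Fin 3 →₀ ℕ) : (expFactorial m : k) ≠ 0 := by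
  rw [Nat.cast_ne_zero]
  exact Finset.prod_ne_zero_iff.mpr fun i _ => Nat.factorial_ne_zero _

theorem diff_C (a : k) (F : Poly k) : diff k (C a) F = a • F := by
  have := (diff k).commutes a
  rw [show C a = algebraMap k (Poly k) a from rfl, this]
  rfl

theorem diff_mul (p q F : Poly k) : diff k (p * q) F = diff k p (diff k q F) := by
  rw [map_mul]; rfl

/-- Once coefficients are weighted by the factorials of their exponents, differentiation by a
monomial is a mere shift of exponents. -/
theorem coeff_diff_monomial (m : Fin 3 →₀ ℕ) (a : k) (n : Fin 3 →₀ ℕ) (F : Poly k) :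
    coeff n (diff k (monomial m a) F) * expFactorial n =
      a * (coeff (n + m) F * expFactorial (n + m)) := by
  suffices h : ∀ (m n : Fin 3 →₀ ℕ) (F : Poly k),
      coeff n (diff k (monomial m 1) F) * expFactorial n =
        coeff (n + m) F * expFactorial (n + m) by
    have : monomial m a = C a * monomial m 1 := by simp [C_mul_monomial]
    rw [this, diff_mul, diff_C, coeff_smul, smul_eq_mul, mul_assoc, h]
  clear m n F a
  intro m
  induction m using Finsupp.induction_linear with
  | zero =>
    intro n F
    have : (monomial (0 : Fin 3 →₀ ℕ) (1 : k)) = 1 := rfl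
    rw [this, map_one]
    simp
  | add a b ha hb =>
    intro n F
    have : monomial (a + b) (1 : k) = monomial a 1 * monomial b 1 := by simp [monomial_mul]
    rw [this, diff_mul, ha, hb, add_assoc]
  | single i r =>
    induction r with
    | zero =>
      intro n F
      have : (monomial (Finsupp.single i 0) (1 : k)) = 1 := by simp
      rw [this, map_one]
      simp
    | succ r ih =>
      intro n F
      have : monomial (Finsupp.single i (r + 1)) (1 : k) = monomial (Finsupp.single i r) 1 * X i :=
          by
        simp [X, monomial_mul, Finsupp.single_add]
      rw [this, diff_mul, ih, diff_X, coeff_pderiv, Finsupp.single_add, ← add_assoc,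
        expFactorial_add_single]
      push_cast
      ring

theorem coeff_diff (p F : Poly k) (n : Fin 3 →₀ ℕ) :
    coeff n (diff k p F) * expFactorial n =
      ∑ m ∈ p.support, coeff m p * (coeff (n + m) F * expFactorial (n + m)) := by
  conv_lhs => rw [p.as_sum]
  rw [map_sum, LinearMap.sum_apply, coeff_sum, Finset.sum_mul]
  exact Finset.sum_congr rfl fun m _ => coeff_diff_monomial m _ n F

theorem coeff_zero_diff (p F : Poly k) :
    coeff 0 (diff k p F) = ∑ m ∈ p.support, coeff m p * (coeff m F * expFactorial m) := by
  have := coeff_diff p F 0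
  simpa [expFactorial] using this

/-- Both sides are the sum of `m! p_m F_m` over all exponents `m`, which is symmetric in the two
polynomials. -/
theorem coeff_zero_diff_comm (p F : Poly k) :
    coeff 0 (diff k p F) = coeff 0 (diff k F p) := by
  rw [coeff_zero_diff, coeff_zero_diff,
    Finset.sum_subset (Finset.subset_union_left (s₂ := F.support)),
    Finset.sum_subset (Finset.subset_union_right (s₁ := p.support) (s₂ := F.support))]
  · exact Finset.sum_congr rfl fun m _ => by ring
  · intro m _ hm
    rw [notMem_support_iff.mp hm, zero_mul]
  · intro m _ hm
    rw [notMem_support_iff.mp hm, zero_mul]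

section CharZero

variable [CharZero k]

theorem isHomogeneous_diff {p F : Poly k} {d e j : ℕ} (hp : p.IsHomogeneous d)
    (hF : F.IsHomogeneous e) (h : d + j = e) : (diff k p F).IsHomogeneous j := by
  intro n hn
  change Finsupp.weight (fun _ => 1) n = j
  rw [← Finsupp.degree_eq_weight_one]
  by_contra hne
  apply hn
  have h1 := coeff_diff p F n
  rw [Finset.sum_eq_zero] at h1
  · exact (mul_eq_zero.mp h1).resolve_right (expFactorial_cast_ne_zero n)
  · intro m hm
    rw [hF.coeff_eq_zero (d := n + m), zero_mul, mul_zero]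
    have h2 : m.degree = d := (hp.degree_eq_sum_deg_support hm).symm
    rw [map_add, h2]
    change ¬ n.degree = j at hne
    omega

theorem diff_eq_zero_of_lt {p F : Poly k} {d e : ℕ} (hp : p.IsHomogeneous d)
    (hF : F.IsHomogeneous e) (h : e < d) : diff k p F = 0 := by
  ext n
  have h1 := coeff_diff p F n
  rw [Finset.sum_eq_zero] at h1
  · simpa using (mul_eq_zero.mp h1).resolve_right (expFactorial_cast_ne_zero n)
  · intro m hm
    rw [hF.coeff_eq_zero (d := n + m), zero_mul, mul_zero]
    have h2 : m.degree = d := (hp.degree_eq_sum_deg_support hm).symm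
    rw [map_add, h2]
    omega

theorem eq_zero_of_forall_coeff_zero_diff {F : Poly k} {d : ℕ} (hF : F.IsHomogeneous d)
    (h : ∀ p : Poly k, p.IsHomogeneous d → coeff 0 (diff k p F) = 0) : F = 0 := by
  ext m
  by_cases hm : m.degree = d
  · have h1 := h (monomial m 1) (isHomogeneous_monomial 1 hm)
    have h2 := coeff_diff_monomial m (1 : k) 0 F
    rw [h1] at h2
    simp only [zero_mul, zero_add, one_mul] at h2
    simpa using (mul_eq_zero.mp h2.symm).resolve_right (expFactorial_cast_ne_zero m)
  · simpa using hF.coeff_eq_zero hm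

end CharZero

/-! ### Forms -/

variable (k) in
/-- The forms of degree `d`. -/
abbrev Forms (d : ℕ) : Submodule k (Poly k) := homogeneousSubmodule (Fin 3) k d

instance (d : ℕ) : FiniteDimensional k (Forms k d) :=
  Module.Finite.iff_fg.mpr (homogeneousSubmodule_fg (Fin 3) k d)

theorem finrank_forms (d : ℕ) : Module.finrank k (Forms k d) = (d + 2).choose 2 := by
  have h : (Finset.finsuppAntidiag (Finset.univ : Finset (Fin 3)) d).card = (d + 2).choose 2 := by
    rw [Finset.card_finsuppAntidiag_nat_eq_choose, Finset.card_univ, Fintype.card_fin,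
      show 3 + d - 1 = d + 2 by omega]
    exact Nat.choose_symm_add
  have h2 := (homogeneousSubmodule_eq_finsupp_supported (Fin 3) k d)
  let b : Module.Basis {m : Fin 3 →₀ ℕ | m.degree = d} k (Forms k d) :=
    .ofRepr ((LinearEquiv.ofEq _ _ h2).trans (AddMonoidAlgebra.supportedEquivFinsupp _))
  rw [Module.finrank_eq_nat_card_basis b, ← h, ← Nat.card_eq_finsetCard]
  refine Nat.card_congr (Equiv.subtypeEquivRight fun m => ?_)
  simp [Finset.mem_finsuppAntidiag, Finsupp.degree_eq_sum]

/-- The perfect pairing between `R_d` and `S_d`. -/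
noncomputable def pairing (d : ℕ) : LinearMap.BilinForm k (Forms k d) :=
  LinearMap.mk₂ k (fun p F => coeff 0 (diff k (p : Poly k) (F : Poly k)))
    (by intros; simp) (by intros; simp) (by intros; simp) (by intros; simp)

theorem pairing_apply (d : ℕ) (p F : Forms k d) :
    pairing d p F = coeff 0 (diff k (p : Poly k) (F : Poly k)) := rfl

theorem pairing_isSymm (d : ℕ) : (pairing (k := k) d).IsSymm :=
  ⟨fun p F => by simp [pairing_apply, coeff_zero_diff_comm]⟩

theorem pairing_nondegenerate [CharZero k] (d : ℕ) : (pairing (k := k) d).Nondegenerate := by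
  have h : ∀ F : Forms k d, (∀ p, pairing d p F = 0) → F = 0 := fun F hF =>
    Subtype.ext (eq_zero_of_forall_coeff_zero_diff F.2 fun p hp => hF ⟨p, hp⟩)
  exact ⟨fun F hF => h F fun p => (pairing_isSymm d).eq p F ▸ hF p, fun F hF => h F hF⟩

/-! ### Dimension counts -/

/-- Multiplication of forms of degree `i` by a form of degree `a`. -/
noncomputable def mulForms {q : Poly k} {a : ℕ} (hq : q.IsHomogeneous a) (i : ℕ) :
    Forms k i →ₗ[k] Forms k (a + i) :=
  (LinearMap.mulLeft k q).restrict fun _ hp => hq.mul hp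

theorem mulForms_injective {q : Poly k} {a : ℕ} (hq : q.IsHomogeneous a) (h0 : q ≠ 0) (i : ℕ) :
    Function.Injective (mulForms hq i) := by
  intro x y hxy
  have := congrArg Subtype.val hxy
  exact Subtype.ext (mul_left_cancel₀ h0 this)

theorem finrank_range_mulForms {q : Poly k} {a : ℕ} (hq : q.IsHomogeneous a) (h0 : q ≠ 0)
    (i : ℕ) : Module.finrank k (LinearMap.range (mulForms hq i)) = (i + 2).choose 2 := by
  rw [LinearMap.finrank_range_of_inj (mulForms_injective hq h0 i), finrank_forms]

/-- A linear map on the forms of degree `a + i` that kills the multiples of a nonzero form `q` of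
degree `a` has rank at most `dim (R/q)_{a+i}`. -/
theorem finrank_range_add_le {V : Type*} [AddCommGroup V] [Module k V] {q : Poly k} {a i : ℕ}
    (hq : q.IsHomogeneous a) (h0 : q ≠ 0) (f : Forms k (a + i) →ₗ[k] V)
    (hf : ∀ r, f (mulForms hq i r) = 0) :
    Module.finrank k (LinearMap.range f) + (i + 2).choose 2 ≤ (a + i + 2).choose 2 := by
  rw [← finrank_range_mulForms hq h0 i, ← finrank_forms (k := k) (a + i),
    ← LinearMap.finrank_range_add_finrank_ker f]
  gcongr
  apply Submodule.finrank_mono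
  rintro _ ⟨r, rfl⟩
  exact hf r

/-- The forms of degree `a + i` killed by a form `q` of degree `a`. -/
theorem finrank_killed_add [CharZero k] {q : Poly k} {a : ℕ} (hq : q.IsHomogeneous a)
    (h0 : q ≠ 0) (i : ℕ) :
    Module.finrank k ↥(LinearMap.ker (diff k q) ⊓ Forms k (a + i)) + (i + 2).choose 2 =
      (a + i + 2).choose 2 := by
  -- A form is killed by `q` exactly when it is orthogonal to all multiples of `q`; multiplication
  -- by `q` is injective, so the dimension of the orthogonal is known.
  have h1 : LinearMap.ker (diff k q) ⊓ Forms k (a + i) =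
      ((pairing (a + i)).orthogonal (LinearMap.range (mulForms hq i))).map
        (Forms k (a + i)).subtype := by
    ext F
    constructor
    · rintro ⟨h1, h2⟩
      refine ⟨⟨F, h2⟩, ?_, rfl⟩
      rintro _ ⟨r, rfl⟩
      change diff k q F = 0 at h1
      change coeff 0 (diff k (q * r) F) = 0
      rw [mul_comm, diff_mul, h1]
      simp
    · rintro ⟨F, h, rfl⟩
      refine ⟨?_, F.2⟩
      change diff k q F = 0
      refine eq_zero_of_forall_coeff_zero_diff (isHomogeneous_diff hq F.2 rfl) fun p hp => ?_
      have h2 := h (mulForms hq i ⟨p, hp⟩) (LinearMap.mem_range_self _ _)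
      rw [← diff_mul, mul_comm]
      exact h2
  have h2 := LinearMap.BilinForm.finrank_orthogonal (pairing_nondegenerate (a + i))
    (LinearMap.range (mulForms hq i))
  have h3 := Submodule.finrank_le (LinearMap.range (mulForms hq i))
  rw [h1, Submodule.finrank_map_subtype_eq, h2]
  rw [finrank_range_mulForms hq h0, finrank_forms] at *
  omega

/-! ### Inverse systems -/

/-- The degree `d` part of an ideal. -/
noncomputable def idealPart (I : Ideal (Poly k)) (d : ℕ) : Submodule k (Forms k d) :=
  (I.restrictScalars k).comap (Forms k d).subtype

theorem mem_idealPart {I : Ideal (Poly k)} {d : ℕ} {p : Forms k d} :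
    p ∈ idealPart I d ↔ (p : Poly k) ∈ I := Iff.rfl

theorem hilb_add_finrank_idealPart (I : Ideal (Poly k)) (d : ℕ) :
    hilb I d + Module.finrank k (idealPart I d) = (d + 2).choose 2 := by
  have h := LinearMap.finrank_range_add_finrank_ker
    ((Ideal.Quotient.mkₐ k I).toLinearMap.domRestrict (Forms k d))
  rw [finrank_forms] at h
  have h2 : idealPart I d = LinearMap.ker
      ((Ideal.Quotient.mkₐ k I).toLinearMap.domRestrict (Forms k d)) := by
    ext p
    simp [mem_idealPart, Ideal.Quotient.eq_zero_iff_mem]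
  rw [← h, hilb, gradedPart, h2, LinearMap.range_domRestrict]

/-- The forms obtained from `W` by differential operators of order `j`. -/
noncomputable def invSys (W : Submodule k (Poly k)) (j : ℕ) : Submodule k (Poly k) :=
  Submodule.map₂ (diff k).toLinearMap (Forms k j) W

theorem diff_mem_invSys {W : Submodule k (Poly k)} {j : ℕ} {p F : Poly k}
    (hp : p.IsHomogeneous j) (hF : F ∈ W) : diff k p F ∈ invSys W j :=
  Submodule.apply_mem_map₂ _ hp hF

theorem invSys_le {W V : Submodule k (Poly k)} {j : ℕ} :
    invSys W j ≤ V ↔ ∀ p : Poly k, p.IsHomogeneous j → ∀ F ∈ W, diff k p F ∈ V :=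
  Submodule.map₂_le

theorem IsHomog.ext {I J : Ideal (Poly k)} (hI : IsHomog I) (hJ : IsHomog J)
    (h : ∀ d (p : Poly k), p.IsHomogeneous d → (p ∈ I ↔ p ∈ J)) : I = J := by
  ext p
  constructor <;> intro hp <;> rw [← sum_homogeneousComponent p] <;>
    refine Ideal.sum_mem _ fun i _ => ?_
  · exact (h i _ (homogeneousComponent_isHomogeneous i p)).mp (hI p hp i)
  · exact (h i _ (homogeneousComponent_isHomogeneous i p)).mpr (hJ p hp i)

section CharZero

variable [CharZero k]

theorem invSys_le_forms {W : Submodule k (Poly k)} {d e j : ℕ} (hW : W ≤ Forms k e)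
    (h : j + d = e) : invSys W j ≤ Forms k d :=
  invSys_le.mpr fun _ hp _ hF => isHomogeneous_diff hp (hW hF) h

/-- In degree `d` the annihilator is the orthogonal of the space of derivatives of `W` of that
degree, since `(q * p) ∘ G` can be read as `p` acting on `q ∘ G`. -/
theorem hilb_Ann {W : Submodule k (Poly k)} {d e j : ℕ} (hW : W ≤ Forms k e)
    (h : j + d = e) : hilb (Ann W) d = Module.finrank k (invSys W j) := by
  have h1 : idealPart (Ann W) d =
      (pairing d).orthogonal ((invSys W j).comap (Forms k d).subtype) := by
    ext p
    constructor
    · intro hp F hF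
      have h2 : invSys W j ≤ LinearMap.ker (diff k (p : Poly k)) :=
        invSys_le.mpr fun q hq G hG => by
          have h3 : diff k (p : Poly k) G = 0 := hp G hG
          rw [LinearMap.mem_ker, ← diff_mul, mul_comm, diff_mul, h3, map_zero]
      have h3 : diff k (p : Poly k) F = 0 := h2 hF
      rw [← (pairing_isSymm d).eq]
      simp [pairing_apply, h3]
    · intro hp G hG
      refine eq_zero_of_forall_coeff_zero_diff
        (isHomogeneous_diff p.2 (hW hG) ((add_comm _ _).trans h)) fun q hq => ?_
      rw [← diff_mul, mul_comm, diff_mul]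
      have h3 := hp ⟨diff k q G, isHomogeneous_diff hq (hW hG) h⟩ (diff_mem_invSys hq hG)
      rw [← (pairing_isSymm d).eq] at h3
      exact h3
  have h2 := hilb_add_finrank_idealPart (Ann W) d
  have h3 := LinearMap.BilinForm.finrank_orthogonal (pairing_nondegenerate d)
    ((invSys W j).comap (Forms k d).subtype)
  have h4 := Submodule.finrank_le ((invSys W j).comap (Forms k d).subtype)
  rw [← h1] at h3
  rw [finrank_forms] at *
  rw [← Submodule.map_comap_eq_of_le (p := invSys W j) (f := (Forms k d).subtype)
    (by simpa using invSys_le_forms hW h),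
    Submodule.finrank_map_subtype_eq]
  omega

theorem Ann_isHomog {W : Submodule k (Poly k)} {e : ℕ} (hW : W ≤ Forms k e) :
    IsHomog (Ann W) := by
  intro p hp d F hF
  rcases lt_or_ge e d with hd | hd
  · exact diff_eq_zero_of_lt (homogeneousComponent_isHomogeneous d p) (hW hF) hd
  have h1 := hp F hF
  rw [← sum_homogeneousComponent p, map_sum, LinearMap.sum_apply] at h1
  have h2 := congrArg (homogeneousComponent (e - d)) h1
  rw [map_sum, map_zero] at h2
  -- Different components of `p` send `F` to different degrees, so no cancellation between them is
  -- possible.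
  have key : ∀ i, homogeneousComponent (e - d) (diff k (homogeneousComponent i p) F) =
      if i = d then diff k (homogeneousComponent i p) F else 0 := by
    intro i
    have hi := homogeneousComponent_isHomogeneous i p
    rcases lt_or_ge e i with h3 | h3
    · rw [diff_eq_zero_of_lt hi (hW hF) h3]; simp
    · rw [homogeneousComponent_of_mem (isHomogeneous_diff hi (hW hF) (Nat.add_sub_cancel' h3))]
      congr 1
      simp only [eq_iff_iff]
      omega
  simp only [key, Finset.sum_ite_eq', Finset.mem_range] at h2
  split_ifs at h2 with h3
  · exact h2
  · rw [homogeneousComponent_eq_zero _ _ (by omega)]; simp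

/-- Macaulay duality for level algebras. -/
theorem IsLevel.exists_eq_Ann {I : Ideal (Poly k)} {e : ℕ} (hI : IsLevel I e) :
    ∃ W ≤ Forms k e, Module.finrank k W = hilb I e ∧ I = Ann W := by
  obtain ⟨hom, -, htop, hsoc⟩ := hI
  set W := ((pairing e).orthogonal (idealPart I e)).map (Forms k e).subtype with hWdef
  have hW : W ≤ Forms k e := Submodule.map_subtype_le _ _
  refine ⟨W, hW, ?_, ?_⟩
  · have h2 := hilb_add_finrank_idealPart I e
    have h3 := LinearMap.BilinForm.finrank_orthogonal (pairing_nondegenerate e) (idealPart I e)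
    rw [hWdef, Submodule.finrank_map_subtype_eq, h3, finrank_forms]
    omega
  · have mem_of_gt : ∀ d, e < d → ∀ p : Poly k, p.IsHomogeneous d → p ∈ I := by
      intro d hd p hp
      have : Ideal.Quotient.mk I p ∈ gradedPart I d := ⟨p, hp, rfl⟩
      rw [htop d hd, Submodule.mem_bot] at this
      exact Ideal.Quotient.eq_zero_iff_mem.mp this
    refine hom.ext (Ann_isHomog hW) fun d p hp => ?_
    rcases lt_or_ge e d with hd | hd
    · exact ⟨fun _ F hF => diff_eq_zero_of_lt hp (hW hF) hd, fun _ => mem_of_gt d hd p hp⟩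
    constructor
    · rintro hpI _ ⟨F, hF, rfl⟩
      refine eq_zero_of_forall_coeff_zero_diff
        (isHomogeneous_diff hp F.2 (Nat.add_sub_cancel' hd)) fun r hr => ?_
      rw [← diff_mul]
      exact hF ⟨r * p, by simpa [Nat.sub_add_cancel hd] using hr.mul hp⟩
        (I.mul_mem_left r hpI)
    · intro hpA
      obtain ⟨n, hn⟩ : ∃ n, d + n = e := ⟨e - d, by omega⟩
      clear hd
      -- Descent from degree `e`, where double orthogonality gives the claim. Below `e`, if all
      -- products of `p` with the variables lie in `I`, then the class of `p` is in the socle, which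
      -- is zero there.
      induction n generalizing d p with
      | zero =>
        obtain rfl : d = e := by omega
        have h1 := LinearMap.BilinForm.orthogonal_orthogonal (pairing_nondegenerate d)
          (pairing_isSymm d).isRefl (idealPart I d)
        have h2 : (⟨p, hp⟩ : Forms k d) ∈ idealPart I d := by
          rw [← h1]
          intro F hF
          rw [← (pairing_isSymm d).eq]
          change coeff 0 (diff k p F) = 0
          rw [hpA F ⟨F, hF, rfl⟩, coeff_zero]
        exact h2
      | succ n ih =>
        have h1 : Ideal.Quotient.mk I p ∈ socle I ⊓ gradedPart I d := by
          refine ⟨fun i => ?_, ⟨p, hp, rfl⟩⟩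
          rw [← map_mul, Ideal.Quotient.eq_zero_iff_mem]
          exact ih (d + 1) (p * X i) (hp.mul (isHomogeneous_X k i))
            ((Ann W).mul_mem_right _ hpA) (by omega)
        rw [hsoc d (by omega), Submodule.mem_bot] at h1
        exact Ideal.Quotient.eq_zero_iff_mem.mp h1

end CharZero

end

/-! ### Rank bounds from the forms killing `F` and `G` -/

section

variable {k : Type*} [Field k]

theorem choose_two_succ (d : ℕ) : (d + 3).choose 2 = (d + 2).choose 2 + (d + 2) := by
  rw [Nat.choose_succ_succ' (d + 2) 1, Nat.choose_one_right, add_comm]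

theorem finrank_map_add_finrank_inf_ker {V V' : Type*} [AddCommGroup V] [Module k V]
    [AddCommGroup V'] [Module k V'] (M : Submodule k V) [FiniteDimensional k M] (g : V →ₗ[k] V') :
    Module.finrank k (M.map g) + Module.finrank k ↥(LinearMap.ker g ⊓ M) =
      Module.finrank k M := by
  rw [← LinearMap.finrank_range_add_finrank_ker (g.domRestrict M), LinearMap.range_domRestrict,
    LinearMap.ker_domRestrict, ← Submodule.finrank_map_subtype_eq M,
    Submodule.map_comap_subtype, inf_comm]

/-- A linear map that kills the multiples of a linear form has rank at most `j + 1` on the forms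
of degree `j`. -/
theorem finrank_map_forms_le_of_linear {V : Type*} [AddCommGroup V] [Module k V] {l : Poly k}
    (hl : l.IsHomogeneous 1) (h0 : l ≠ 0) (g : Poly k →ₗ[k] V) (hg : ∀ p, g (l * p) = 0) (j : ℕ) :
    Module.finrank k ((Forms k j).map g) ≤ j + 1 := by
  rcases j with - | j
  · exact (Submodule.finrank_map_le _ _).trans (by rw [finrank_forms]; simp)
  · have h := finrank_range_add_le hl h0 (g.domRestrict (Forms k (1 + j))) fun r => hg r
    rw [LinearMap.range_domRestrict] at h
    rw [add_comm j 1]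
    have := choose_two_succ j
    rw [show 1 + j + 2 = j + 3 by omega] at h
    omega

/-- A linear map that kills the multiples of a quadratic form has rank at most `2j + 1` on the
forms of degree `j`. -/
theorem finrank_map_forms_le_of_quadric {V : Type*} [AddCommGroup V] [Module k V] {q : Poly k}
    (hq : q.IsHomogeneous 2) (h0 : q ≠ 0) (g : Poly k →ₗ[k] V) (hg : ∀ p, g (q * p) = 0) (j : ℕ) :
    Module.finrank k ((Forms k j).map g) ≤ 2 * j + 1 := by
  rcases j with - | - | j
  · exact (Submodule.finrank_map_le _ _).trans (by rw [finrank_forms]; simp)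
  · exact (Submodule.finrank_map_le _ _).trans (by rw [finrank_forms]; decide)
  · have h := finrank_range_add_le hq h0 (g.domRestrict (Forms k (2 + j))) fun r => hg r
    rw [LinearMap.range_domRestrict] at h
    rw [show j + 1 + 1 = 2 + j by omega]
    have := choose_two_succ j
    have := choose_two_succ (j + 1)
    rw [show 2 + j + 2 = j + 1 + 3 by omega] at h
    rw [show j + 1 + 2 = j + 3 by omega] at this
    omega

theorem finrank_killed_le [CharZero k] {l : Poly k} (hl : l.IsHomogeneous 1) (h0 : l ≠ 0) (d : ℕ) :
    Module.finrank k ↥(LinearMap.ker (diff k l) ⊓ Forms k d) ≤ d + 1 := by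
  rcases d with - | d
  · exact (Submodule.finrank_mono inf_le_right).trans (by rw [finrank_forms]; simp)
  · have h := finrank_killed_add hl h0 d
    rw [add_comm d 1]
    have := choose_two_succ d
    rw [show 1 + d + 2 = d + 3 by omega] at h
    omega

/-- The linear map `p ↦ p ∘ F`. -/
noncomputable def diffOn (F : Poly k) : Poly k →ₗ[k] Poly k := (diff k).toLinearMap.flip F

theorem diffOn_apply (F p : Poly k) : diffOn F p = diff k p F := rfl

theorem invSys_span_pair (F G : Poly k) (j : ℕ) :
    invSys (Submodule.span k {F, G}) j =
      (Forms k j).map (diffOn F) ⊔ (Forms k j).map (diffOn G) := by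
  apply le_antisymm
  · refine invSys_le.mpr fun p hp H hH => ?_
    obtain ⟨a, b, rfl⟩ := Submodule.mem_span_pair.mp hH
    rw [map_add, map_smul, map_smul]
    have h : ∀ H, diff k p H ∈ (Forms k j).map (diffOn H) := fun H =>
      Submodule.mem_map_of_mem (f := diffOn H) hp
    exact add_mem (Submodule.mem_sup_left (Submodule.smul_mem _ _ (h F)))
      (Submodule.mem_sup_right (Submodule.smul_mem _ _ (h G)))
  · refine sup_le ?_ ?_ <;> rintro _ ⟨p, hp, rfl⟩ <;> rw [diffOn_apply] <;>
      exact diff_mem_invSys hp (Submodule.subset_span (by simp))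

/-! ### Members of the family -/

theorem mul_mem_Ann {F G l₁ l₂ : Poly k} (hF : diff k l₁ F = 0) (hG : diff k (l₁ * l₂) G = 0) :
    l₁ * l₂ ∈ Ann (Submodule.span k {F, G}) := by
  intro H hH
  obtain ⟨a, b, rfl⟩ := Submodule.mem_span_pair.mp hH
  rw [map_add, map_smul, map_smul, hG, mul_comm, diff_mul, hF]
  simp

/-- Applying `l₁` destroys the derivatives of `F` and turns those of `G` into derivatives of `l₁ ∘
G`. That form is killed by `l₂`, hence is binary in suitable coordinates. -/
theorem finrank_map_invSys_le {F G l₁ l₂ : Poly k}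
    (h2 : l₂.IsHomogeneous 1) (n2 : l₂ ≠ 0) (hF : diff k l₁ F = 0) (hG : diff k (l₁ * l₂) G = 0)
    (j : ℕ) :
    Module.finrank k ((invSys (Submodule.span k {F, G}) j).map (diff k l₁)) ≤ j + 1 := by
  have : (invSys (Submodule.span k {F, G}) j).map (diff k l₁) =
      (Forms k j).map (diffOn (diff k l₁ G)) := by
    have e : ∀ H p : Poly k, diff k l₁ (diff k p H) = diff k p (diff k l₁ H) := fun H p => by
      rw [← diff_mul, mul_comm, diff_mul]
    rw [invSys_span_pair, Submodule.map_sup, ← Submodule.map_comp, ← Submodule.map_comp]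
    have h3 : (diff k l₁) ∘ₗ diffOn F = 0 := by
      refine LinearMap.ext fun p => ?_
      change diff k l₁ (diff k p F) = 0
      rw [e, hF, map_zero]
    have h4 : (diff k l₁) ∘ₗ diffOn G = diffOn (diff k l₁ G) := LinearMap.ext fun p => e G p
    rw [h3, h4, Submodule.map_zero, bot_sup_eq]
  rw [this]
  refine finrank_map_forms_le_of_linear h2 n2 _ (fun p => ?_) j
  rw [diffOn_apply, ← diff_mul, show l₂ * p * l₁ = p * (l₁ * l₂) by ring, diff_mul, hG, map_zero]

/-- The three terms of the minimum have separate causes. The quadric `l₁ l₂` in the ideal gives `2d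
+ 1`. Kernel and image of `l₁` on the derivatives of order `j = e - d` give `(d + 1) + (j + 1) = e +
2`. Derivatives of `F` and of `G` counted separately give `(j + 1) + (2j + 1)`. -/
theorem hilb_le_hSeq [CharZero k] {F G l₁ l₂ : Poly k} (h1 : l₁.IsHomogeneous 1) (n1 : l₁ ≠ 0)
    (h2 : l₂.IsHomogeneous 1) (n2 : l₂ ≠ 0) (hF : diff k l₁ F = 0) (hG : diff k (l₁ * l₂) G = 0) {d
      e : ℕ} (hd : d ≤ e) (hW : Submodule.span k {F, G} ≤ Forms k e) :
    hilb (Ann (Submodule.span k {F, G})) d ≤ hSeq e d := by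
  obtain ⟨j, rfl⟩ : ∃ j, e = j + d := ⟨e - d, by omega⟩
  have hq := h1.mul h2
  have nq : l₁ * l₂ ≠ 0 := mul_ne_zero n1 n2
  have b1 : hilb (Ann (Submodule.span k {F, G})) d ≤ 2 * d + 1 :=
    finrank_map_forms_le_of_quadric hq nq _ (fun p => by
      have := Ideal.mul_mem_right p _ (mul_mem_Ann hF hG)
      exact Ideal.Quotient.eq_zero_iff_mem.mpr this) d
  have hle := invSys_le_forms hW rfl
  have : FiniteDimensional k (invSys (Submodule.span k {F, G}) j) :=
    Submodule.finiteDimensional_of_le hle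
  have hh := hilb_Ann hW rfl
  have b2 : hilb (Ann (Submodule.span k {F, G})) d ≤ j + d + 2 := by
    rw [hh, ← finrank_map_add_finrank_inf_ker _ (diff k l₁)]
    have := finrank_map_invSys_le h2 n2 hF hG j
    have h4 := finrank_killed_le h1 n1 d
    have h5 := Submodule.finrank_mono (R := k) (inf_le_inf_left (LinearMap.ker (diff k l₁)) hle)
    omega
  have b3 : hilb (Ann (Submodule.span k {F, G})) d ≤ 3 * j + 2 := by
    rw [hh, invSys_span_pair]
    have h3 := Submodule.finrank_add_le_finrank_add_finrank ((Forms k j).map (diffOn F))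
      ((Forms k j).map (diffOn G))
    have h4 := finrank_map_forms_le_of_linear h1 n1 (diffOn F) (fun p => by
      rw [diffOn_apply, mul_comm, diff_mul, hF, map_zero]) j
    have h5 := finrank_map_forms_le_of_quadric hq nq (diffOn G) (fun p => by
      rw [diffOn_apply, mul_comm, diff_mul, hG, map_zero]) j
    omega
  simp only [hSeq, Nat.add_sub_cancel_right]
  omega

/-- In a member of the family, multiplication by a linear form is not surjective from degree `d` to
degree `d + 1` when the Hilbert function is `e + 2` there. -/
theorem exists_killed_invSys [CharZero k] {F G l₁ l₂ : Poly k} (h1 : l₁.IsHomogeneous 1) (n1 : l₁ ≠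
    0)
    (h2 : l₂.IsHomogeneous 1) (n2 : l₂ ≠ 0) (hF : diff k l₁ F = 0) (hG : diff k (l₁ * l₂) G = 0) {d
      e j : ℕ} (hj : j + (d + 1) = e)
    (hW : Submodule.span k {F, G} ≤ Forms k e)
    (hd : hilb (Ann (Submodule.span k {F, G})) (d + 1) = e + 2) {l : Poly k}
    (hl : l.IsHomogeneous 1) :
    ∃ H ∈ invSys (Submodule.span k {F, G}) j, H ≠ 0 ∧ diff k l H = 0 := by
  set M := invSys (Submodule.span k {F, G}) j
  have hle : M ≤ Forms k (d + 1) := invSys_le_forms hW hj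
  have : FiniteDimensional k M := Submodule.finiteDimensional_of_le hle
  rw [hilb_Ann hW hj, ← finrank_map_add_finrank_inf_ker _ (diff k l₁)] at hd
  -- The image of `l₁` has dimension at most `j + 1`, so its kernel `K` has dimension at least `e +
  -- 2 - (j + 1) = d + 2`, one more than the space of forms of degree `d` killed by `l₁`, into which
  -- `l` maps `K`.
  have a1 := finrank_map_invSys_le h2 n2 hF hG j
  set K := LinearMap.ker (diff k l₁) ⊓ M
  have hK : K ≤ Forms k (d + 1) := inf_le_right.trans hle
  have : FiniteDimensional k K := Submodule.finiteDimensional_of_le hK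
  have a2 : K.map (diff k l) ≤ LinearMap.ker (diff k l₁) ⊓ Forms k d := by
    rintro _ ⟨H, hH, rfl⟩
    refine ⟨?_, isHomogeneous_diff hl (hK hH) (add_comm _ _)⟩
    have hH1 : diff k l₁ H = 0 := hH.1
    change diff k l₁ (diff k l H) = 0
    rw [← diff_mul, mul_comm, diff_mul, hH1, map_zero]
  have a3 := (Submodule.finrank_mono a2).trans (finrank_killed_le h1 n1 d)
  have a4 := finrank_map_add_finrank_inf_ker K (diff k l)
  have a5 : LinearMap.ker (diff k l) ⊓ K ≠ ⊥ := by
    intro h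
    rw [h, finrank_bot] at a4
    omega
  obtain ⟨H, hH, hne⟩ := Submodule.exists_mem_ne_zero_of_ne_bot a5
  exact ⟨H, hH.2.2, hne, hH.1⟩

theorem exists_span_pair_of_finrank_two {V : Type*} [AddCommGroup V] [Module k V]
    {W : Submodule k V} (h : Module.finrank k W = 2) : ∃ F G : V, W = Submodule.span k {F, G} := by
  have : FiniteDimensional k W := Module.finite_of_finrank_pos (by omega)
  let b := Module.finBasisOfFinrankEq k W h
  refine ⟨b 0, b 1, ?_⟩
  have h1 := congrArg (Submodule.map W.subtype) b.span_eq
  rw [Submodule.map_top, Submodule.range_subtype, Submodule.map_span] at h1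
  refine h1.symm.trans (congrArg _ ?_)
  ext x
  simp [Fin.exists_fin_two, eq_comm]

/-- Cancelling `x` gives `m = (b/a) l`, so the relation says that `l` kills `F + (b/a) G`; and `x
l`, a multiple of `q`, kills `G`. -/
theorem mem_family_of_relation {e : ℕ} {W : Gr k e} {F G l m x q : Poly k} {a b : k}
    (hW : W.1 = Submodule.span k {F, G}) (hl : l.IsHomogeneous 1) (hx : x.IsHomogeneous 1)
    (hrel : diff k l F + diff k m G = 0) (hqG : diff k q G = 0) (hx0 : x ≠ 0) (ha : a ≠ 0)
    (hl0 : l ≠ 0) (h1 : x * l = a • q) (h2 : x * m = b • q) : W ∈ family k e := by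
  have h3 : m = (b / a) • l := by
    apply mul_left_cancel₀ hx0
    rw [h2, mul_smul_comm, h1, smul_smul, div_mul_cancel₀ _ ha]
  refine ⟨F + (b / a) • G, G, l, x, ?_, hl0, hl, hx0, hx, ?_, ?_⟩
  · rw [hW]
    apply le_antisymm <;> rw [Submodule.span_le] <;> rintro y (rfl | rfl) <;>
      rw [SetLike.mem_coe, Submodule.mem_span_pair]
    · exact ⟨1, -(b / a), by simp⟩
    · exact ⟨0, 1, by simp⟩
    · exact ⟨1, b / a, by simp⟩
    · exact ⟨0, 1, by simp⟩
  · rw [map_add, map_smul, ← hrel, h3, map_smul, LinearMap.smul_apply]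
  · rw [mul_comm, h1, map_smul, LinearMap.smul_apply, hqG, smul_zero]

section CharZero

variable [CharZero k]

/-- With equal dimensions in degrees `d` and `d + 1`, maximal rank means surjectivity. But every
multiple of `l` pairs to zero with a form `H` that `l` kills. -/
theorem not_hasWLP_of_killed {W : Submodule k (Poly k)} {d e j : ℕ} (hW : W ≤ Forms k e)
    (hj : j + (d + 1) = e) (hd : hilb (Ann W) d = hilb (Ann W) (d + 1))
    (h : ∀ l : Poly k, l.IsHomogeneous 1 → ∃ H ∈ invSys W j, H ≠ 0 ∧ diff k l H = 0) :
    ¬ HasWLP (Ann W) e := by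
  rintro ⟨l, hl, hwlp⟩
  obtain ⟨H, hH, hne, hlH⟩ := h l hl
  have h1 := hwlp d (by omega)
  rw [hd, min_self] at h1
  have : FiniteDimensional k (gradedPart (Ann W) (d + 1)) := by
    unfold gradedPart; infer_instance
  have hle : LinearMap.range (mulMap (Ann W) l d) ≤ gradedPart (Ann W) (d + 1) := by
    rintro _ ⟨⟨_, p, hp, rfl⟩, rfl⟩
    exact ⟨l * p, by simpa [add_comm] using hl.mul hp, map_mul (Ideal.Quotient.mk (Ann W)) _ _⟩
  have heq := Submodule.eq_of_le_of_finrank_eq hle h1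
  apply hne
  have hI : ∀ p ∈ Ann W, diff k p H = 0 := by
    intro p hp
    have h2 : invSys W j ≤ LinearMap.ker (diff k p) := invSys_le.mpr fun q hq G hG => by
      have h3 : diff k p G = 0 := hp G hG
      rw [LinearMap.mem_ker, ← diff_mul, mul_comm, diff_mul, h3, map_zero]
    exact h2 hH
  refine eq_zero_of_forall_coeff_zero_diff (invSys_le_forms hW hj hH) fun p hp => ?_
  have h2 : Ideal.Quotient.mk (Ann W) p ∈ LinearMap.range (mulMap (Ann W) l d) := by
    rw [heq]; exact ⟨p, hp, rfl⟩
  obtain ⟨⟨_, r, hr, rfl⟩, h3⟩ := h2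
  have h4 : p - l * r ∈ Ann W := by
    rw [← Ideal.Quotient.eq]
    exact h3.symm
  have h5 := hI _ h4
  rw [map_sub, LinearMap.sub_apply, mul_comm, diff_mul, hlH, map_zero, sub_zero] at h5
  rw [h5, coeff_zero]

/-! ### Level algebras with the extremal Hilbert function -/

theorem mem_family_of_hilb {e : ℕ} (he : 6 ≤ e) (W : Gr k e)
    (h2 : hilb (Ann W.1) 2 = 5) (h3 : hilb (Ann W.1) (e - 1) = 5)
    (h4 : hilb (Ann W.1) (e - 2) = 8) : W ∈ family k e := by
  obtain ⟨F, G, hFG⟩ := exists_span_pair_of_finrank_two W.2.2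
  obtain ⟨q, hq, nq⟩ : ∃ q ∈ idealPart (Ann W.1) 2, q ≠ 0 := by
    apply Submodule.exists_mem_ne_zero_of_ne_bot
    intro h
    have := hilb_add_finrank_idealPart (Ann W.1) 2
    rw [h, h2, finrank_bot] at this
    exact absurd this (by decide)
  -- The kernel of `Ψ j` is the space of relations of degree `j` between `F` and `G`; its range is
  -- the space of derivatives of order `j`.
  let Ψ : ∀ j, (Forms k j × Forms k j) →ₗ[k] Poly k := fun j =>
    ((diffOn F).domRestrict (Forms k j)).coprod ((diffOn G).domRestrict (Forms k j))
  have hΨ : ∀ j p, Ψ j p = diff k p.1 F + diff k p.2 G := fun j p => rfl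
  have hrank : ∀ j, j ≤ e → Module.finrank k (LinearMap.ker (Ψ j)) + hilb (Ann W.1) (e - j) =
      2 * (j + 2).choose 2 := by
    intro j hj
    rw [hilb_Ann W.2.1 (Nat.add_sub_cancel' hj), hFG, invSys_span_pair, ← finrank_forms (k := k),
      two_mul, ← Module.finrank_prod (R := k) (M := Forms k j) (M' := Forms k j),
      ← LinearMap.finrank_range_add_finrank_ker (Ψ j),
      LinearMap.range_coprod, LinearMap.range_domRestrict, LinearMap.range_domRestrict, add_comm]
  have r1 := hrank 1 (by omega)
  have r2 := hrank 2 (by omega)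
  rw [h3] at r1
  rw [h4] at r2
  obtain ⟨⟨l, m⟩, hlm, nlm⟩ : ∃ x ∈ LinearMap.ker (Ψ 1), x ≠ 0 := by
    apply Submodule.exists_mem_ne_zero_of_ne_bot
    intro h
    rw [h, finrank_bot] at r1
    exact absurd r1 (by decide)
  have hlm' : diff k l F + diff k m G = 0 := hlm
  have hqF : diff k q F = 0 := hq F (hFG ▸ Submodule.subset_span (by simp))
  have hqG : diff k q G = 0 := hq G (hFG ▸ Submodule.subset_span (by simp))
  let α : (k × k) →ₗ[k] (Forms k 2 × Forms k 2) :=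
    ((LinearMap.toSpanSingleton k _ q).prodMap (LinearMap.toSpanSingleton k _ q))
  let β : Forms k 1 →ₗ[k] (Forms k 2 × Forms k 2) := (mulForms l.2 1).prod (mulForms m.2 1)
  have hα : ∀ x, α x = (x.1 • q, x.2 • q) := fun x => rfl
  have hβ : ∀ x, β x = (mulForms l.2 1 x, mulForms m.2 1 x) := fun x => rfl
  have nlm' : l ≠ 0 ∨ m ≠ 0 := by
    by_contra! h
    exact nlm (Prod.ext h.1 h.2)
  have iα : Function.Injective α := by
    rw [← LinearMap.ker_eq_bot, LinearMap.ker_eq_bot']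
    rintro ⟨a, b⟩ h
    simpa [hα, nq] using h
  have iβ : Function.Injective β := by
    intro x y hxy
    rw [hβ, hβ, Prod.mk.injEq] at hxy
    rcases nlm' with h | h
    · exact mulForms_injective l.2 (by simpa using h) 1 hxy.1
    · exact mulForms_injective m.2 (by simpa using h) 1 hxy.2
  have lα : LinearMap.range α ≤ LinearMap.ker (Ψ 2) := by
    rintro _ ⟨x, rfl⟩
    simp [hΨ, hα, hqF, hqG]
  have lβ : LinearMap.range β ≤ LinearMap.ker (Ψ 2) := by
    rintro _ ⟨x, rfl⟩
    rw [LinearMap.mem_ker, hΨ]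
    change diff k (l * x) F + diff k (m * x) G = 0
    rw [mul_comm, diff_mul, mul_comm, diff_mul, ← map_add, hlm', map_zero]
  -- The quadratic relations have dimension `12 - 8 = 4`, whereas the multiples of `q` and of `(l,
  -- m)` have dimensions 2 and 3.
  have hne : LinearMap.range α ⊓ LinearMap.range β ≠ ⊥ := by
    intro h
    have d1 := Submodule.finrank_sup_add_finrank_inf_eq (LinearMap.range α) (LinearMap.range β)
    have d2 := Submodule.finrank_mono (sup_le lα lβ)
    rw [LinearMap.finrank_range_of_inj iα, LinearMap.finrank_range_of_inj iβ, h, finrank_bot,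
      finrank_forms, Module.finrank_prod, Module.finrank_self] at d1
    have : (1 + 2).choose 2 = 3 := rfl
    have : (2 + 2).choose 2 = 6 := rfl
    omega
  obtain ⟨_, ⟨⟨⟨a, b⟩, rfl⟩, ⟨x, hx⟩⟩, hne'⟩ := Submodule.exists_mem_ne_zero_of_ne_bot hne
  have e1 : (x : Poly k) * l = a • (q : Poly k) := by
    rw [mul_comm]; exact congrArg (fun y => ((y.1 : Forms k 2) : Poly k)) hx
  have e2 : (x : Poly k) * m = b • (q : Poly k) := by
    rw [mul_comm]; exact congrArg (fun y => ((y.2 : Forms k 2) : Poly k)) hx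
  have nx : (x : Poly k) ≠ 0 := by
    intro h
    have : x = 0 := Subtype.ext h
    rw [this, map_zero] at hx
    exact hne' hx.symm
  have nq' : (q : Poly k) ≠ 0 := fun h => nq (Subtype.ext h)
  -- A common element gives `x l = a q` and `x m = b q` with `a`, `b` not both zero. If `a = 0`,
  -- then `F` and `G` exchange roles.
  by_cases ha : a = 0
  · have hb : b ≠ 0 := by
      rintro rfl
      exact hne' (by rw [ha, hα]; simp)
    refine mem_family_of_relation (a := b) (b := a) (by rw [hFG, Set.pair_comm]) m.2 x.2
      (by rw [add_comm]; exact hlm') hqF nx hb ?_ e2 e1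
    intro h
    rw [h, mul_zero] at e2
    exact smul_ne_zero hb nq' e2.symm
  · refine mem_family_of_relation hFG l.2 x.2 hlm' hqG nx ha ?_ e1 e2
    intro h
    rw [h, mul_zero] at e1
    exact smul_ne_zero ha nq' e1.symm

/-- Only the entries in degrees `2`, `e - 2`, `e - 1` and `e` enter. The bound `6 ≤ e` is what makes
the entry in degree `e - 2` equal to 8. -/
theorem exists_mem_family_eq_Ann {e : ℕ} (he : 6 ≤ e) {I : Ideal (Poly k)} (hI : IsLevel I e)
    (hh : HasHVector I e (hSeq e)) : ∃ W ∈ family k e, I = Ann W.1 := by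
  obtain ⟨W, hW, hr, rfl⟩ := hI.exists_eq_Ann
  have key : ∀ d ≤ e, ∀ n, hSeq e d = n → hilb (Ann W) d = n := fun d hd n h => h ▸ hh.1 d hd
  rw [key e le_rfl 2 (by simp only [hSeq]; omega)] at hr
  exact ⟨⟨W, hW, hr⟩, mem_family_of_hilb he _ (key _ (by omega) _ (by simp only [hSeq]; omega))
    (key _ (by omega) _ (by simp only [hSeq]; omega))
    (key _ (by omega) _ (by simp only [hSeq]; omega)), rfl⟩

theorem not_hasWLP {e : ℕ} (he : (Odd e ∧ 9 ≤ e) ∨ (Even e ∧ 12 ≤ e)) {I : Ideal (Poly k)}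
    (hI : IsLevel I e) (hh : HasHVector I e (hSeq e)) : ¬ HasWLP I e := by
  obtain ⟨W, ⟨F, G, l₁, l₂, hFG, n1, h1, n2, h2, hF, hG⟩, rfl⟩ :=
    exists_mem_family_eq_Ann (by omega) hI hh
  -- The plateau of value `e + 2` must contain two consecutive degrees. It starts by `e / 2 + 1` and
  -- must reach `e / 2 + 2`, which requires `e ≥ 9` for odd and `e ≥ 12` for even `e`.
  obtain ⟨d, hd, hd1, hd2⟩ : ∃ d, d + 1 ≤ e ∧ hSeq e d = e + 2 ∧ hSeq e (d + 1) = e + 2 := by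
    refine ⟨e / 2 + 1, by omega, ?_, ?_⟩ <;> simp only [hSeq] <;> rcases he with ⟨⟨a, ha⟩, h⟩ |
        ⟨⟨a, ha⟩, h⟩ <;> omega
  obtain ⟨j, hj⟩ : ∃ j, j + (d + 1) = e := ⟨e - (d + 1), by omega⟩
  rw [← hh.1 _ (by omega)] at hd1 hd2
  have hW := W.2.1
  rw [hFG] at *
  exact not_hasWLP_of_killed hW hj (hd1.trans hd2.symm) fun l hl =>
    exists_killed_invSys h1 n1 h2 n2 hF hG hj hW hd2 hl

end CharZero

end

section

/-! ### Krull dimension of subalgebras of polynomial rings -/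

/-- Contraction of primes along an integral map is strictly monotone (incomparability). -/
theorem ringKrullDim_le_of_isIntegral {A B : Type*} [CommRing A] [CommRing B] (g : A →+* B)
    (hg : g.IsIntegral) : ringKrullDim B ≤ ringKrullDim A := by
  let _ := g.toAlgebra
  have : Algebra.IsIntegral A B := ⟨hg⟩
  refine Order.krullDim_le_of_strictMono (PrimeSpectrum.comap g) fun p q hpq => ?_
  exact Ideal.IsIntegral.comap_lt_comap hpq

/-- By Noether normalization the subalgebra is integral over a polynomial ring, whose number of
variables is bounded by transcendence degree. -/
theorem ringKrullDim_subalgebra_le {k : Type*} [Field k] {ι : Type*} [Fintype ι]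
    (C : Subalgebra k (MvPolynomial ι k)) (hC : C.FG) :
    ringKrullDim C ≤ Fintype.card ι := by
  have : Algebra.FiniteType k C := C.fg_iff_finiteType.mp hC
  obtain ⟨s, g, hinj, hint⟩ := exists_integral_inj_algHom_of_fg k C
  refine (ringKrullDim_le_of_isIntegral g.toRingHom hint).trans ?_
  rw [MvPolynomial.ringKrullDim_of_isNoetherianRing, ringKrullDim_eq_zero_of_field, zero_add]
  have h1 := lift_trdeg_le_of_injective (C.val.comp g)
    (Subtype.val_injective.comp hinj)
  rw [MvPolynomial.trdeg_of_isDomain, MvPolynomial.trdeg_of_isDomain] at h1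
  simp at h1
  simpa using h1

variable {k : Type*} [Field k]

/-! ### Plücker coordinates -/

variable (k) in
/-- The polynomials in the Plücker coordinates. -/
abbrev PlueckerPoly : Type _ := MvPolynomial ((Fin 3 →₀ ℕ) × (Fin 3 →₀ ℕ)) k

theorem pluecker_comb (F G : Poly k) (a b c d : k) :
    pluecker (a • F + b • G) (c • F + d • G) = (a * d - b * c) • pluecker F G := by
  ext mn
  simp only [pluecker, coeff_add, coeff_smul, smul_eq_mul, Pi.smul_apply]
  ring

theorem finrank_span_pair_eq_two_iff {V : Type*} [AddCommGroup V] [Module k V] {F G : V} :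
    Module.finrank k (Submodule.span k {F, G}) = 2 ↔ LinearIndependent k ![F, G] := by
  rw [linearIndependent_iff_card_eq_finrank_span, Fintype.card_fin, Set.finrank,
    Matrix.range_cons, Matrix.range_cons, Matrix.range_empty, Set.union_empty,
    Set.singleton_union, eq_comm]

theorem finrank_span_pair_eq_two_iff_pluecker {F G : Poly k} :
    Module.finrank k (Submodule.span k {F, G}) = 2 ↔ ∃ mn, pluecker F G mn ≠ 0 := by
  rw [finrank_span_pair_eq_two_iff, LinearIndependent.pair_iff]
  constructor
  · intro h
    by_contra! h0
    by_cases hF : F = 0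
    · have := (h 1 0 (by simp [hF])).1
      exact one_ne_zero this
    · obtain ⟨m, hm⟩ := MvPolynomial.ne_zero_iff.mp hF
      refine hm (neg_eq_zero.mp ((h (coeff m G) (-coeff m F) ?_).2))
      ext n
      have := h0 (m, n)
      simp only [pluecker] at this
      simp only [coeff_add, coeff_smul, smul_eq_mul, coeff_zero]
      linear_combination -this
  · rintro ⟨⟨m, n⟩, h⟩ s t hst
    have hm := congrArg (coeff m) hst
    have hn := congrArg (coeff n) hst
    simp only [coeff_add, coeff_smul, smul_eq_mul, coeff_zero] at hm hn
    simp only [pluecker] at h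
    constructor
    · apply (mul_eq_zero.mp _).resolve_right h
      linear_combination coeff n G * hm - coeff m G * hn
    · apply (mul_eq_zero.mp _).resolve_right h
      linear_combination coeff m F * hn - coeff n F * hm

theorem exists_pluecker_eq_smul {F G F' G' : Poly k} (hr : Module.finrank k (Submodule.span k {F',
    G'}) = 2)
    (h : Submodule.span k {F', G'} = Submodule.span k {F, G}) :
    ∃ s : k, s ≠ 0 ∧ pluecker F' G' = s • pluecker F G := by
  have hF : F' ∈ Submodule.span k {F, G} := h ▸ Submodule.subset_span (by simp)
  have hG : G' ∈ Submodule.span k {F, G} := h ▸ Submodule.subset_span (by simp)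
  obtain ⟨a, b, rfl⟩ := Submodule.mem_span_pair.mp hF
  obtain ⟨c, d, rfl⟩ := Submodule.mem_span_pair.mp hG
  refine ⟨a * d - b * c, ?_, pluecker_comb F G a b c d⟩
  obtain ⟨mn, hmn⟩ := finrank_span_pair_eq_two_iff_pluecker.mp hr
  intro h0
  rw [pluecker_comb, h0] at hmn
  simp at hmn

theorem span_smul_pair {V : Type*} [AddCommGroup V] [Module k V] (F G : V) {s : k} (hs : s ≠ 0) :
    Submodule.span k {s • F, G} = Submodule.span k {F, G} := by
  rw [Submodule.span_insert, Submodule.span_insert, Submodule.span_singleton_smul_eq hs.isUnit]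

theorem pluecker_smul_left (F G : Poly k) (s : k) : pluecker (s • F) G = s • pluecker F G := by
  simpa using pluecker_comb F G s 0 0 1

/-! ### The Zariski topology -/

theorem eval_smul_of_isHomogeneous {σ : Type*} {P : MvPolynomial σ k} {n : ℕ}
    (hP : P.IsHomogeneous n) (s : k) (v : σ → k) : eval (s • v) P = s ^ n * eval v P := by
  rw [eval_eq, eval_eq, Finset.mul_sum]
  refine Finset.sum_congr rfl fun m hm => ?_
  simp only [Pi.smul_apply, smul_eq_mul, mul_pow, Finset.prod_mul_distrib,
    Finset.prod_pow_eq_pow_sum]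
  rw [← hP.degree_eq_sum_deg_support hm]
  ring

theorem mem_basicOpen_iff {e n : ℕ} {P : PlueckerPoly k} (hP : P.IsHomogeneous n) {W : Gr k e}
    {F G : Poly k} (hW : W.1 = Submodule.span k {F, G}) :
    W ∈ basicOpen e P ↔ eval (pluecker F G) P ≠ 0 := by
  constructor
  · rintro ⟨F', G', h, hne⟩ h0
    have hr := W.2.2
    rw [h] at hr
    obtain ⟨s, -, hs⟩ := exists_pluecker_eq_smul hr (h.symm.trans hW)
    rw [hs, eval_smul_of_isHomogeneous hP, h0, mul_zero] at hne
    exact hne rfl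
  · exact fun h => ⟨F, G, hW, h⟩

/-- Along the line through `v`, `P` becomes a polynomial in `s` whose coefficients are the values at
`v` of its homogeneous components. One nonzero coefficient suffices over an infinite field. -/
theorem exists_eval_smul_ne_zero [Infinite k] {σ : Type*} (P : MvPolynomial σ k) (v : σ → k) {n : ℕ}
    (h : eval v (homogeneousComponent n P) ≠ 0) : ∃ s : k, s ≠ 0 ∧ eval (s • v) P ≠ 0 := by
  let p : Polynomial k := ∑ i ∈ Finset.range (P.totalDegree + 1),
    Polynomial.monomial i (eval v (homogeneousComponent i P))
  have hp : ∀ s, p.eval s = eval (s • v) P := by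
    intro s
    conv_rhs => rw [← sum_homogeneousComponent P]
    rw [map_sum, Polynomial.eval_finsetSum]
    refine Finset.sum_congr rfl fun i _ => ?_
    rw [Polynomial.eval_monomial,
      eval_smul_of_isHomogeneous (homogeneousComponent_isHomogeneous i P), mul_comm]
  have hp0 : p ≠ 0 := by
    intro h0
    have h1 := congrArg (Polynomial.coeff · n) h0
    simp only [p, Polynomial.finsetSum_coeff, Polynomial.coeff_monomial, Finset.sum_ite_eq',
      Finset.mem_range, Polynomial.coeff_zero] at h1
    split_ifs at h1 with h2
    · exact h h1
    · rw [homogeneousComponent_eq_zero _ _ (by omega)] at h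
      simp at h
  by_contra! hs
  -- The extra factor excludes `s = 0`.
  have : p * Polynomial.X = 0 := by
    apply Polynomial.funext
    intro s
    rw [Polynomial.eval_mul, hp, Polynomial.eval_X, Polynomial.eval_zero]
    by_cases h0 : s = 0
    · rw [h0, mul_zero]
    · rw [hs s h0, zero_mul]
  exact hp0 ((mul_eq_zero.mp this).resolve_right Polynomial.X_ne_zero)

/-- The nonvanishing locus of any polynomial in the Plücker coordinates is open, as its
nonvanishing on some basis is the nonvanishing of some homogeneous component. -/
theorem isOpen_basicOpen [Infinite k] (e : ℕ) (P : PlueckerPoly k) : IsOpen (basicOpen e P) := by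
  have : basicOpen e P = ⋃ n, basicOpen e (homogeneousComponent n P) := by
    ext W
    rw [Set.mem_iUnion]
    constructor
    · rintro ⟨F, G, hW, h⟩
      by_contra! h0
      apply h
      rw [← sum_homogeneousComponent P, map_sum]
      refine Finset.sum_eq_zero fun i _ => ?_
      by_contra h1
      exact h0 i ⟨F, G, hW, h1⟩
    · rintro ⟨n, F, G, hW, h⟩
      obtain ⟨s, hs, h1⟩ := exists_eval_smul_ne_zero P _ h
      exact ⟨s • F, G, by rw [span_smul_pair F G hs, hW], by rwa [pluecker_smul_left]⟩
  rw [this]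
  exact isOpen_iUnion fun n => TopologicalSpace.isOpen_generateFrom_of_mem
    ⟨n, _, homogeneousComponent_isHomogeneous n P, rfl⟩

theorem isTopologicalBasis_basicOpen (e : ℕ) : TopologicalSpace.IsTopologicalBasis
    {U : Set (Gr k e) | ∃ (n : ℕ) (P : PlueckerPoly k), P.IsHomogeneous n ∧ U = basicOpen e P} where
  exists_subset_inter := by
    rintro _ ⟨n, P, hP, rfl⟩ _ ⟨m, Q, hQ, rfl⟩ W ⟨h1, h2⟩
    obtain ⟨F, G, hW, h1⟩ := h1
    rw [mem_basicOpen_iff hQ hW] at h2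
    refine ⟨_, ⟨n + m, P * Q, hP.mul hQ, rfl⟩, ⟨F, G, hW, ?_⟩, ?_⟩
    · rw [map_mul]
      exact mul_ne_zero h1 h2
    rintro W' ⟨F', G', hW', h⟩
    rw [map_mul] at h
    exact ⟨⟨F', G', hW', left_ne_zero_of_mul h⟩, ⟨F', G', hW', right_ne_zero_of_mul h⟩⟩
  sUnion_eq := by
    rw [Set.sUnion_eq_univ_iff]
    intro W
    obtain ⟨F, G, h⟩ := exists_span_pair_of_finrank_two W.2.2
    exact ⟨_, ⟨0, 1, isHomogeneous_one _ _, rfl⟩, F, G, h, by simp⟩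
  eq_generateFrom := rfl

/-! ### Polynomial families of planes -/

section Param

variable {σ : Type*}

/-- The Plücker coordinates of a pair of forms with polynomial coefficients. -/
noncomputable def plueckerPoly (F G : MvPolynomial (Fin 3) (MvPolynomial σ k)) :
    (Fin 3 →₀ ℕ) × (Fin 3 →₀ ℕ) → MvPolynomial σ k :=
  fun mn => coeff mn.1 F * coeff mn.2 G - coeff mn.2 F * coeff mn.1 G

theorem eval_plueckerPoly (F G : MvPolynomial (Fin 3) (MvPolynomial σ k)) (t : σ → k)
    (mn : (Fin 3 →₀ ℕ) × (Fin 3 →₀ ℕ)) :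
    eval t (plueckerPoly F G mn) = pluecker (map (eval t) F) (map (eval t) G) mn := by
  simp [plueckerPoly, pluecker, coeff_map]

theorem eval_bind₁_plueckerPoly (F G : MvPolynomial (Fin 3) (MvPolynomial σ k)) (t : σ → k)
    (P : PlueckerPoly k) : eval t (bind₁ (plueckerPoly F G) P) =
      eval (pluecker (map (eval t) F) (map (eval t) G)) P := by
  have h := aeval_bind₁ (R := k) (S := k) t (plueckerPoly F G) P
  simp only [aeval_eq_eval] at h
  rw [h]
  congr 2
  ext mn
  exact eval_plueckerPoly F G t mn

/-- The planes `⟨F_t, G_t⟩` of a polynomial family of pairs of forms, for the parameters `t` with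
`D(t) ≠ 0`. -/
def paramSet (e : ℕ) (F G : MvPolynomial (Fin 3) (MvPolynomial σ k)) (D : MvPolynomial σ k) :
    Set (Gr k e) :=
  {W | ∃ t : σ → k, eval t D ≠ 0 ∧ W.1 = Submodule.span k {map (eval t) F, map (eval t) G}}

variable {e : ℕ} {F G : MvPolynomial (Fin 3) (MvPolynomial σ k)}

/-- The planes of a polynomial family that lie in a given open set are those of a nonempty open
set of parameters. -/
theorem exists_ne_zero_of_mem_open (hF : F.IsHomogeneous e) (hG : G.IsHomogeneous e)
    {U : Set (Gr k e)} (hU : IsOpen U) {W : Gr k e} (hWU : W ∈ U) {t₀ : σ → k}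
    (hW : W.1 = Submodule.span k {map (eval t₀) F, map (eval t₀) G}) :
    ∃ Q : MvPolynomial σ k, Q ≠ 0 ∧ ∀ t, eval t Q ≠ 0 →
      ∃ W' ∈ U, W'.1 = Submodule.span k {map (eval t) F, map (eval t) G} := by
  obtain ⟨_, ⟨n, P, hP, rfl⟩, hWP, hPU⟩ :=
    (isTopologicalBasis_basicOpen e).exists_subset_of_mem_open hWU hU
  rw [mem_basicOpen_iff hP hW] at hWP
  have hr := W.2.2
  rw [hW, finrank_span_pair_eq_two_iff_pluecker] at hr
  obtain ⟨mn, hmn⟩ := hr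
  have hval : ∀ t, eval t (bind₁ (plueckerPoly F G) P * plueckerPoly F G mn) =
      eval (pluecker (map (eval t) F) (map (eval t) G)) P *
        pluecker (map (eval t) F) (map (eval t) G) mn := fun t => by
    rw [map_mul, eval_bind₁_plueckerPoly, eval_plueckerPoly]
  -- The first factor keeps the plane inside the neighbourhood; the Plücker coordinate keeps the two
  -- forms independent.
  refine ⟨bind₁ (plueckerPoly F G) P * plueckerPoly F G mn, ?_, fun t ht => ?_⟩
  · intro h0
    have := hval t₀
    rw [h0, map_zero] at this
    exact mul_ne_zero hWP hmn this.symm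
  · rw [hval] at ht
    have hle : Submodule.span k {map (eval t) F, map (eval t) G} ≤ homogeneousSubmodule (Fin 3) k e
        := by
      rw [Submodule.span_le]
      rintro _ (rfl | rfl)
      · exact hF.map _
      · exact hG.map _
    exact ⟨⟨_, hle, finrank_span_pair_eq_two_iff_pluecker.mpr ⟨mn, right_ne_zero_of_mul ht⟩⟩,
      hPU ⟨_, _, rfl, left_ne_zero_of_mul ht⟩, rfl⟩

theorem exists_eval_ne_zero [Infinite k] {P : MvPolynomial σ k} (h : P ≠ 0) :
    ∃ t, eval t P ≠ 0 := by
  by_contra! h0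
  exact h (MvPolynomial.funext fun t => by rw [h0, map_zero])

/-- The degeneration principle: `D` may vanish at `t₀`. Each neighbourhood of `W` contains the
planes with `Q(t) ≠ 0` for some nonzero `Q`, and `Q * D` is a nonzero polynomial over an infinite
field. -/
theorem mem_closure_paramSet [Infinite k] (hF : F.IsHomogeneous e) (hG : G.IsHomogeneous e)
    {D : MvPolynomial σ k} (hD : D ≠ 0) {W : Gr k e} {t₀ : σ → k}
    (hW : W.1 = Submodule.span k {map (eval t₀) F, map (eval t₀) G}) :
    W ∈ closure (paramSet e F G D) := by
  rw [mem_closure_iff]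
  intro U hU hWU
  obtain ⟨Q, hQ, h⟩ := exists_ne_zero_of_mem_open hF hG hU hWU hW
  obtain ⟨t, ht⟩ := exists_eval_ne_zero (mul_ne_zero hQ hD)
  rw [map_mul] at ht
  obtain ⟨W', hU', hW'⟩ := h t (left_ne_zero_of_mul ht)
  exact ⟨W', hU', t, right_ne_zero_of_mul ht, hW'⟩

theorem isPreirreducible_paramSet [Infinite k] (hF : F.IsHomogeneous e) (hG : G.IsHomogeneous e)
    (D : MvPolynomial σ k) : IsPreirreducible (paramSet e F G D) := by
  rintro U V hU hV ⟨W₁, ⟨t₁, hD₁, hW₁⟩, hU₁⟩ ⟨W₂, ⟨t₂, -, hW₂⟩, hV₂⟩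
  obtain ⟨P, hP, h1⟩ := exists_ne_zero_of_mem_open hF hG hU hU₁ hW₁
  obtain ⟨Q, hQ, h2⟩ := exists_ne_zero_of_mem_open hF hG hV hV₂ hW₂
  have hD : D ≠ 0 := by rintro rfl; simp at hD₁
  obtain ⟨t, ht⟩ := exists_eval_ne_zero (mul_ne_zero (mul_ne_zero hP hQ) hD)
  rw [map_mul, map_mul] at ht
  obtain ⟨W', hU', hW'⟩ := h1 t (left_ne_zero_of_mul (left_ne_zero_of_mul ht))
  obtain ⟨W'', hV', hW''⟩ := h2 t (right_ne_zero_of_mul (left_ne_zero_of_mul ht))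
  obtain rfl : W' = W'' := Subtype.ext (hW'.trans hW''.symm)
  exact ⟨W', ⟨t, right_ne_zero_of_mul ht, hW'⟩, hU', hV'⟩

/-! ### The dimension of a polynomial family -/

/-- The ideal of the cone over a set of planes. -/
noncomputable def coneIdeal (Z : Set (Gr k e)) : Ideal (PlueckerPoly k) where
  carrier := {P | Disjoint Z (basicOpen e P)}
  zero_mem' := by
    rw [Set.mem_ofPred_eq, Set.disjoint_left]
    rintro W - ⟨F, G, -, h⟩
    simp at h
  add_mem' := by
    intro P Q hP hQ
    rw [Set.mem_ofPred_eq, Set.disjoint_left] at *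
    rintro W hW ⟨F, G, hFG, h⟩
    rw [map_add] at h
    by_cases h1 : eval (pluecker F G) P = 0
    · rw [h1, zero_add] at h
      exact hQ hW ⟨F, G, hFG, h⟩
    · exact hP hW ⟨F, G, hFG, h1⟩
  smul_mem' := by
    intro Q P hP
    rw [Set.mem_ofPred_eq, Set.disjoint_left] at *
    rintro W hW ⟨F, G, hFG, h⟩
    rw [smul_eq_mul, map_mul] at h
    exact hP hW ⟨F, G, hFG, right_ne_zero_of_mul h⟩

theorem mem_coneIdeal {Z : Set (Gr k e)} {P : PlueckerPoly k} :
    P ∈ coneIdeal Z ↔ Disjoint Z (basicOpen e P) := Iff.rfl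

theorem eval_smul_ne_zero_of_mem_basicOpen {W : Gr k e} {F G : Poly k} {P : PlueckerPoly k}
    (hW : W.1 = Submodule.span k {F, G}) (h : W ∈ basicOpen e P) :
    ∃ s : k, s ≠ 0 ∧ eval (s • pluecker F G) P ≠ 0 := by
  obtain ⟨F', G', h1, h2⟩ := h
  have hr := W.2.2
  rw [h1] at hr
  obtain ⟨s, hs, h3⟩ := exists_pluecker_eq_smul hr (h1.symm.trans hW)
  exact ⟨s, hs, h3 ▸ h2⟩

/-- Restricted to the line through `v`, both polynomials become nonzero polynomials in one variable,
so their product has a nonzero value at some nonzero parameter. -/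
theorem exists_mul_eval_smul_ne_zero [Infinite k] {τ : Type*} (P Q : MvPolynomial τ k) (v : τ → k)
    {s t : k}
    (hs : eval (s • v) P ≠ 0) (ht : eval (t • v) Q ≠ 0) :
    ∃ r : k, r ≠ 0 ∧ eval (r • v) (P * Q) ≠ 0 := by
  let φ : MvPolynomial τ k →ₐ[k] Polynomial k := aeval fun i => Polynomial.C (v i) * Polynomial.X
  have hφ : ∀ (R : MvPolynomial τ k) (r : k), (φ R).eval r = eval (r • v) R := by
    intro R r
    have : (Polynomial.aeval r).comp φ = (aeval (r • v) : MvPolynomial τ k →ₐ[k] k) := by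
      refine MvPolynomial.algHom_ext fun i => ?_
      simp only [φ, AlgHom.comp_apply, aeval_X, map_mul, Polynomial.aeval_C, Polynomial.aeval_X,
        Algebra.algebraMap_self, RingHom.id_apply, Pi.smul_apply, smul_eq_mul]
      ring
    have h := DFunLike.congr_fun this R
    simpa [Polynomial.coe_aeval_eq_eval, aeval_eq_eval] using h
  have hP : φ P ≠ 0 := by
    intro h; rw [← hφ, h] at hs; simp at hs
  have hQ : φ Q ≠ 0 := by
    intro h; rw [← hφ, h] at ht; simp at ht
  by_contra! h
  refine mul_ne_zero (mul_ne_zero hP hQ) Polynomial.X_ne_zero (Polynomial.funext fun r => ?_)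
  rw [← map_mul, Polynomial.eval_mul, hφ, Polynomial.eval_X, Polynomial.eval_zero]
  by_cases hr : r = 0
  · rw [hr, mul_zero]
  · rw [h r hr, zero_mul]

/-- Irreducibility gives one plane in both open sets. As `P` and `Q` need not be homogeneous, they
may be nonzero at different bases of it; `exists_mul_eval_smul_ne_zero` supplies a common one. -/
theorem coneIdeal_isPrime [Infinite k] {Z : Set (Gr k e)} (hZ : IsIrreducible Z) : (coneIdeal
    Z).IsPrime := by
  refine ⟨fun h => ?_, fun {P Q} hPQ => ?_⟩
  · obtain ⟨W, hW⟩ := hZ.nonempty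
    have h1 : (1 : PlueckerPoly k) ∈ coneIdeal Z := by rw [h]; trivial
    obtain ⟨F, G, h⟩ := exists_span_pair_of_finrank_two W.2.2
    exact Set.disjoint_left.mp h1 hW ⟨F, G, h, by simp⟩
  · by_contra! h
    rw [mem_coneIdeal, mem_coneIdeal, Set.not_disjoint_iff_nonempty_inter,
      Set.not_disjoint_iff_nonempty_inter] at h
    obtain ⟨W, hW, h1, h2⟩ :=
      hZ.isPreirreducible _ _ (isOpen_basicOpen e P) (isOpen_basicOpen e Q) h.1 h.2
    obtain ⟨F, G, hFG⟩ := exists_span_pair_of_finrank_two W.2.2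
    obtain ⟨s, -, hs⟩ := eval_smul_ne_zero_of_mem_basicOpen hFG h1
    obtain ⟨t, -, ht⟩ := eval_smul_ne_zero_of_mem_basicOpen hFG h2
    obtain ⟨r, hr, h3⟩ := exists_mul_eval_smul_ne_zero P Q _ hs ht
    refine Set.disjoint_left.mp hPQ hW ⟨r • F, G, ?_, ?_⟩
    · rw [span_smul_pair F G hr, hFG]
    · rwa [pluecker_smul_left]

theorem coneIdeal_anti {Z Z' : Set (Gr k e)} (h : Z ⊆ Z') : coneIdeal Z' ≤ coneIdeal Z :=
  fun _ hP => Set.disjoint_of_subset_left h hP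

theorem coneIdeal_lt [Infinite k] {Z Z' : Set (Gr k e)} (h : Z ⊆ Z') (h' : ¬ Z' ⊆ closure Z) :
    coneIdeal Z' < coneIdeal Z := by
  refine lt_of_le_not_ge (coneIdeal_anti h) fun hle => h' fun W hW => ?_
  rw [(isTopologicalBasis_basicOpen e).mem_closure_iff]
  rintro _ ⟨n, P, hP, rfl⟩ hWP
  by_contra hd
  rw [Set.not_nonempty_iff_eq_empty, ← Set.disjoint_iff_inter_eq_empty, disjoint_comm] at hd
  exact Set.disjoint_left.mp (hle hd) hW hWP

/-- The irrelevant ideal. -/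
noncomputable def irrelevantIdeal (k : Type*) [Field k] : Ideal (PlueckerPoly k) :=
  RingHom.ker (constantCoeff (R := k) (σ := (Fin 3 →₀ ℕ) × (Fin 3 →₀ ℕ)))

/-- The vertex of the cone gives one more step in every chain, matching the extra dimension of a
cone over its base. -/
theorem coneIdeal_lt_irrelevantIdeal [Infinite k] {Z : Set (Gr k e)} (hZ : Z.Nonempty) :
    coneIdeal Z < irrelevantIdeal k := by
  obtain ⟨W, hW⟩ := hZ
  obtain ⟨F, G, hFG⟩ := exists_span_pair_of_finrank_two W.2.2
  refine lt_of_le_not_ge (fun P hP => ?_) fun hle => ?_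
  · change constantCoeff P = 0
    by_contra h
    have h1 : eval (pluecker F G) (homogeneousComponent 0 P) ≠ 0 := by
      rwa [homogeneousComponent_zero, eval_C]
    obtain ⟨s, hs, h2⟩ := exists_eval_smul_ne_zero P _ h1
    refine Set.disjoint_left.mp hP hW ⟨s • F, G, ?_, ?_⟩
    · rw [span_smul_pair F G hs, hFG]
    · rwa [pluecker_smul_left]
  · have hr := W.2.2
    rw [hFG, finrank_span_pair_eq_two_iff_pluecker] at hr
    obtain ⟨mn, hmn⟩ := hr
    have h1 : (X mn : PlueckerPoly k) ∈ irrelevantIdeal k := constantCoeff_X k mn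
    exact Set.disjoint_left.mp (hle h1) hW ⟨F, G, hFG, by rwa [eval_X]⟩

/-- The homomorphism from polynomials in the Plücker coordinates that describes the cone over a
polynomial family. -/
noncomputable def coneHom (F G : MvPolynomial (Fin 3) (MvPolynomial σ k)) :
    PlueckerPoly k →ₐ[k] MvPolynomial (Option σ) k :=
  aeval fun mn => X none * rename some (plueckerPoly F G mn)

theorem eval_coneHom (F G : MvPolynomial (Fin 3) (MvPolynomial σ k)) (t : σ → k) (s : k)
    (P : PlueckerPoly k) : eval (fun i => i.elim s t) (coneHom F G P) =
      eval (s • pluecker (map (eval t) F) (map (eval t) G)) P := by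
  have : (aeval (fun i => Option.elim i s t)).comp (coneHom F G) =
      (aeval (s • pluecker (map (eval t) F) (map (eval t) G)) : PlueckerPoly k →ₐ[k] k) := by
    refine MvPolynomial.algHom_ext fun mn => ?_
    have h := eval_plueckerPoly F G t mn
    simp only [coneHom, AlgHom.comp_apply, aeval_X, map_mul, aeval_rename, Pi.smul_apply,
      Option.elim_none, smul_eq_mul]
    rw [← h]
    congr 1
  exact DFunLike.congr_fun this P

theorem ker_coneHom_le [Infinite k] {X : Set (Gr k e)} (hX : X ⊆ closure (paramSet e F G 1)) {Z :
    Set (Gr k e)}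
    (hZ : Z ⊆ X) : RingHom.ker (coneHom F G) ≤ coneIdeal Z := by
  intro P hP
  have h1 : Disjoint (paramSet e F G 1) (basicOpen e P) := by
    rw [Set.disjoint_left]
    rintro W ⟨t, -, hW⟩ h
    obtain ⟨s, -, hs⟩ := eval_smul_ne_zero_of_mem_basicOpen hW h
    rw [← eval_coneHom, show coneHom F G P = 0 from hP, map_zero] at hs
    exact hs rfl
  exact Set.disjoint_of_subset_left (hZ.trans hX) (h1.closure_left (isOpen_basicOpen e P))

/-- There are infinitely many Plücker variables, but only pairs of exponents in the supports of `F`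
and `G` have nonzero image. -/
theorem coneHom_range_fg (F G : MvPolynomial (Fin 3) (MvPolynomial σ k)) :
    (coneHom F G).range.FG := by
  classical
  rw [coneHom, ← Algebra.adjoin_range_eq_range_aeval]
  refine Subalgebra.fg_def.mpr ⟨_, ?_, rfl⟩
  refine ((((F.support ∪ G.support) ×ˢ (F.support ∪ G.support)).image fun mn =>
    X none * rename some (plueckerPoly F G mn)).finite_toSet.insert 0).subset ?_
  rintro _ ⟨mn, rfl⟩
  by_cases h : mn ∈ (F.support ∪ G.support) ×ˢ (F.support ∪ G.support)
  · exact Or.inr (Finset.mem_coe.mpr (Finset.mem_image_of_mem _ h))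
  · left
    have : plueckerPoly F G mn = 0 := by
      simp only [Finset.mem_product, Finset.mem_union, mem_support_iff] at h
      rw [plueckerPoly]
      by_cases h1 : coeff mn.1 F = 0 <;> by_cases h2 : coeff mn.1 G = 0 <;>
        by_cases h3 : coeff mn.2 F = 0 <;> by_cases h4 : coeff mn.2 G = 0 <;> simp_all
    simp [this]

/-- A subset of the closure of a polynomial family with `n` parameters has dimension at most
`n`. -/
theorem topologicalKrullDim_le [Infinite k] [Fintype σ] {X : Set (Gr k e)}
    (hX : X ⊆ closure (paramSet e F G 1)) : topologicalKrullDim X ≤ (Fintype.card σ : ℕ) := by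
  rcases isEmpty_or_nonempty (TopologicalSpace.IrreducibleCloseds X) with hE | hN
  · rw [topologicalKrullDim, Order.krullDim_eq_bot]
    exact bot_le
  let T := TopologicalSpace.IrreducibleCloseds X
  let im : T → Set (Gr k e) := fun Z => Subtype.val '' (Z : Set X)
  have im_irr : ∀ Z, IsIrreducible (im Z) := fun Z =>
    Z.isIrreducible.image _ continuous_subtype_val.continuousOn
  have im_sub : ∀ Z, im Z ⊆ X := by
    rintro Z _ ⟨x, -, rfl⟩
    exact x.2
  -- A chain of irreducible closed sets, prolonged below by the vertex of the cone, becomes a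
  -- descending chain of primes that contain the kernel of `coneHom`.
  let J : WithBot T → Ideal (PlueckerPoly k) := fun z =>
    z.recBotCoe (irrelevantIdeal k) (fun Z => coneIdeal (im Z))
  have J_prime : ∀ z, (J z).IsPrime := by
    intro z
    induction z with
    | bot => exact RingHom.ker_isPrime _
    | coe Z => exact coneIdeal_isPrime (im_irr Z)
  have J_ker : ∀ z, RingHom.ker (coneHom F G) ≤ J z := by
    intro z
    induction z with
    | bot =>
      obtain ⟨Z⟩ := hN
      exact (ker_coneHom_le hX (im_sub Z)).trans
        (coneIdeal_lt_irrelevantIdeal (im_irr Z).nonempty).le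
    | coe Z => exact ker_coneHom_le hX (im_sub Z)
  have J_anti : ∀ y z, y < z → J z < J y := by
    intro y z hyz
    induction z with
    | bot => exact absurd hyz not_lt_bot
    | coe Z' =>
      induction y with
      | bot => exact coneIdeal_lt_irrelevantIdeal (im_irr Z').nonempty
      | coe Z =>
        rw [WithBot.coe_lt_coe] at hyz
        refine coneIdeal_lt (Set.image_mono hyz.le) fun h => hyz.not_ge fun x hx => ?_
        have h1 := (closure_subtype (p := (· ∈ X)) (x := x) (s := (Z : Set X))).mpr (h ⟨x, hx, rfl⟩)
        rwa [Z.isClosed.closure_eq] at h1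
  have hsurj : Function.Surjective (coneHom F G).rangeRestrict :=
    AlgHom.rangeRestrict_surjective _
  have hker : ∀ z, RingHom.ker (coneHom F G).rangeRestrict ≤ J z := by
    intro z P hP
    exact J_ker z (congrArg Subtype.val hP)
  let g : WithBot T → (PrimeSpectrum (coneHom F G).range)ᵒᵈ := fun z => OrderDual.toDual
    ⟨(J z).map (coneHom F G).rangeRestrict,
      have := J_prime z; Ideal.map_isPrime_of_surjective hsurj (hker z)⟩
  have hcm : ∀ z, ((J z).map (coneHom F G).rangeRestrict).comap (coneHom F G).rangeRestrict = J z
      := by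
    intro z
    rw [Ideal.comap_map_of_surjective _ hsurj]
    exact sup_eq_left.mpr (hker z)
  have hg : StrictMono g := by
    intro y z hyz
    have h1 := J_anti y z hyz
    refine lt_of_le_not_ge (Ideal.map_mono h1.le) fun h2 => h1.not_ge ?_
    rw [← hcm y, ← hcm z]
    exact Ideal.comap_mono h2
  have h1 := Order.krullDim_le_of_strictMono g hg
  rw [Order.krullDim_withBot, Order.krullDim_orderDual] at h1
  -- The range of `coneHom` lies in a polynomial ring with one variable more than `σ`, the scaling
  -- variable; it cancels against the added vertex.
  have h2 := h1.trans (ringKrullDim_subalgebra_le _ (coneHom_range_fg F G))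
  rw [Fintype.card_option, Nat.cast_add, Nat.cast_one] at h2
  exact ENat.WithBot.add_le_add_one_right_iff.mp h2

end Param

/-! ### Lower bounds for the dimension -/

theorem isIrreducible_preimage_val {Y : Type*} [TopologicalSpace Y] {X S : Set Y} (h : S ⊆ X)
    (hS : IsIrreducible S) : IsIrreducible (Subtype.val ⁻¹' S : Set X) := by
  obtain ⟨⟨y, hy⟩, hpre⟩ := hS
  refine ⟨⟨⟨y, h hy⟩, hy⟩, ?_⟩
  rintro _ _ ⟨U, hU, rfl⟩ ⟨V, hV, rfl⟩ ⟨x, hx, hxU⟩ ⟨x', hx', hxV⟩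
  obtain ⟨z, hz, hzU, hzV⟩ := hpre U V hU hV ⟨x, hx, hxU⟩ ⟨x', hx', hxV⟩
  exact ⟨⟨z, h hz⟩, hz, hzU, hzV⟩

/-- A chain of irreducible subsets, each of which is not contained in the closure of its
predecessor, bounds the dimension from below. -/
theorem le_topologicalKrullDim_of_chain {Y : Type*} [TopologicalSpace Y] {X : Set Y} {n : ℕ}
    (S : ℕ → Set Y) (hX : ∀ i ≤ n, S i ⊆ X) (hirr : ∀ i ≤ n, IsIrreducible (S i))
    (hmono : ∀ i < n, S i ⊆ S (i + 1)) (hlt : ∀ i < n, ¬ S (i + 1) ⊆ closure (S i)) :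
    (n : WithBot ℕ∞) ≤ topologicalKrullDim X := by
  let f : Fin (n + 1) → TopologicalSpace.IrreducibleCloseds X := fun i =>
    ⟨closure (Subtype.val ⁻¹' S i), (isIrreducible_preimage_val (hX i (by omega))
      (hirr i (by omega))).closure, isClosed_closure⟩
  have hf : StrictMono f := by
    rw [Fin.strictMono_iff_lt_succ]
    intro i
    refine lt_of_le_not_ge (closure_mono (Set.preimage_mono (hmono i i.2))) fun h => ?_
    refine hlt i i.2 fun y hy => ?_
    have h1 : (⟨y, hX (i + 1) i.2 hy⟩ : X) ∈ closure (Subtype.val ⁻¹' S i : Set X) :=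
      h (subset_closure (show _ ∈ Subtype.val ⁻¹' S (i + 1) from hy))
    have h2 := (closure_subtype (p := (· ∈ X))).mp h1
    exact closure_mono (Set.image_preimage_subset _ _) h2
  exact Order.LTSeries.length_le_krullDim (LTSeries.mk n f hf)

/-- A polynomial in the Plücker coordinates that separates two sets of planes. -/
theorem not_subset_closure_of_eval [Infinite k] {e : ℕ} {S T : Set (Gr k e)} (P : PlueckerPoly k)
    (hS : ∀ W ∈ S, ∀ F G : Poly k, W.1 = Submodule.span k {F, G} → eval (pluecker F G) P = 0)
    {W : Gr k e} (hW : W ∈ T) {F G : Poly k} (hFG : W.1 = Submodule.span k {F, G})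
    (h : eval (pluecker F G) P ≠ 0) : ¬ T ⊆ closure S := by
  intro hT
  have h1 : Disjoint S (basicOpen e P) := by
    rw [Set.disjoint_left]
    rintro W hW ⟨F, G, hFG, h⟩
    exact h (hS W hW F G hFG)
  exact Set.disjoint_left.mp (h1.closure_left (isOpen_basicOpen e P)) (hT hW) ⟨F, G, hFG, h⟩

end

section

/-! ### Linear substitutions -/

section Subst

variable {K : Type*} [CommRing K]

/-- The substitution `X i ↦ ∑ j, A i j X j`. -/
noncomputable def subst (A : Matrix (Fin 3) (Fin 3) K) :
    MvPolynomial (Fin 3) K →ₐ[K] MvPolynomial (Fin 3) K :=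
  aeval fun i => ∑ j, C (A i j) * X j

theorem subst_X (A : Matrix (Fin 3) (Fin 3) K) (i : Fin 3) :
    subst A (X i) = ∑ j, C (A i j) * X j := aeval_X _ _

theorem subst_C (A : Matrix (Fin 3) (Fin 3) K) (a : K) : subst A (C a) = C a := aeval_C _ _

theorem subst_subst (A B : Matrix (Fin 3) (Fin 3) K) (F : MvPolynomial (Fin 3) K) :
    subst B (subst A F) = subst (A * B) F := by
  have : (subst B).comp (subst A) = subst (A * B) := by
    refine MvPolynomial.algHom_ext fun i => ?_
    simp only [AlgHom.comp_apply, subst_X, map_sum, map_mul, subst_C, Finset.mul_sum,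
      Matrix.mul_apply, Finset.sum_mul]
    rw [Finset.sum_comm]
    simp only [mul_assoc]
  exact DFunLike.congr_fun this F

theorem subst_one (F : MvPolynomial (Fin 3) K) : subst 1 F = F := by
  have : subst (1 : Matrix (Fin 3) (Fin 3) K) = AlgHom.id K _ := by
    refine MvPolynomial.algHom_ext fun i => ?_
    rw [subst_X, AlgHom.id_apply, Finset.sum_eq_single i]
    · simp
    · intro j _ hj; simp [Matrix.one_apply_ne hj.symm]
    · simp
  rw [this, AlgHom.id_apply]

theorem isHomogeneous_sum_C_mul_X (v : Fin 3 → K) : (∑ j, C (v j) * X j).IsHomogeneous 1 :=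
  IsHomogeneous.sum _ _ _ fun j _ => isHomogeneous_C_mul_X _ j

theorem isHomogeneous_subst (A : Matrix (Fin 3) (Fin 3) K) {F : MvPolynomial (Fin 3) K} {e : ℕ}
    (hF : F.IsHomogeneous e) : (subst A F).IsHomogeneous e := by
  have h := hF.aeval _ fun i => isHomogeneous_sum_C_mul_X (A i)
  rwa [one_mul] at h

theorem map_subst {L : Type*} [CommRing L] (φ : K →+* L) (A : Matrix (Fin 3) (Fin 3) K)
    (F : MvPolynomial (Fin 3) K) : map φ (subst A F) = subst (A.map φ) (map φ F) := by
  induction F using MvPolynomial.induction_on with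
  | C a => simp
  | add p q hp hq => simp [hp, hq]
  | mul_X p i hp => simp [hp, subst_X]

theorem pderiv_subst (A : Matrix (Fin 3) (Fin 3) K) (j : Fin 3) (F : MvPolynomial (Fin 3) K) :
    pderiv j (subst A F) = ∑ i, C (A i j) * subst A (pderiv i F) := by
  induction F using MvPolynomial.induction_on with
  | C a => simp
  | add p q hp hq => simp [hp, hq, mul_add, Finset.sum_add_distrib]
  | mul_X p i hp =>
    have h1 : pderiv j (∑ l, C (A i l) * X l : MvPolynomial (Fin 3) K) = C (A i j) := by
      simp [pderiv_X, Pi.single_apply]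
    have h2 : ∀ l, pderiv l (p * X i) = p * (if l = i then 1 else 0) + X i * pderiv l p := by
      intro l
      rw [Derivation.leibniz, pderiv_X, smul_eq_mul, smul_eq_mul, Pi.single_apply]
      simp only [eq_comm]
    rw [map_mul, subst_X, Derivation.leibniz, h1, hp]
    simp only [h2, map_add, map_mul, subst_X, mul_add, Finset.sum_add_distrib, smul_eq_mul]
    congr 1
    · rw [Finset.sum_eq_single i]
      · simp [mul_comm]
      · intro b _ hb; simp [hb]
      · simp
    · rw [Finset.mul_sum]
      exact Finset.sum_congr rfl fun l _ => by ring

end Subst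

/-! ### Directional derivatives -/

section Directional

variable {k : Type*} [Field k]

/-- The linear form with coefficient vector `a`. -/
noncomputable def lin (a : Fin 3 → k) : Poly k := ∑ i, C (a i) * X i

theorem lin_isHomogeneous (a : Fin 3 → k) : (lin a).IsHomogeneous 1 := isHomogeneous_sum_C_mul_X a

theorem exists_eq_lin {l : Poly k} (hl : l.IsHomogeneous 1) : ∃ a, l = lin a := by
  have h : l ∈ Submodule.span k (Set.range (X : Fin 3 → Poly k)) := by
    rw [← homogeneousSubmodule_one_eq_span_X]; exact hl
  obtain ⟨a, rfl⟩ := (Submodule.mem_span_range_iff_exists_fun k).mp h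
  exact ⟨a, Finset.sum_congr rfl fun i _ => by rw [C_mul']⟩

theorem lin_eq_zero_iff {a : Fin 3 → k} : lin a = 0 ↔ a = 0 := by
  constructor
  · intro h
    ext i
    have := congrArg (coeff (Finsupp.single i 1)) h
    simpa [lin, coeff_sum, coeff_C_mul, coeff_X, Finsupp.single_left_inj] using this
  · rintro rfl; simp [lin]

/-- The derivative in the direction `a`. -/
noncomputable def dirDeriv (a : Fin 3 → k) (F : Poly k) : Poly k := diff k (lin a) F

theorem dirDeriv_eq (a : Fin 3 → k) (F : Poly k) : dirDeriv a F = ∑ i, C (a i) * pderiv i F := by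
  rw [dirDeriv, lin, map_sum, LinearMap.sum_apply]
  refine Finset.sum_congr rfl fun i _ => ?_
  rw [diff_mul, diff_C, diff_X, C_mul']

theorem dirDeriv_single (i : Fin 3) (F : Poly k) : dirDeriv (Pi.single i 1) F = pderiv i F := by
  rw [dirDeriv_eq, Finset.sum_eq_single i]
  · simp
  · intro j _ hj; simp [hj]
  · simp

theorem dirDeriv_zero (a : Fin 3 → k) : dirDeriv a 0 = 0 := map_zero _

theorem dirDeriv_smul (c : k) (a : Fin 3 → k) (F : Poly k) :
    dirDeriv (c • a) F = c • dirDeriv a F := by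
  simp only [dirDeriv_eq, Finset.smul_sum, Pi.smul_apply, smul_eq_mul, C_mul, smul_eq_C_mul]
  exact Finset.sum_congr rfl fun i _ => by ring

/-- Chain rule: moving a form by an invertible `A` moves the directions that kill it by the inverse
of `A`. -/
theorem dirDeriv_subst (A : Matrix (Fin 3) (Fin 3) k) (a : Fin 3 → k) (F : Poly k) :
    dirDeriv a (subst A F) = subst A (dirDeriv (A.mulVec a) F) := by
  simp only [dirDeriv_eq, pderiv_subst, map_sum, map_mul, subst_C, Matrix.mulVec, dotProduct,
    Finset.mul_sum, Finset.sum_mul]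
  rw [Finset.sum_comm]
  exact Finset.sum_congr rfl fun i _ => Finset.sum_congr rfl fun j _ => by ring

theorem diff_lin_mul_lin (a b : Fin 3 → k) (F : Poly k) :
    diff k (lin a * lin b) F = dirDeriv a (dirDeriv b F) := diff_mul _ _ _

theorem dirDeriv_comm (a b : Fin 3 → k) (F : Poly k) :
    dirDeriv a (dirDeriv b F) = dirDeriv b (dirDeriv a F) := by
  rw [← diff_lin_mul_lin, mul_comm, diff_lin_mul_lin]

theorem mem_family_iff {e : ℕ} {W : Gr k e} : W ∈ family k e ↔ ∃ (F G : Poly k) (a b : Fin 3 → k),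
    W.1 = Submodule.span k {F, G} ∧ a ≠ 0 ∧ b ≠ 0 ∧ dirDeriv a F = 0 ∧
      dirDeriv a (dirDeriv b G) = 0 := by
  constructor
  · rintro ⟨F, G, l₁, l₂, hW, n1, h1, n2, h2, hF, hG⟩
    obtain ⟨a, rfl⟩ := exists_eq_lin h1
    obtain ⟨b, rfl⟩ := exists_eq_lin h2
    exact ⟨F, G, a, b, hW, mt lin_eq_zero_iff.mpr n1, mt lin_eq_zero_iff.mpr n2, hF,
      by rwa [← diff_lin_mul_lin]⟩
  · rintro ⟨F, G, a, b, hW, na, nb, hF, hG⟩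
    exact ⟨F, G, lin a, lin b, hW, mt lin_eq_zero_iff.mp na, lin_isHomogeneous a,
      mt lin_eq_zero_iff.mp nb, lin_isHomogeneous b, hF, by rwa [diff_lin_mul_lin]⟩

end Directional

/-! ### Binary forms -/

section Binary

variable {K : Type*} [CommRing K]

/-- The binary form of degree `e` in `u` and `v` with coefficients `f 0, …, f e`. -/
noncomputable def bin (f : ℕ → K) (e : ℕ) (u v : MvPolynomial (Fin 3) K) :
    MvPolynomial (Fin 3) K := ∑ i ∈ Finset.range (e + 1), C (f i) * (u ^ i * v ^ (e - i))

theorem bin_isHomogeneous (f : ℕ → K) (e : ℕ) {u v : MvPolynomial (Fin 3) K}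
    (hu : u.IsHomogeneous 1) (hv : v.IsHomogeneous 1) : (bin f e u v).IsHomogeneous e := by
  refine IsHomogeneous.sum _ _ _ fun i hi => IsHomogeneous.C_mul ?_ _
  have h := (hu.pow i).mul (hv.pow (e - i))
  rwa [one_mul, one_mul, Nat.add_sub_cancel' (by simpa [Nat.lt_succ_iff] using hi)] at h

theorem map_bin {L : Type*} [CommRing L] (φ : K →+* L) (f : ℕ → K) (e : ℕ)
    (u v : MvPolynomial (Fin 3) K) :
    map φ (bin f e u v) = bin (fun i => φ (f i)) e (map φ u) (map φ v) := by
  simp [bin]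

theorem subst_bin (A : Matrix (Fin 3) (Fin 3) K) (f : ℕ → K) (e : ℕ)
    (u v : MvPolynomial (Fin 3) K) : subst A (bin f e u v) = bin f e (subst A u) (subst A v) := by
  simp [bin]

theorem add_bin (f g : ℕ → K) (e : ℕ) (u v : MvPolynomial (Fin 3) K) :
    bin f e u v + bin g e u v = bin (fun i => f i + g i) e u v := by
  simp [bin, ← Finset.sum_add_distrib, add_mul]

theorem C_mul_bin (a : K) (f : ℕ → K) (e : ℕ) (u v : MvPolynomial (Fin 3) K) :
    C a * bin f e u v = bin (fun i => a * f i) e u v := by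
  simp [bin, Finset.mul_sum, mul_assoc]

theorem bin_congr {f g : ℕ → K} {e : ℕ} (h : ∀ i ≤ e, f i = g i) (u v : MvPolynomial (Fin 3) K) :
    bin f e u v = bin g e u v :=
  Finset.sum_congr rfl fun i hi => by rw [h i (by simpa [Nat.lt_succ_iff] using hi)]

theorem coeff_bin (f : ℕ → K) (e : ℕ) {a b c : Fin 3} (hab : a ≠ b) (hac : a ≠ c) (hbc : b ≠ c)
    (m : Fin 3 →₀ ℕ) :
    coeff m (bin f e (X a) (X b)) = if m c = 0 ∧ m.degree = e then f (m a) else 0 := by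
  have huniv : (Finset.univ : Finset (Fin 3)) = {a, b, c} := by
    revert hab hac hbc; revert a b c; decide
  have hdeg : m.degree = m a + (m b + m c) := by
    rw [Finsupp.degree_eq_sum, huniv, Finset.sum_insert (by simp [hab, hac]),
      Finset.sum_insert (by simp [hbc]), Finset.sum_singleton]
  have key : ∀ i ∈ Finset.range (e + 1), coeff m (C (f i) * (X a ^ i * X b ^ (e - i))) =
      if m a = i then (if m c = 0 ∧ m.degree = e then f (m a) else 0) else 0 := by
    intro i hi
    rw [Finset.mem_range] at hi
    rw [X_pow_eq_monomial, X_pow_eq_monomial, monomial_mul, C_mul_monomial, coeff_monomial,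
      hdeg, ← ite_and]
    have : Finsupp.single a i + Finsupp.single b (e - i) = m ↔
        m a = i ∧ m c = 0 ∧ m a + (m b + m c) = e := by
      constructor
      · rintro rfl
        simp [hab, hab.symm, hac, hbc]
        omega
      · rintro ⟨h1, h2, h3⟩
        ext x
        have hx : x ∈ ({a, b, c} : Finset (Fin 3)) := huniv ▸ Finset.mem_univ x
        simp only [Finset.mem_insert, Finset.mem_singleton] at hx
        rcases hx with rfl | rfl | rfl
        · simp [hab.symm, h1]
        · simp [hab]; omega
        · simp [hac, hbc, h2]
    rw [if_congr this rfl rfl]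
    by_cases h : m a = i
    · subst h; simp
    · simp [h]
  rw [bin, coeff_sum, Finset.sum_congr rfl key, Finset.sum_ite_eq]
  split_ifs with h1 h2
  · rfl
  · rfl
  · rw [Finset.mem_range] at h1; omega
  · rfl

end Binary

/-! ### Forms killed by coordinate derivatives -/

section Normal

variable {k : Type*} [Field k] [CharZero k]

theorem coeff_eq_zero_of_pderiv {F : Poly k} {i : Fin 3} (h : pderiv i F = 0) {m : Fin 3 →₀ ℕ}
    (hm : m i ≠ 0) : coeff m F = 0 := by
  have h1 := coeff_pderiv F (i := i) (m - Finsupp.single i 1)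
  have h2 : m - Finsupp.single i 1 + Finsupp.single i 1 = m := by
    ext j
    simp only [Finsupp.coe_add, Finsupp.coe_tsub, Pi.add_apply, Pi.sub_apply]
    rcases eq_or_ne i j with rfl | hj
    · simp; omega
    · simp [hj]
  rw [h, coeff_zero, h2] at h1
  exact (mul_eq_zero.mp h1.symm).resolve_right (Nat.cast_add_one_ne_zero _)

theorem eq_bin_of_pderiv {F : Poly k} {e : ℕ} (hF : F.IsHomogeneous e) (h : pderiv 2 F = 0) :
    ∃ f : ℕ → k, F = bin f e (X 0) (X 1) := by
  refine ⟨fun i => coeff (Finsupp.single 0 i + Finsupp.single 1 (e - i)) F, ?_⟩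
  ext m
  rw [coeff_bin _ _ (show (0 : Fin 3) ≠ 1 by decide) (show (0 : Fin 3) ≠ 2 by decide) (by decide)]
  split_ifs with h1
  · congr 1
    have h2 := h1.2
    rw [Finsupp.degree_eq_sum, Fin.sum_univ_three, h1.1] at h2
    ext j
    fin_cases j
    · simp
    · simp; omega
    · simp [h1.1]
  · by_cases h2 : m 2 = 0
    · exact hF.coeff_eq_zero fun h3 => h1 ⟨h2, h3⟩
    · exact coeff_eq_zero_of_pderiv h h2

/-- No monomial of `G` involves both `X 0` and `X 2`. The pure power of `X 1` would fit both
summands; it is assigned to the first, whence `h 0 = 0`. -/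
theorem eq_bin_add_bin_of_pderiv {G : Poly k} {e : ℕ} (hG : G.IsHomogeneous e)
    (h : pderiv 2 (pderiv 0 G) = 0) :
    ∃ g h : ℕ → k, h 0 = 0 ∧ G = bin g e (X 0) (X 1) + bin h e (X 2) (X 1) := by
  refine ⟨fun i => coeff (Finsupp.single 0 i + Finsupp.single 1 (e - i)) G,
    fun i => if i = 0 then 0 else coeff (Finsupp.single 2 i + Finsupp.single 1 (e - i)) G, rfl, ?_⟩
  ext m
  rw [coeff_add,
    coeff_bin _ _ (show (0 : Fin 3) ≠ 1 by decide) (show (0 : Fin 3) ≠ 2 by decide) (by decide),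
    coeff_bin _ _ (show (2 : Fin 3) ≠ 1 by decide) (show (2 : Fin 3) ≠ 0 by decide) (by decide)]
  by_cases hd : m.degree = e
  swap
  · simp [hd, hG.coeff_eq_zero hd]
  have hd' := hd
  rw [Finsupp.degree_eq_sum, Fin.sum_univ_three] at hd'
  by_cases h0 : m 0 = 0
  · by_cases h2 : m 2 = 0
    · have : Finsupp.single 1 e = m := by
        ext j; fin_cases j <;> simp [h0, h2]; omega
      simp [-Finsupp.single_tsub, h0, h2, hd, this]
    · have : Finsupp.single 2 (m 2) + Finsupp.single 1 (e - m 2) = m := by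
        ext j; fin_cases j <;> simp [h0]; omega
      simp [-Finsupp.single_tsub, h0, h2, hd, this]
  · by_cases h2 : m 2 = 0
    · have : Finsupp.single 0 (m 0) + Finsupp.single 1 (e - m 0) = m := by
        ext j; fin_cases j <;> simp [h2]; omega
      simp [-Finsupp.single_tsub, h0, h2, hd, this]
    · have h3 := coeff_eq_zero_of_pderiv h (m := m - Finsupp.single 0 1) (by simpa using h2)
      rw [coeff_pderiv] at h3
      have h4 : m - Finsupp.single 0 1 + Finsupp.single 0 1 = m := by
        ext j; fin_cases j <;> simp; omega
      rw [h4] at h3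
      simp [h0, h2, (mul_eq_zero.mp h3).resolve_right (Nat.cast_add_one_ne_zero _)]

theorem eq_bin_add_mul_bin_of_pderiv {G : Poly k} {e : ℕ} (hG : G.IsHomogeneous (e + 1))
    (h : pderiv 2 (pderiv 2 G) = 0) :
    ∃ g h : ℕ → k, G = bin g (e + 1) (X 0) (X 1) + X 2 * bin h e (X 0) (X 1) := by
  obtain ⟨b, hb⟩ := eq_bin_of_pderiv (F := pderiv 2 G) (e := e) (by simpa using hG.pderiv) h
  have h1 : pderiv 2 (G - X 2 * bin b e (X 0) (X 1)) = 0 := by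
    have h2 : pderiv (R := k) 2 (bin b e (X 0) (X 1)) = 0 := by rw [← hb, h]
    rw [map_sub, Derivation.leibniz, h2, hb]
    simp
  have h3 : (G - X 2 * bin b e (X 0) (X 1)).IsHomogeneous (e + 1) := by
    refine hG.sub ?_
    have := (isHomogeneous_X k (2 : Fin 3)).mul
      (bin_isHomogeneous b e (isHomogeneous_X k (0 : Fin 3)) (isHomogeneous_X k (1 : Fin 3)))
    rwa [add_comm] at this
  obtain ⟨g, hg⟩ := eq_bin_of_pderiv h3 h1
  exact ⟨g, b, by rw [← hg]; ring⟩

end Normal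

end

section

/-! ### Normal forms for the members of the family -/

section Normal

variable {K : Type*} [CommRing K]

/-- The pair of forms `f(X₀, X₁)`, `g(X₀, X₁) + h(X₂, X₁)`, after a linear substitution: the first
form. -/
noncomputable def shapeF (N : Matrix (Fin 3) (Fin 3) K) (f : ℕ → K) (e : ℕ) :
    MvPolynomial (Fin 3) K := subst N (bin f e (X 0) (X 1))

/-- The pair of forms `f(X₀, X₁)`, `g(X₀, X₁) + h(X₂, X₁)`, after a linear substitution: the second
form. -/
noncomputable def shapeG (N : Matrix (Fin 3) (Fin 3) K) (g h : ℕ → K) (e : ℕ) :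
    MvPolynomial (Fin 3) K := subst N (bin g e (X 0) (X 1) + bin h e (X 2) (X 1))

theorem shapeF_isHomogeneous (N : Matrix (Fin 3) (Fin 3) K) (f : ℕ → K) (e : ℕ) :
    (shapeF N f e).IsHomogeneous e :=
  isHomogeneous_subst _ (bin_isHomogeneous _ _ (isHomogeneous_X _ _) (isHomogeneous_X _ _))

theorem shapeG_isHomogeneous (N : Matrix (Fin 3) (Fin 3) K) (g h : ℕ → K) (e : ℕ) :
    (shapeG N g h e).IsHomogeneous e :=
  isHomogeneous_subst _ ((bin_isHomogeneous _ _ (isHomogeneous_X _ _) (isHomogeneous_X _ _)).add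
    (bin_isHomogeneous _ _ (isHomogeneous_X _ _) (isHomogeneous_X _ _)))

theorem map_shapeF {L : Type*} [CommRing L] (φ : K →+* L) (N : Matrix (Fin 3) (Fin 3) K)
    (f : ℕ → K) (e : ℕ) : map φ (shapeF N f e) = shapeF (N.map φ) (fun i => φ (f i)) e := by
  simp [shapeF, map_subst, map_bin]

theorem map_shapeG {L : Type*} [CommRing L] (φ : K →+* L) (N : Matrix (Fin 3) (Fin 3) K)
    (g h : ℕ → K) (e : ℕ) :
    map φ (shapeG N g h e) = shapeG (N.map φ) (fun i => φ (g i)) (fun i => φ (h i)) e := by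
  simp only [shapeG, map_subst, map_add, map_bin, map_X]

/-- The unipotent-like substitutions that normalize the two linear forms. -/
def normalMat (a b c d : K) : Matrix (Fin 3) (Fin 3) K := !![1, 0, c; a, 1, b; d, 0, 1]

theorem map_normalMat {L : Type*} [CommRing L] (φ : K →+* L) (a b c d : K) :
    (normalMat a b c d).map φ = normalMat (φ a) (φ b) (φ c) (φ d) := by
  ext i j
  fin_cases i <;> fin_cases j <;> simp [normalMat]

/-- The substitution of the normal form with parameters `t`. -/
def nfMat (e : ℕ) (t : ℕ → K) : Matrix (Fin 3) (Fin 3) K :=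
  normalMat (t (3 * e - 1)) (t (3 * e + 1)) (t (3 * e + 2)) (t (3 * e))

/-- The first form of the normal form with parameters `t 0, …, t (3e + 2)`. -/
noncomputable def nfF (e : ℕ) (t : ℕ → K) : MvPolynomial (Fin 3) K :=
  shapeF (nfMat e t) (fun i => if i < e then t i else 1) e

/-- The second form of the normal form with parameters `t 0, …, t (3e + 2)`. -/
noncomputable def nfG (e : ℕ) (t : ℕ → K) : MvPolynomial (Fin 3) K :=
  shapeG (nfMat e t) (fun i => if i < e then t (e + i) else 0)
    (fun i => if i = 0 then 0 else if i < e then t (2 * e + i - 1) else 1) e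

theorem map_nfF {L : Type*} [CommRing L] (φ : K →+* L) (e : ℕ) (t : ℕ → K) :
    map φ (nfF e t) = nfF e (fun j => φ (t j)) := by
  simp only [nfF, nfMat, map_shapeF, map_normalMat, apply_ite φ, map_one]

theorem map_nfG {L : Type*} [CommRing L] (φ : K →+* L) (e : ℕ) (t : ℕ → K) :
    map φ (nfG e t) = nfG e (fun j => φ (t j)) := by
  simp only [nfG, nfMat, map_shapeG, map_normalMat, apply_ite φ, map_one, map_zero]

end Normal

variable {k : Type*} [Field k]

variable (k) in
/-- The first `n` variables, followed by zeros. -/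
noncomputable def tvar (n : ℕ) (j : ℕ) : MvPolynomial (Fin n) k :=
  if h : j < n then X ⟨j, h⟩ else 0

variable (k) in
/-- The planes in normal form for which all parameters from the `n`-th on vanish. -/
def nfSet (e n : ℕ) : Set (Gr k e) := paramSet e (nfF e (tvar k n)) (nfG e (tvar k n)) 1

theorem mem_nfSet {e n : ℕ} {W : Gr k e} : W ∈ nfSet k e n ↔ ∃ t : ℕ → k, (∀ j, n ≤ j → t j = 0) ∧
    W.1 = Submodule.span k {nfF e t, nfG e t} := by
  constructor
  · rintro ⟨s, -, h⟩
    refine ⟨fun j => eval s (tvar k n j), fun j hj => ?_, ?_⟩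
    · simp [tvar, not_lt.mpr hj]
    · rw [h, map_nfF, map_nfG]
  · rintro ⟨t, ht, h⟩
    refine ⟨fun j => t j, by simp, ?_⟩
    have : (fun j => eval (fun i : Fin n => t i) (tvar k n j)) = t := by
      ext j
      by_cases hj : j < n
      · simp [tvar, hj]
      · simp [tvar, hj, ht j (not_lt.mp hj)]
    rw [map_nfF, map_nfG, this, h]

theorem nfF_isHomogeneous (e : ℕ) {K : Type*} [CommRing K] (t : ℕ → K) :
    (nfF e t).IsHomogeneous e := shapeF_isHomogeneous _ _ _

theorem nfG_isHomogeneous (e : ℕ) {K : Type*} [CommRing K] (t : ℕ → K) :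
    (nfG e t).IsHomogeneous e := shapeG_isHomogeneous _ _ _ _

theorem pderiv_two_bin (f : ℕ → k) (e : ℕ) : pderiv 2 (bin f e (X 0) (X 1)) = 0 := by
  simp [bin, Derivation.leibniz, Derivation.leibniz_pow, pderiv_X]

theorem pderiv_zero_bin (f : ℕ → k) (e : ℕ) : pderiv 0 (bin f e (X 2) (X 1)) = 0 := by
  simp [bin, Derivation.leibniz, Derivation.leibniz_pow, pderiv_X]

theorem dirDeriv_shapeF {N : Matrix (Fin 3) (Fin 3) k} {a : Fin 3 → k} {s : k}
    (h : N.mulVec a = s • Pi.single 2 1) (f : ℕ → k) (e : ℕ) : dirDeriv a (shapeF N f e) = 0 := by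
  rw [shapeF, dirDeriv_subst, h, dirDeriv_smul, dirDeriv_single, pderiv_two_bin, smul_zero,
      map_zero]

theorem dirDeriv_shapeG {N : Matrix (Fin 3) (Fin 3) k} {a b : Fin 3 → k} {s r : k}
    (h : N.mulVec a = s • Pi.single 2 1) (h' : N.mulVec b = r • Pi.single 0 1) (f g : ℕ → k)
    (e : ℕ) : dirDeriv a (dirDeriv b (shapeG N f g e)) = 0 := by
  rw [shapeG, dirDeriv_subst, dirDeriv_subst, h, h', dirDeriv_smul, dirDeriv_smul, dirDeriv_single,
    dirDeriv_single, map_add, pderiv_zero_bin, add_zero, map_smul,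
    Derivation.map_smul]
  have : pderiv 2 (pderiv 0 (bin f e (X 0) (X 1)) : Poly k) = 0 := by
    have h1 := (pderiv_commute k 2 0).eq
    have h2 := DFunLike.congr_fun h1 (bin f e (X 0) (X 1))
    change pderiv 2 (pderiv 0 _) = pderiv 0 (pderiv 2 _) at h2
    rw [h2, pderiv_two_bin, map_zero]
  rw [this, smul_zero, map_zero, smul_zero]

/-- This vector and the one in `normalMat_mulVec_snd` are columns of the adjugate, and `1 - c * d`
is the determinant. Each has an entry 1, so they serve as directions even for singular matrices and
`nfSet` needs no determinant condition. -/
theorem normalMat_mulVec_fst (a b c d : k) :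
    (normalMat a b c d).mulVec ![-c, a * c - b, 1] = (1 - c * d) • Pi.single 2 1 := by
  ext i
  fin_cases i <;> simp [normalMat, Matrix.mulVec, dotProduct, Fin.sum_univ_three] <;> ring

theorem normalMat_mulVec_snd (a b c d : k) :
    (normalMat a b c d).mulVec ![1, b * d - a, -d] = (1 - c * d) • Pi.single 0 1 := by
  ext i
  fin_cases i <;> simp [normalMat, Matrix.mulVec, dotProduct, Fin.sum_univ_three]
  ring

theorem nfSet_subset_family (e n : ℕ) : nfSet k e n ⊆ family k e := by
  intro W hW
  obtain ⟨t, -, h⟩ := mem_nfSet.mp hW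
  refine mem_family_iff.mpr ⟨_, _, _, _, h, ?_, ?_,
    dirDeriv_shapeF (normalMat_mulVec_fst _ _ _ _) _ _,
    dirDeriv_shapeG (normalMat_mulVec_fst _ _ _ _) (normalMat_mulVec_snd _ _ _ _) _ _ _⟩
  · intro h0
    simpa using congrFun h0 2
  · intro h0
    simpa using congrFun h0 0

theorem nfSet_mono (e : ℕ) {m n : ℕ} (h : m ≤ n) : nfSet k e m ⊆ nfSet k e n := by
  intro W hW
  obtain ⟨t, ht, hW⟩ := mem_nfSet.mp hW
  exact mem_nfSet.mpr ⟨t, fun j hj => ht j (h.trans hj), hW⟩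

theorem span_pair_normalize {V : Type*} [AddCommGroup V] [Module k V] (F G : V) {a b : k} (c : k)
    (ha : a ≠ 0) (hb : b ≠ 0) :
    Submodule.span k {a • F, b • (G - c • F)} = Submodule.span k {F, G} := by
  apply le_antisymm <;> rw [Submodule.span_le] <;> rintro y (rfl | rfl) <;>
    rw [SetLike.mem_coe, Submodule.mem_span_pair]
  · exact ⟨a, 0, by simp⟩
  · exact ⟨-(b * c), b, by simp only [smul_sub, smul_smul, neg_smul]; abel⟩
  · exact ⟨a⁻¹, 0, by simp [smul_smul, ha]⟩
  · exact ⟨c * a⁻¹, b⁻¹, by simp [smul_smul, ha, hb]⟩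

theorem smul_bin (a : k) (f : ℕ → k) (e : ℕ) (u v : Poly k) :
    a • bin f e u v = bin (fun i => a * f i) e u v := by
  rw [smul_eq_C_mul, C_mul_bin]

/-- Scaling the first form makes `f e = 1`, subtracting a multiple of it from the second removes `g
e`, and scaling the second makes `h e = 1`. -/
theorem mem_nfSet_of_shape {e : ℕ} (he : 1 ≤ e) {W : Gr k e} {a b c d : k} {f g h : ℕ → k}
    (hf : f e ≠ 0) (hh : h e ≠ 0) (h0 : h 0 = 0)
    (hW : W.1 = Submodule.span k
      {shapeF (normalMat a b c d) f e, shapeG (normalMat a b c d) g h e}) :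
    W ∈ nfSet k e (3 * e + 3) := by
  -- The parameters come in blocks: `e` coefficients of `f`, `e` of `g`, `e - 1` of `h`, then the
  -- matrix entries in the order `a, d, b, c`.
  let t : ℕ → k := fun j => if j < e then (f e)⁻¹ * f j else
    if j < 2 * e then (h e)⁻¹ * (g (j - e) - g e * (f e)⁻¹ * f (j - e)) else
    if j < 3 * e - 1 then (h e)⁻¹ * h (j + 1 - 2 * e) else
    if j = 3 * e - 1 then a else if j = 3 * e then d else if j = 3 * e + 1 then b else
    if j = 3 * e + 2 then c else 0
  have hN : nfMat e t = normalMat a b c d := by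
    have h1 : t (3 * e - 1) = a := by
      simp only [t]
      rw [if_neg (by omega), if_neg (by omega), if_neg (by omega), if_pos trivial]
    have h2 : t (3 * e) = d := by
      simp only [t]
      rw [if_neg (by omega), if_neg (by omega), if_neg (by omega), if_neg (by omega), if_pos
          trivial]
    have h3 : t (3 * e + 1) = b := by
      simp only [t]
      rw [if_neg (by omega), if_neg (by omega), if_neg (by omega), if_neg (by omega),
        if_neg (by omega), if_pos trivial]
    have h4 : t (3 * e + 2) = c := by
      simp only [t]
      rw [if_neg (by omega), if_neg (by omega), if_neg (by omega), if_neg (by omega),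
        if_neg (by omega), if_neg (by omega), if_pos trivial]
    rw [nfMat, h1, h2, h3, h4]
  have hF : nfF e t = (f e)⁻¹ • shapeF (normalMat a b c d) f e := by
    rw [nfF, hN, shapeF, shapeF, ← map_smul, smul_bin]
    congr 1
    refine bin_congr (fun i hi => ?_) _ _
    split_ifs with h1
    · simp only [t]
      rw [if_pos h1]
    · obtain rfl : i = e := by omega
      rw [inv_mul_cancel₀ hf]
  have hG : nfG e t = (h e)⁻¹ • (shapeG (normalMat a b c d) g h e -
      (g e * (f e)⁻¹) • shapeF (normalMat a b c d) f e) := by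
    rw [nfG, hN, shapeG, shapeG, shapeF, ← map_smul, ← map_sub, ← map_smul, smul_bin,
      add_sub_right_comm, smul_add, smul_bin, sub_eq_add_neg, ← neg_one_smul k, smul_bin, add_bin,
      smul_bin]
    congr 2
    · refine bin_congr (fun i hi => ?_) _ _
      split_ifs with h1
      · simp only [t]
        rw [if_neg (by omega), if_pos (by omega), Nat.add_sub_cancel_left]
        ring
      · obtain rfl : i = e := by omega
        field_simp
        ring
    · refine bin_congr (fun i hi => ?_) _ _
      split_ifs with h1 h2
      · rw [h1, h0, mul_zero]
      · simp only [t]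
        rw [if_neg (by omega), if_neg (by omega), if_pos (by omega)]
        congr 2
        omega
      · obtain rfl : i = e := by omega
        rw [inv_mul_cancel₀ hh]
  refine mem_nfSet.mpr ⟨t, fun j hj => ?_, ?_⟩
  · simp only [t]
    rw [if_neg (by omega), if_neg (by omega), if_neg (by omega), if_neg (by omega),
      if_neg (by omega), if_neg (by omega), if_neg (by omega)]
  · rw [hW, hF, hG, span_pair_normalize _ _ _ (inv_ne_zero hf) (inv_ne_zero hh)]

/-- Two parameters are added to the top coefficients of `f` and `h`. For nonzero perturbed
coefficients the plane has a normal form, and the given plane is the value at zero. -/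
theorem mem_closure_nfSet_of_shape [Infinite k] {e : ℕ} (he : 1 ≤ e) {W : Gr k e} {a b c d : k}
    {f g h : ℕ → k} (h0 : h 0 = 0)
    (hW : W.1 = Submodule.span k
      {shapeF (normalMat a b c d) f e, shapeG (normalMat a b c d) g h e}) :
    W ∈ closure (nfSet k e (3 * e + 3)) := by
  let N : Matrix (Fin 3) (Fin 3) (MvPolynomial (Fin 2) k) :=
    normalMat (C a) (C b) (C c) (C d)
  let f' : ℕ → MvPolynomial (Fin 2) k := fun i => C (f i) + if i = e then X 0 else 0
  let h' : ℕ → MvPolynomial (Fin 2) k := fun i => C (h i) + if i = e then X 1 else 0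
  let g' : ℕ → MvPolynomial (Fin 2) k := fun i => C (g i)
  have hN : ∀ t : Fin 2 → k, N.map (eval t) = normalMat a b c d := fun t => by
    simp [N, map_normalMat]
  have hD : f' e * h' e ≠ 0 := by
    intro h1
    have h2 := congrArg (eval ![1 - f e, 1 - h e]) h1
    simp [f', h'] at h2
  have hf : (fun i => eval 0 (f' i)) = f := by
    ext i; by_cases hi : i = e <;> simp [f', hi]
  have hg : (fun i => eval 0 (g' i)) = g := by ext i; simp [g']
  have hh : (fun i => eval 0 (h' i)) = h := by
    ext i; by_cases hi : i = e <;> simp [h', hi]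
  have key := mem_closure_paramSet (shapeF_isHomogeneous N f' e) (shapeG_isHomogeneous N g' h' e)
    hD (W := W) (t₀ := 0) (by
      rw [map_shapeF, map_shapeG, hN, hf, hg, hh, hW])
  refine closure_mono ?_ key
  rintro W' ⟨t, ht, hW'⟩
  rw [map_mul] at ht
  rw [map_shapeF, map_shapeG, hN] at hW'
  refine mem_nfSet_of_shape he (left_ne_zero_of_mul ht) (right_ne_zero_of_mul ht) ?_ hW'
  simp [h', h0, show (0 : ℕ) ≠ e by omega]

end

/-! ### Density of the normal forms in the family -/

section

variable {k : Type*} [Field k]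

theorem subst_inv_subst {N : Matrix (Fin 3) (Fin 3) k} (hN : IsUnit N.det) (F : Poly k) :
    subst N⁻¹ (subst N F) = F := by
  rw [subst_subst, Matrix.mul_nonsing_inv _ hN, subst_one]

theorem subst_subst_inv {N : Matrix (Fin 3) (Fin 3) k} (hN : IsUnit N.det) (F : Poly k) :
    subst N (subst N⁻¹ F) = F := by
  rw [subst_subst, Matrix.nonsing_inv_mul _ hN, subst_one]

theorem subst_eq_zero_iff {N : Matrix (Fin 3) (Fin 3) k} (hN : IsUnit N.det) {F : Poly k} :
    subst N F = 0 ↔ F = 0 := by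
  refine ⟨fun h => ?_, fun h => by rw [h, map_zero]⟩
  rw [← subst_inv_subst hN F, h, map_zero]

theorem dirDeriv_add (a : Fin 3 → k) (F G : Poly k) :
    dirDeriv a (F + G) = dirDeriv a F + dirDeriv a G := map_add _ _ _

theorem dirDeriv_smul_right (c : k) (a : Fin 3 → k) (F : Poly k) :
    dirDeriv a (c • F) = c • dirDeriv a F := map_smul _ _ _

theorem mem_closure_nfSet_of_generic [CharZero k] {e : ℕ} (he : 1 ≤ e) {W : Gr k e} {F G : Poly k}
    {a b : Fin 3 → k} (hW : W.1 = Submodule.span k {F, G}) (ha : a 2 ≠ 0) (hb : b 0 ≠ 0)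
    (hab : a 0 * b 2 - a 2 * b 0 ≠ 0) (hF : dirDeriv a F = 0)
    (hG : dirDeriv a (dirDeriv b G) = 0) : W ∈ closure (nfSet k e (3 * e + 3)) := by
  have hFh : F.IsHomogeneous e := W.2.1 (hW ▸ Submodule.subset_span (by simp))
  have hGh : G.IsHomogeneous e := W.2.1 (hW ▸ Submodule.subset_span (by simp))
  let Δ := a 0 * b 2 - a 2 * b 0
  -- The entries solve the equations that make `N a` a multiple of the last basis vector and `N b`
  -- one of the first; Cramer's rule gives the middle row.
  let N := normalMat ((a 2 * b 1 - a 1 * b 2) / Δ) ((a 1 * b 0 - a 0 * b 1) / Δ)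
    (-a 0 / a 2) (-b 2 / b 0)
  have hNd : IsUnit N.det := by
    have : N.det = -Δ / (a 2 * b 0) := by
      simp only [N, normalMat, Matrix.det_fin_three, Matrix.of_apply, Matrix.cons_val]
      field_simp
      simp only [Δ]
      ring
    rw [this]
    exact (div_ne_zero (neg_ne_zero.mpr hab) (mul_ne_zero ha hb)).isUnit
  have hΔ : Δ ≠ 0 := hab
  have hNa : N.mulVec a = (-Δ / b 0) • Pi.single 2 1 := by
    ext i
    fin_cases i <;> simp [N, normalMat, Matrix.mulVec, dotProduct, Fin.sum_univ_three] <;>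
      field_simp <;> (try simp only [Δ]) <;> ring
  have hNb : N.mulVec b = (-Δ / a 2) • Pi.single 0 1 := by
    ext i
    fin_cases i <;> simp [N, normalMat, Matrix.mulVec, dotProduct, Fin.sum_univ_three] <;>
      field_simp <;> (try simp only [Δ]) <;> ring
  have hsa : -Δ / b 0 ≠ 0 := div_ne_zero (neg_ne_zero.mpr hab) hb
  have hsb : -Δ / a 2 ≠ 0 := div_ne_zero (neg_ne_zero.mpr hab) ha
  have hF' : pderiv 2 (subst N⁻¹ F) = 0 := by
    rw [← subst_subst_inv hNd F, dirDeriv_subst, hNa, subst_eq_zero_iff hNd, dirDeriv_smul,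
      dirDeriv_single] at hF
    exact (smul_eq_zero_iff_right hsa).mp hF
  have hG' : pderiv 2 (pderiv 0 (subst N⁻¹ G)) = 0 := by
    rw [← subst_subst_inv hNd G, dirDeriv_subst, dirDeriv_subst, hNa, hNb, subst_eq_zero_iff hNd,
      dirDeriv_smul, dirDeriv_smul, dirDeriv_single, dirDeriv_single, Derivation.map_smul] at hG
    exact (smul_eq_zero_iff_right hsb).mp ((smul_eq_zero_iff_right hsa).mp hG)
  obtain ⟨f, hf⟩ := eq_bin_of_pderiv (isHomogeneous_subst _ hFh) hF'
  obtain ⟨g, h, h0, hg⟩ := eq_bin_add_bin_of_pderiv (isHomogeneous_subst _ hGh) hG'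
  have hW' : W.1 = Submodule.span k {shapeF N f e, shapeG N g h e} := by
    rw [shapeF, shapeG, ← hf, ← hg, subst_subst_inv hNd, subst_subst_inv hNd, hW]
  exact mem_closure_nfSet_of_shape he h0 hW'

/-- The plane is moved by a generic matrix `T`. The moved forms have the directions `adj(T) a` and
`adj(T) b`, polynomial in `T` unlike those from the inverse. The conditions of
`mem_closure_nfSet_of_generic` hold for some `T`, and `T = 1` gives back the plane. -/
theorem mem_closure_nfSet_of_linearIndependent [CharZero k] {e : ℕ} (he : 1 ≤ e) {W : Gr k e}
    {F G : Poly k} {a b : Fin 3 → k} (hW : W.1 = Submodule.span k {F, G})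
    {A : Matrix (Fin 3) (Fin 3) k} (hA : A.det ≠ 0) (ha : A.mulVec (Pi.single 2 1) = a)
    (hb : A.mulVec (Pi.single 0 1) = b) (hF : dirDeriv a F = 0)
    (hG : dirDeriv a (dirDeriv b G) = 0) : W ∈ closure (nfSet k e (3 * e + 3)) := by
  have hFh : F.IsHomogeneous e := W.2.1 (hW ▸ Submodule.subset_span (by simp))
  have hGh : G.IsHomogeneous e := W.2.1 (hW ▸ Submodule.subset_span (by simp))
  let M : Matrix (Fin 3) (Fin 3) (MvPolynomial (Fin 3 × Fin 3) k) := fun i j => X (i, j)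
  let v := M.adjugate.mulVec (fun i => C (a i))
  let w := M.adjugate.mulVec (fun i => C (b i))
  let D := v 2 * w 0 * (v 0 * w 2 - v 2 * w 0)
  have hM : ∀ t : Fin 3 × Fin 3 → k, M.map (eval t) = fun i j => t (i, j) := fun t => by
    ext i j; exact eval_X _
  have hadj : ∀ (t : Fin 3 × Fin 3 → k) (c : Fin 3 → k) (i : Fin 3),
      eval t (M.adjugate.mulVec (fun i => C (c i)) i) =
        (Matrix.adjugate (fun i j => t (i, j))).mulVec c i := fun t c i => by
    have h1 := RingHom.map_mulVec (eval t) M.adjugate (fun i => C (c i)) i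
    have h2 := RingHom.map_adjugate (eval t) M
    rw [RingHom.mapMatrix_apply, RingHom.mapMatrix_apply, hM] at h2
    rw [h1, h2]
    congr 1
    ext j
    simp
  -- At `T = A` the two directions become nonzero multiples of the last and the first basis vector.
  have hD : D ≠ 0 := by
    intro h0
    have h1 := congrArg (eval fun ij => A ij.1 ij.2) h0
    have e1 : A.adjugate.mulVec a = A.det • Pi.single 2 1 := by
      rw [← ha, Matrix.mulVec_mulVec, Matrix.adjugate_mul, Matrix.smul_mulVec, Matrix.one_mulVec]
    have e2 : A.adjugate.mulVec b = A.det • Pi.single 0 1 := by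
      rw [← hb, Matrix.mulVec_mulVec, Matrix.adjugate_mul, Matrix.smul_mulVec, Matrix.one_mulVec]
    simp only [D, v, w, map_mul, map_sub, hadj, map_zero] at h1
    change A.adjugate.mulVec a 2 * A.adjugate.mulVec b 0 * (A.adjugate.mulVec a 0 *
      A.adjugate.mulVec b 2 - A.adjugate.mulVec a 2 * A.adjugate.mulVec b 0) = 0 at h1
    rw [e1, e2] at h1
    simp [hA] at h1
  have hmap : ∀ (t : Fin 3 × Fin 3 → k) (H : Poly k),
      map (eval t) (subst M (map C H)) = subst (fun i j => t (i, j)) H := fun t H => by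
    rw [map_subst, hM, map_map]
    congr 1
    have : (eval t).comp C = RingHom.id k := by ext; simp
    rw [this, map_id]
  have hone : (fun i j => (1 : Matrix (Fin 3) (Fin 3) k) i j) = (1 : Matrix (Fin 3) (Fin 3) k) :=
      rfl
  have key := mem_closure_paramSet (isHomogeneous_subst M (hFh.map C))
    (isHomogeneous_subst M (hGh.map C)) hD (W := W)
    (t₀ := fun ij => (1 : Matrix (Fin 3) (Fin 3) k) ij.1 ij.2) (by
      rw [hmap, hmap, hone, subst_one, subst_one, hW])
  rw [← closure_closure]
  refine closure_mono ?_ key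
  rintro W' ⟨t, ht, hW'⟩
  rw [hmap, hmap] at hW'
  let T : Matrix (Fin 3) (Fin 3) k := fun i j => t (i, j)
  simp only [D, v, w, map_mul, map_sub, hadj] at ht
  have hker : ∀ c : Fin 3 → k, T.mulVec (T.adjugate.mulVec c) = T.det • c := fun c => by
    rw [Matrix.mulVec_mulVec, Matrix.mul_adjugate, Matrix.smul_mulVec, Matrix.one_mulVec]
  refine mem_closure_nfSet_of_generic he hW' (a := T.adjugate.mulVec a) (b := T.adjugate.mulVec b)
    (left_ne_zero_of_mul (left_ne_zero_of_mul ht)) (right_ne_zero_of_mul (left_ne_zero_of_mul ht))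
    (right_ne_zero_of_mul ht) ?_ ?_
  · change dirDeriv _ (subst T F) = 0
    rw [dirDeriv_subst, hker, dirDeriv_smul, hF, smul_zero, map_zero]
  · change dirDeriv _ (dirDeriv _ (subst T G)) = 0
    rw [dirDeriv_subst, dirDeriv_subst, hker, hker, dirDeriv_smul, dirDeriv_smul,
      dirDeriv_smul_right, hG, smul_zero, smul_zero, map_zero]

theorem exists_matrix_of_cross_ne_zero {a b : Fin 3 → k} (h : crossProduct a b ≠ 0) :
    ∃ A : Matrix (Fin 3) (Fin 3) k, A.det ≠ 0 ∧ A.mulVec (Pi.single 2 1) = a ∧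
      A.mulVec (Pi.single 0 1) = b := by
  obtain ⟨i, hi⟩ := Function.ne_iff.mp h
  -- With `i` a nonzero coordinate of the cross product, the triple product of the columns is that
  -- coordinate.
  refine ⟨(Matrix.of ![b, Pi.single i 1, a]).transpose, ?_, ?_, ?_⟩
  · rw [Matrix.det_transpose]
    have := triple_product_eq_det b (Pi.single i 1) a
    change _ = Matrix.det (Matrix.of ![b, Pi.single i 1, a]) at this
    rw [← this, triple_product_permutation]
    simpa using hi
  · ext j; simp
  · ext j; simp

theorem exists_cross_ne_zero {a : Fin 3 → k} (h : a ≠ 0) : ∃ b, crossProduct a b ≠ 0 := by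
  by_contra! h0
  apply h
  have h1 := h0 ![1, 0, 0]
  have h2 := h0 ![0, 1, 0]
  rw [cross_apply] at h1 h2
  ext i
  fin_cases i
  · simpa using congrFun h2 2
  · simpa using congrFun h1 2
  · simpa using congrFun h1 1

/-- Up to the factor `s`, the inner product is `(X 1 + s X 2)^(n+1) - X 1^(n+1)`, a difference of
terms killed by `![0, -s, 1]` and by the last basis vector respectively. At `s = 0` it is `(n + 1) X
2 X 1^n`: a double direction is the limit of two distinct ones. -/
theorem bin_add_mul_deformation (h : ℕ → k) (e : ℕ) (s : k) (hs : s ≠ 0) [CharZero k] :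
    dirDeriv (Pi.single 2 1) (dirDeriv ![0, -s, 1] (∑ i ∈ Finset.range (e + 1),
      C (h i / ((e - i : ℕ) + 1)) * (X 0 ^ i * (X 2 * ∑ j ∈ Finset.range (e - i + 1),
        (X 1 + C s * X 2) ^ j * X 1 ^ (e - i - j))))) = 0 := by
  have key : ∀ n i : ℕ, dirDeriv (Pi.single 2 1) (dirDeriv ![0, -s, 1]
      (X 0 ^ i * (X 2 * ∑ j ∈ Finset.range (n + 1), (X 1 + C s * X 2) ^ j * X 1 ^ (n - j)))) = 0 :=
        by
    intro n i
    have h1 : s • ((X 0 : Poly k) ^ i * (X 2 * ∑ j ∈ Finset.range (n + 1),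
        (X 1 + C s * X 2) ^ j * X 1 ^ (n - j))) =
        X 0 ^ i * (X 1 + C s * X 2) ^ (n + 1) - X 0 ^ i * X 1 ^ (n + 1) := by
      have h2 := geom_sum₂_mul (X 1 + C s * X 2 : Poly k) (X 1) (n + 1)
      simp only [Nat.add_sub_cancel] at h2
      rw [← mul_sub, ← h2, smul_eq_C_mul]
      ring
    refine (smul_eq_zero_iff_right hs).mp ?_
    rw [← dirDeriv_smul_right, ← dirDeriv_smul_right, h1]
    have h3 : dirDeriv ![0, -s, 1] (X 0 ^ i * (X 1 + C s * X 2) ^ (n + 1)) = 0 := by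
      simp [dirDeriv_eq, Fin.sum_univ_three, Derivation.leibniz, Derivation.leibniz_pow, pderiv_X]
      ring
    have h4 : dirDeriv (Pi.single 2 1) ((X 0 : Poly k) ^ i * X 1 ^ (n + 1)) = 0 := by
      simp [dirDeriv_single, Derivation.leibniz, Derivation.leibniz_pow, pderiv_X]
    rw [dirDeriv, dirDeriv, map_sub, map_sub]
    change dirDeriv _ (dirDeriv _ _) - dirDeriv _ (dirDeriv _ _) = 0
    rw [h3, dirDeriv_comm, h4, dirDeriv_zero, dirDeriv_zero, sub_zero]
  rw [dirDeriv, dirDeriv, map_sum, map_sum]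
  refine Finset.sum_eq_zero fun i _ => ?_
  change dirDeriv _ (dirDeriv _ _) = 0
  rw [← smul_eq_C_mul, dirDeriv_smul_right, dirDeriv_smul_right, key, smul_zero]

/-- In suitable coordinates `G = g(X 0, X 1) + X 2 h(X 0, X 1)`. The second summand is deformed by
`bin_add_mul_deformation`; for a nonzero parameter the two directions are independent. -/
theorem mem_closure_nfSet_of_eq [CharZero k] {e : ℕ} {W : Gr k (e + 1)}
    {F G : Poly k} {a : Fin 3 → k} (hW : W.1 = Submodule.span k {F, G}) (ha0 : a ≠ 0)
    (hF : dirDeriv a F = 0) (hG : dirDeriv a (dirDeriv a G) = 0) :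
    W ∈ closure (nfSet k (e + 1) (3 * (e + 1) + 3)) := by
  have hFh : F.IsHomogeneous (e + 1) := W.2.1 (hW ▸ Submodule.subset_span (by simp))
  have hGh : G.IsHomogeneous (e + 1) := W.2.1 (hW ▸ Submodule.subset_span (by simp))
  obtain ⟨b, hb⟩ := exists_cross_ne_zero ha0
  obtain ⟨A, hA, hAa, -⟩ := exists_matrix_of_cross_ne_zero hb
  have hAu : IsUnit A.det := hA.isUnit
  have hAi : IsUnit (A⁻¹).det := by rw [Matrix.isUnit_nonsing_inv_det_iff]; exact hAu
  have hAa' : (A⁻¹).mulVec a = Pi.single 2 1 := by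
    rw [← hAa, Matrix.mulVec_mulVec, Matrix.nonsing_inv_mul _ hAu, Matrix.one_mulVec]
  have hF' : pderiv 2 (subst A F) = 0 := by
    rw [← dirDeriv_single, dirDeriv_subst, hAa, hF, map_zero]
  have hG' : pderiv 2 (pderiv 2 (subst A G)) = 0 := by
    rw [← dirDeriv_single, ← dirDeriv_single, dirDeriv_subst, dirDeriv_subst, hAa, hG, map_zero]
  obtain ⟨f, hf⟩ := eq_bin_of_pderiv (isHomogeneous_subst _ hFh) hF'
  obtain ⟨g, h, hg⟩ := eq_bin_add_mul_bin_of_pderiv (isHomogeneous_subst _ hGh) hG'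
  let N : Matrix (Fin 3) (Fin 3) (MvPolynomial Unit k) := A⁻¹.map C
  let s : MvPolynomial Unit k := X ()
  let F' : MvPolynomial (Fin 3) (MvPolynomial Unit k) := bin (fun i => C (f i)) (e + 1) (X 0) (X 1)
  let G' : MvPolynomial (Fin 3) (MvPolynomial Unit k) := bin (fun i => C (g i)) (e + 1) (X 0) (X 1)
      +
    ∑ i ∈ Finset.range (e + 1), C (C (h i / ((e - i : ℕ) + 1))) * (X 0 ^ i * (X 2 *
      ∑ j ∈ Finset.range (e - i + 1), (X 1 + C s * X 2) ^ j * X 1 ^ (e - i - j)))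
  have hF'h : F'.IsHomogeneous (e + 1) := bin_isHomogeneous _ _ (isHomogeneous_X _ _)
      (isHomogeneous_X _ _)
  have hG'h : G'.IsHomogeneous (e + 1) := by
    refine (bin_isHomogeneous _ _ (isHomogeneous_X _ _) (isHomogeneous_X _ _)).add
      (IsHomogeneous.sum _ _ _ fun i hi => IsHomogeneous.C_mul ?_ _)
    have hi := Finset.mem_range.mp hi
    have h1 : (∑ j ∈ Finset.range (e - i + 1), (X 1 + C s * X 2) ^ j * X 1 ^ (e - i - j) :
        MvPolynomial (Fin 3) (MvPolynomial Unit k)).IsHomogeneous (e - i) := by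
      refine IsHomogeneous.sum _ _ _ fun j hj => ?_
      have hj := Finset.mem_range.mp hj
      have h2 : (X 1 + C s * X 2 : MvPolynomial (Fin 3) (MvPolynomial Unit k)).IsHomogeneous 1 :=
        (isHomogeneous_X _ _).add (isHomogeneous_C_mul_X _ _)
      have h3 := (h2.pow j).mul ((isHomogeneous_X (MvPolynomial Unit k) (1 : Fin 3)).pow (e - i -
          j))
      rwa [one_mul, one_mul, Nat.add_sub_cancel' (by omega)] at h3
    have h4 := ((isHomogeneous_X (MvPolynomial Unit k) (0 : Fin 3)).pow i).mul
      ((isHomogeneous_X (MvPolynomial Unit k) (2 : Fin 3)).mul h1)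
    rwa [one_mul, show i + (1 + (e - i)) = e + 1 by omega] at h4
  have hN : ∀ t : Unit → k, N.map (eval t) = A⁻¹ := fun t => by ext i j; simp [N]
  have hmF : ∀ t : Unit → k, map (eval t) F' = subst A F := fun t => by
    rw [hf]; simp [F', map_bin]
  have hmG : ∀ t : Unit → k, map (eval t) G' = bin g (e + 1) (X 0) (X 1) +
      ∑ i ∈ Finset.range (e + 1), C (h i / ((e - i : ℕ) + 1)) * (X 0 ^ i * (X 2 *
      ∑ j ∈ Finset.range (e - i + 1), (X 1 + C (t ()) * X 2) ^ j * X 1 ^ (e - i - j))) := fun t =>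
        by
    simp [G', map_bin, s]
  have hG0 : map (eval 0) G' = subst A G := by
    rw [hmG, hg]
    congr 1
    rw [bin, Finset.mul_sum]
    refine Finset.sum_congr rfl fun i _ => ?_
    have h1 : ∀ j ∈ Finset.range (e - i + 1),
        (X 1 + C ((0 : Unit → k) ()) * X 2 : Poly k) ^ j * X 1 ^ (e - i - j) = X 1 ^ (e - i) := by
      intro j hj
      have hj := Finset.mem_range.mp hj
      rw [Pi.zero_apply, C_0, zero_mul, add_zero, ← pow_add, Nat.add_sub_cancel' (by omega)]
    rw [Finset.sum_congr rfl h1, Finset.sum_const, Finset.card_range, nsmul_eq_mul]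
    have h2 : (((e - i : ℕ) : k) + 1) ≠ 0 := Nat.cast_add_one_ne_zero _
    have h3 : C (h i / (((e - i : ℕ) : k) + 1)) * (((e - i + 1 : ℕ)) : Poly k) = C (h i) := by
      rw [← map_natCast C, ← C_mul, Nat.cast_add_one, div_mul_cancel₀ _ h2]
    rw [← h3]
    ring
  have key := mem_closure_paramSet (isHomogeneous_subst N hF'h) (isHomogeneous_subst N hG'h)
    (X_ne_zero () : (X () : MvPolynomial Unit k) ≠ 0) (W := W) (t₀ := 0) (by
      rw [map_subst, map_subst, hN, hmF, hG0, subst_inv_subst hAu, subst_inv_subst hAu, hW])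
  rw [← closure_closure]
  refine closure_mono ?_ key
  rintro W' ⟨t, ht, hW'⟩
  rw [eval_X] at ht
  rw [map_subst, map_subst, hN, hmF, hmG] at hW'
  let M : Matrix (Fin 3) (Fin 3) k := !![0, 1, 0; -t (), 0, 0; 1, 0, 1]
  have hM : M.det ≠ 0 := by simpa [M, Matrix.det_fin_three] using ht
  have hM2 : M.mulVec (Pi.single 2 1) = Pi.single 2 1 := by
    ext i; fin_cases i <;> simp [M]
  have hM0 : M.mulVec (Pi.single 0 1) = ![0, -t (), 1] := by
    ext i; fin_cases i <;> simp [M]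
  have hinv : ∀ v, (A⁻¹).mulVec (A.mulVec v) = v := fun v => by
    rw [Matrix.mulVec_mulVec, Matrix.nonsing_inv_mul _ hAu, Matrix.one_mulVec]
  refine mem_closure_nfSet_of_linearIndependent (by omega) hW' (A := A * M)
    (a := a) (b := A.mulVec ![0, -t (), 1]) ?_ ?_ ?_ ?_ ?_
  · rw [Matrix.det_mul]; exact mul_ne_zero hA hM
  · rw [← Matrix.mulVec_mulVec, hM2, hAa]
  · rw [← Matrix.mulVec_mulVec, hM0]
  · rw [dirDeriv_subst, hAa', dirDeriv_single, hF', map_zero]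
  · rw [dirDeriv_subst, dirDeriv_subst, hAa', hinv, dirDeriv_add, dirDeriv_add,
      bin_add_mul_deformation _ _ _ ht, add_zero, dirDeriv_comm, dirDeriv_single, pderiv_two_bin,
      dirDeriv_zero, map_zero]

theorem family_subset_closure_nfSet [CharZero k] {e : ℕ} (he : 1 ≤ e) :
    family k e ⊆ closure (nfSet k e (3 * e + 3)) := by
  intro W hW
  obtain ⟨F, G, a, b, hW, ha, hb, hF, hG⟩ := mem_family_iff.mp hW
  by_cases hab : crossProduct a b = 0
  · have h1 : ¬ LinearIndependent k ![a, b] := by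
      rw [← crossProduct_ne_zero_iff_linearIndependent, not_not]; exact hab
    rw [LinearIndependent.pair_iff' ha] at h1
    push Not at h1
    obtain ⟨c, rfl⟩ := h1
    obtain ⟨e, rfl⟩ : ∃ e', e = e' + 1 := ⟨e - 1, by omega⟩
    refine mem_closure_nfSet_of_eq hW ha hF ?_
    rw [dirDeriv_smul, dirDeriv_smul_right] at hG
    exact (smul_eq_zero_iff_right (by rintro rfl; simp at hb)).mp hG
  · obtain ⟨A, hA, h1, h2⟩ := exists_matrix_of_cross_ne_zero hab
    exact mem_closure_nfSet_of_linearIndependent he hW hA h1 h2 hF hG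

end

/-! ### Irreducibility, and the chain of strata bounding the dimension from below -/

section

section Expo

/-- The exponent `(a, b, c)`. -/
noncomputable def expo (a b c : ℕ) : Fin 3 →₀ ℕ := Finsupp.equivFunOnFinite.symm ![a, b, c]

@[simp] theorem expo_zero (a b c : ℕ) : expo a b c 0 = a := rfl
@[simp] theorem expo_one (a b c : ℕ) : expo a b c 1 = b := rfl
@[simp] theorem expo_two (a b c : ℕ) : expo a b c 2 = c := rfl

theorem expo_inj {a b c a' b' c' : ℕ} :
    expo a b c = expo a' b' c' ↔ a = a' ∧ b = b' ∧ c = c' := by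
  refine ⟨fun h => ⟨?_, ?_, ?_⟩, by rintro ⟨rfl, rfl, rfl⟩; rfl⟩
  · simpa using DFunLike.congr_fun h 0
  · simpa using DFunLike.congr_fun h 1
  · simpa using DFunLike.congr_fun h 2

theorem expo_add (a b c a' b' c' : ℕ) :
    expo a b c + expo a' b' c' = expo (a + a') (b + b') (c + c') := by
  ext i; fin_cases i <;> rfl

theorem expo_add_single_zero (a b c : ℕ) : expo a b c + Finsupp.single 0 1 = expo (a + 1) b c := by
  ext i; fin_cases i <;> simp

theorem expo_add_single_one (a b c : ℕ) : expo a b c + Finsupp.single 1 1 = expo a (b + 1) c := by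
  ext i; fin_cases i <;> simp

theorem expo_add_single_two (a b c : ℕ) : expo a b c + Finsupp.single 2 1 = expo a b (c + 1) := by
  ext i; fin_cases i <;> simp

theorem degree_expo (a b c : ℕ) : (expo a b c).degree = a + b + c := by
  rw [Finsupp.degree_eq_sum, Fin.sum_univ_three]; rfl

theorem X_pow_mul_eq_monomial {K : Type*} [CommRing K] (a b c : ℕ) :
    (X 0 ^ a * X 1 ^ b * X 2 ^ c : MvPolynomial (Fin 3) K) = monomial (expo a b c) 1 := by
  have h : Finsupp.single 0 a + Finsupp.single 1 b + Finsupp.single 2 c = expo a b c := by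
    ext i; fin_cases i <;> simp
  rw [X_pow_eq_monomial, X_pow_eq_monomial, X_pow_eq_monomial, monomial_mul, monomial_mul, h,
    mul_one, mul_one]

theorem coeff_X_pow_mul {K : Type*} [CommRing K] (a b c a' b' c' : ℕ) :
    coeff (expo a b c) (X 0 ^ a' * X 1 ^ b' * X 2 ^ c' : MvPolynomial (Fin 3) K) =
      if a = a' ∧ b = b' ∧ c = c' then 1 else 0 := by
  rw [X_pow_mul_eq_monomial, coeff_monomial]
  simp only [expo_inj, eq_comm]

end Expo

variable {k : Type*} [Field k]

theorem exists_gr_of_pluecker_ne_zero {e : ℕ} {F G : Poly k} (hF : F.IsHomogeneous e)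
    (hG : G.IsHomogeneous e) {mn : (Fin 3 →₀ ℕ) × (Fin 3 →₀ ℕ)} (h : pluecker F G mn ≠ 0) :
    ∃ W : Gr k e, W.1 = Submodule.span k {F, G} := by
  refine ⟨⟨Submodule.span k {F, G}, ?_, finrank_span_pair_eq_two_iff_pluecker.mpr ⟨mn, h⟩⟩, rfl⟩
  rw [Submodule.span_le]
  rintro y (rfl | rfl)
  exacts [hF, hG]

theorem bin_eq_pow_add (f : ℕ → k) {e : ℕ} (u v : Poly k) (h : f e = 1) :
    bin f e u v = u ^ e + ∑ i ∈ Finset.range e, C (f i) * (u ^ i * v ^ (e - i)) := by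
  rw [bin, Finset.sum_range_succ, add_comm, h, C_1, one_mul, Nat.sub_self, pow_zero, mul_one]

theorem subst_nfMat_X_zero (e : ℕ) (t : ℕ → k) :
    subst (nfMat e t) (X 0) = X 0 + C (t (3 * e + 2)) * X 2 := by
  simp [subst_X, nfMat, normalMat, Fin.sum_univ_three]

theorem subst_nfMat_X_one (e : ℕ) (t : ℕ → k) : subst (nfMat e t) (X 1) =
    C (t (3 * e - 1)) * X 0 + X 1 + C (t (3 * e + 1)) * X 2 := by
  simp [subst_X, nfMat, normalMat, Fin.sum_univ_three]

theorem subst_nfMat_X_two (e : ℕ) (t : ℕ → k) :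
    subst (nfMat e t) (X 2) = C (t (3 * e)) * X 0 + X 2 := by
  simp [subst_X, nfMat, normalMat, Fin.sum_univ_three]

theorem nfF_eq (e : ℕ) (t : ℕ → k) : nfF e t = (X 0 + C (t (3 * e + 2)) * X 2) ^ e +
    ∑ i ∈ Finset.range e, C (t i) * ((X 0 + C (t (3 * e + 2)) * X 2) ^ i *
      (C (t (3 * e - 1)) * X 0 + X 1 + C (t (3 * e + 1)) * X 2) ^ (e - i)) := by
  rw [nfF, shapeF, subst_bin, bin_eq_pow_add _ _ _ (by simp), subst_nfMat_X_zero,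
    subst_nfMat_X_one]
  refine congrArg _ (Finset.sum_congr rfl fun i hi => ?_)
  rw [if_pos (Finset.mem_range.mp hi)]

theorem nfG_eq {e : ℕ} (he : 1 ≤ e) (t : ℕ → k) : nfG e t = (C (t (3 * e)) * X 0 + X 2) ^ e +
    ∑ i ∈ Finset.range e, C (t (e + i)) * ((X 0 + C (t (3 * e + 2)) * X 2) ^ i *
      (C (t (3 * e - 1)) * X 0 + X 1 + C (t (3 * e + 1)) * X 2) ^ (e - i)) +
    ∑ i ∈ Finset.range (e - 1), C (t (2 * e + i)) * ((C (t (3 * e)) * X 0 + X 2) ^ (i + 1) *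
      (C (t (3 * e - 1)) * X 0 + X 1 + C (t (3 * e + 1)) * X 2) ^ (e - (i + 1))) := by
  have h1 : ∀ u v : Poly k, bin (fun i => if i < e then t (e + i) else 0) e u v =
      ∑ i ∈ Finset.range e, C (t (e + i)) * (u ^ i * v ^ (e - i)) := by
    intro u v
    rw [bin, Finset.sum_range_succ, if_neg (lt_irrefl e), C_0, zero_mul, add_zero]
    refine Finset.sum_congr rfl fun i hi => ?_
    rw [if_pos (Finset.mem_range.mp hi)]
  have h2 : ∀ u v : Poly k, bin (fun i => if i = 0 then 0 else if i < e then t (2 * e + i - 1) else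
      1)
      e u v = u ^ e +
      ∑ i ∈ Finset.range (e - 1), C (t (2 * e + i)) * (u ^ (i + 1) * v ^ (e - (i + 1))) := by
    intro u v
    rw [bin_eq_pow_add _ _ _ (by rw [if_neg (by omega), if_neg (lt_irrefl e)])]
    refine congrArg _ ?_
    conv_lhs => rw [← Nat.sub_add_cancel he]
    rw [Finset.sum_range_succ', if_pos rfl, C_0, zero_mul, add_zero]
    refine Finset.sum_congr rfl fun i hi => ?_
    have hi := Finset.mem_range.mp hi
    rw [Nat.sub_add_cancel he, if_neg (by omega), if_pos (by omega), ← Nat.add_assoc,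
      Nat.add_sub_cancel]
  rw [nfG, shapeG, map_add, subst_bin, subst_bin, subst_nfMat_X_zero, subst_nfMat_X_one,
    subst_nfMat_X_two, h1, h2]
  ring

theorem coeff_nfF {e : ℕ} {t : ℕ → k} (ht : ∀ j, 3 * e - 1 ≤ j → t j = 0) (a b c : ℕ) :
    coeff (expo a b c) (nfF e t) =
      if c = 0 ∧ a + b + c = e then (if a < e then t a else 1) else 0 := by
  have h1 : nfMat e t = 1 := by
    rw [nfMat, ht _ le_rfl, ht _ (by omega), ht _ (by omega), ht _ (by omega)]
    ext i j; fin_cases i <;> fin_cases j <;> simp [normalMat]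
  rw [nfF, h1, shapeF, subst_one, coeff_bin _ _ (show (0 : Fin 3) ≠ 1 by decide)
    (show (0 : Fin 3) ≠ 2 by decide) (by decide), degree_expo, expo_zero, expo_two]

theorem coeff_nfG {e : ℕ} {t : ℕ → k} (ht : ∀ j, 3 * e - 1 ≤ j → t j = 0) (a b c : ℕ) :
    coeff (expo a b c) (nfG e t) =
      (if c = 0 ∧ a + b + c = e then (if a < e then t (e + a) else 0) else 0) +
      (if a = 0 ∧ a + b + c = e then (if c = 0 then 0 else if c < e then t (2 * e + c - 1) else 1)
        else 0) := by
  have h1 : nfMat e t = 1 := by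
    rw [nfMat, ht _ le_rfl, ht _ (by omega), ht _ (by omega), ht _ (by omega)]
    ext i j; fin_cases i <;> fin_cases j <;> simp [normalMat]
  rw [nfG, h1, shapeG, subst_one, coeff_add, coeff_bin _ _ (show (0 : Fin 3) ≠ 1 by decide)
    (show (0 : Fin 3) ≠ 2 by decide) (by decide), coeff_bin _ _ (show (2 : Fin 3) ≠ 1 by decide)
    (show (2 : Fin 3) ≠ 0 by decide) (by decide), degree_expo, expo_zero, expo_two]

theorem pluecker_nf_eq_one {e : ℕ} (he : 1 ≤ e) {t : ℕ → k} (ht : ∀ j, 3 * e - 1 ≤ j → t j = 0) :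
    pluecker (nfF e t) (nfG e t) (expo e 0 0, expo 0 0 e) = 1 := by
  simp [pluecker, coeff_nfF ht, coeff_nfG ht, show e ≠ 0 by omega]

theorem nfSet_isIrreducible [CharZero k] {e : ℕ} (he : 1 ≤ e) (n : ℕ) :
    IsIrreducible (nfSet k e n) := by
  refine ⟨?_, isPreirreducible_paramSet (nfF_isHomogeneous _ _) (nfG_isHomogeneous _ _) _⟩
  obtain ⟨W, hW⟩ := exists_gr_of_pluecker_ne_zero (nfF_isHomogeneous e (fun _ => (0 : k)))
    (nfG_isHomogeneous e _) (by rw [pluecker_nf_eq_one he (by simp)]; exact one_ne_zero)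
  exact ⟨W, mem_nfSet.mpr ⟨_, by simp, hW⟩⟩

theorem isIrreducible_of_subset_closure {Y : Type*} [TopologicalSpace Y] {S T : Set Y}
    (hS : IsIrreducible S) (hST : S ⊆ T) (hT : T ⊆ closure S) : IsIrreducible T := by
  rw [← isIrreducible_iff_closure] at hS ⊢
  rwa [subset_antisymm (closure_minimal hT isClosed_closure) (closure_mono hST)]

theorem family_isIrreducible [CharZero k] {e : ℕ} (he : 1 ≤ e) : IsIrreducible (family k e) :=
  isIrreducible_of_subset_closure (nfSet_isIrreducible he _) (nfSet_subset_family e _)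
    (family_subset_closure_nfSet he)

theorem topologicalKrullDim_family_le [CharZero k] {e : ℕ} (he : 1 ≤ e) :
    topologicalKrullDim (family k e) ≤ ((3 * (e + 1) : ℕ) : WithBot ℕ∞) := by
  have h := topologicalKrullDim_le (family_subset_closure_nfSet (k := k) he)
  rwa [Fintype.card_fin] at h

/-- A homogeneous polynomial of positive degree vanishes at the zero vector, so `F` and `G` with a
nonzero value of `P` automatically span a plane. -/
theorem not_subset_closure_nfSet [CharZero k] {e i n : ℕ} {T : Set (Gr k e)} {P : PlueckerPoly k}
    (hP : P.IsHomogeneous n) (hn : n ≠ 0) (hS : ∀ t : ℕ → k, (∀ j, i ≤ j → t j = 0) →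
      eval (pluecker (nfF e t) (nfG e t)) P = 0) {F G : Poly k} (hF : F.IsHomogeneous e)
    (hG : G.IsHomogeneous e) (hne : eval (pluecker F G) P ≠ 0)
    (hT : ∀ W : Gr k e, W.1 = Submodule.span k {F, G} → W ∈ T) :
    ¬ T ⊆ closure (nfSet k e i) := by
  obtain ⟨mn, hmn⟩ : ∃ mn, pluecker F G mn ≠ 0 := by
    by_contra! h0
    apply hne
    have h1 : pluecker F G = (0 : k) • pluecker F G := by
      ext mn; simp [h0]
    rw [h1, eval_smul_of_isHomogeneous hP, zero_pow hn, zero_mul]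
  obtain ⟨W, hW⟩ := exists_gr_of_pluecker_ne_zero hF hG hmn
  refine not_subset_closure_of_eval P (fun W' hW' F' G' h' => ?_) (hT W hW) hW hne
  obtain ⟨t, ht, h⟩ := mem_nfSet.mp hW'
  have hr := W'.2.2
  rw [h'] at hr
  obtain ⟨s, -, hs⟩ := exists_pluecker_eq_smul hr (h'.symm.trans h)
  rw [hs, eval_smul_of_isHomogeneous hP, hS t ht, mul_zero]

/-- While the substitution is trivial, `X 0 ^ e` has coefficients `1, 0` in the two forms and `X 2 ^
e` has `0, 1`, so every remaining parameter is itself a Plücker coordinate. -/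
theorem not_nfSet_subset_closure_of_coeff [CharZero k] {e i : ℕ} (he : 1 ≤ e) (hi : i < 3 * e - 1) :
    ¬ nfSet k e (i + 1) ⊆ closure (nfSet k e i) := by
  obtain ⟨mn, hmn⟩ : ∃ mn, ∀ t : ℕ → k, (∀ j, 3 * e - 1 ≤ j → t j = 0) →
      pluecker (nfF e t) (nfG e t) mn = t i := by
    by_cases h1 : i < e
    · refine ⟨(expo i (e - i) 0, expo 0 0 e), fun t ht => ?_⟩
      simp [pluecker, coeff_nfF ht, coeff_nfG ht, show e ≠ 0 by omega,
        show i + (e - i) = e by omega, h1]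
    by_cases h2 : i < 2 * e
    · refine ⟨(expo e 0 0, expo (i - e) (e - (i - e)) 0), fun t ht => ?_⟩
      simp [pluecker, coeff_nfF ht, coeff_nfG ht, show e ≠ 0 by omega,
        show i - e + (e - (i - e)) = e by omega, show i - e < e by omega,
        show e + (i - e) = i by omega]
    · refine ⟨(expo e 0 0, expo 0 (e - (i - 2 * e + 1)) (i - 2 * e + 1)), fun t ht => ?_⟩
      simp [pluecker, coeff_nfF ht, coeff_nfG ht, show e ≠ 0 by omega,
        show (e - (i - 2 * e + 1)) + (i - 2 * e + 1) = e by omega,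
        show i - 2 * e + 1 < e by omega, show 2 * e + (i - 2 * e) = i by omega]
  refine not_subset_closure_nfSet (isHomogeneous_X _ mn) one_ne_zero (fun t ht => ?_)
    (nfF_isHomogeneous e (Pi.single i 1)) (nfG_isHomogeneous e (Pi.single i 1)) ?_
    fun W hW => mem_nfSet.mpr ⟨_, fun j hj => ?_, hW⟩
  · rw [eval_X, hmn t fun j hj => ht j (by omega), ht i le_rfl]
  · rw [eval_X, hmn _ fun j hj => Pi.single_eq_of_ne (by omega) _, Pi.single_eq_same]
    exact one_ne_zero
  · exact Pi.single_eq_of_ne (by omega) _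

/-- With trivial substitution no form contains `X 0 * X 2 ^ (e - 1)`. Putting `a = 1` in the term `X
1 * X 2 ^ (e - 1)` creates this monomial. -/
theorem not_nfSet_subset_closure_a [CharZero k] {e : ℕ} (he : 3 ≤ e) :
    ¬ nfSet k e (3 * e) ⊆ closure (nfSet k e (3 * e - 1)) := by
  let t : ℕ → k := fun j => if j = 3 * e - 2 ∨ j = 3 * e - 1 then 1 else 0
  have ht : ∀ j, t j = if j = 3 * e - 2 ∨ j = 3 * e - 1 then 1 else 0 := fun _ => rfl
  have hF : nfF e t = X 0 ^ e * X 1 ^ 0 * X 2 ^ 0 := by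
    rw [nfF_eq, Finset.sum_eq_zero, ht, if_neg (by omega)]
    · simp
    · intro i hi
      have hi := Finset.mem_range.mp hi
      rw [ht, if_neg (by omega), C_0, zero_mul]
  have hG : nfG e t = X 0 ^ 0 * X 1 ^ 0 * X 2 ^ e + X 0 ^ 1 * X 1 ^ 0 * X 2 ^ (e - 1) +
      X 0 ^ 0 * X 1 ^ 1 * X 2 ^ (e - 1) := by
    rw [nfG_eq (by omega), Finset.sum_eq_zero, Finset.sum_eq_single (e - 2)]
    · rw [ht, if_neg (by omega), ht, if_pos (by omega), ht, if_pos (by omega), ht, if_neg (by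
          omega),
        show e - 2 + 1 = e - 1 by omega, show e - (e - 1) = 1 by omega]
      simp
      ring
    · intro i hi hne
      have hi := Finset.mem_range.mp hi
      rw [ht, if_neg (by omega), C_0, zero_mul]
    · intro h
      exact absurd (Finset.mem_range.mpr (by omega)) h
    · intro i hi
      have hi := Finset.mem_range.mp hi
      rw [ht, if_neg (by omega), C_0, zero_mul]
  refine not_subset_closure_nfSet (isHomogeneous_X _ (expo e 0 0, expo 1 0 (e - 1))) one_ne_zero
    (fun t ht => ?_) (nfF_isHomogeneous e t) (nfG_isHomogeneous e t) ?_
    fun W hW => mem_nfSet.mpr ⟨_, fun j hj => ?_, hW⟩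
  · rw [eval_X]
    simp [pluecker, coeff_nfF ht, coeff_nfG ht, show e ≠ 0 by omega, show e - 1 ≠ 0 by omega]
  · rw [eval_X, pluecker, hF, hG]
    simp only [coeff_add, coeff_X_pow_mul]
    simp [show e ≠ 0 by omega, show e - 1 ≠ 0 by omega]
  · rw [ht, if_neg (by omega)]

theorem coeff_dirDeriv (a : Fin 3 → k) (F : Poly k) (n : Fin 3 →₀ ℕ) : coeff n (dirDeriv a F) =
    ∑ i, a i * (coeff (n + Finsupp.single i 1) F * (n i + 1)) := by
  rw [dirDeriv_eq, coeff_sum]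
  refine Finset.sum_congr rfl fun i _ => ?_
  rw [coeff_C_mul, coeff_pderiv]

/-- If only `a` is nonzero among the matrix entries, the plane is killed by the product of the
directions `(0, 0, 1)` and `(1, -a, 0)`. This gives two proportions with ratio governed by `a`
between coefficients of the contraction `H`; `P` results from eliminating `a`. -/
theorem not_nfSet_subset_closure_d [CharZero k] {e : ℕ} (he : 4 ≤ e) :
    ¬ nfSet k e (3 * e + 1) ⊆ closure (nfSet k e (3 * e)) := by
  let t : ℕ → k := fun j => if j = 2 * e ∨ j = 3 * e then 1 else 0
  have ht : ∀ j, t j = if j = 2 * e ∨ j = 3 * e then 1 else 0 := fun _ => rfl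
  have hF : nfF e t = X 0 ^ e * X 1 ^ 0 * X 2 ^ 0 := by
    rw [nfF_eq, Finset.sum_eq_zero, ht, if_neg (by omega)]
    · simp
    · intro i hi
      have hi := Finset.mem_range.mp hi
      rw [ht, if_neg (by omega), C_0, zero_mul]
  have hG : nfG e t = bin (fun i => (e.choose i : k)) e (X 0) (X 2) +
      X 0 ^ 0 * X 1 ^ (e - 1) * X 2 ^ 1 + X 0 ^ 1 * X 1 ^ (e - 1) * X 2 ^ 0 := by
    rw [nfG_eq (by omega), Finset.sum_eq_zero, Finset.sum_eq_single 0]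
    · rw [show t (2 * e + 0) = 1 from if_pos (by omega), show t (3 * e) = 1 from if_pos (by omega),
        show t (3 * e - 1) = 0 from if_neg (by omega), show t (3 * e + 1) = 0 from if_neg (by
            omega),
        C_1, C_0, one_mul, add_pow, bin]
      simp only [map_natCast, mul_comm ((e.choose _ : ℕ) : Poly k)]
      ring
    · intro i hi hne
      have hi := Finset.mem_range.mp hi
      rw [ht, if_neg (by omega), C_0, zero_mul]
    · intro h
      exact absurd (Finset.mem_range.mpr (by omega)) h
    · intro i hi
      have hi := Finset.mem_range.mp hi
      rw [ht, if_neg (by omega), C_0, zero_mul]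
  let v := expo e 0 0
  let P : PlueckerPoly k := C ((e : k) - 1) * (X (v, expo 1 0 (e - 1)) * X (v, expo 0 (e - 1) 1)) -
    X (v, expo 1 (e - 2) 1) * X (v, expo 0 1 (e - 1))
  have hP : P.IsHomogeneous 2 :=
    (((isHomogeneous_X _ _).mul (isHomogeneous_X _ _)).C_mul _).sub
      ((isHomogeneous_X _ _).mul (isHomogeneous_X _ _))
  have hc : ((e - 2 : ℕ) : k) + 1 = e - 1 := by
    rw [Nat.cast_sub (by omega)]
    push_cast
    ring
  refine not_subset_closure_nfSet hP two_ne_zero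
    (fun t ht => ?_) (nfF_isHomogeneous e t) (nfG_isHomogeneous e t) ?_
    fun W hW => mem_nfSet.mpr ⟨_, fun j hj => ?_, hW⟩
  · let H : Poly k := coeff v (nfF e t) • nfG e t - coeff v (nfG e t) • nfF e t
    have hH : ∀ m, pluecker (nfF e t) (nfG e t) (v, m) = coeff m H := fun m => by
      simp only [H, pluecker, coeff_sub, coeff_smul, smul_eq_mul]
      ring
    have h1 := dirDeriv_shapeF (N := nfMat e t) (normalMat_mulVec_fst _ _ _ _)
      (fun i => if i < e then t i else 1) e
    have h2 := dirDeriv_shapeG (N := nfMat e t) (normalMat_mulVec_fst _ _ _ _)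
      (normalMat_mulVec_snd _ _ _ _) (fun i => if i < e then t (e + i) else 0)
      (fun i => if i = 0 then 0 else if i < e then t (2 * e + i - 1) else 1) e
    rw [ht (3 * e) (by omega), ht (3 * e + 1) (by omega), ht (3 * e + 2) (by omega)] at h2
    rw [ht (3 * e + 1) (by omega), ht (3 * e + 2) (by omega)] at h1
    change dirDeriv _ (nfF e t) = 0 at h1
    change dirDeriv _ (dirDeriv _ (nfG e t)) = 0 at h2
    have h3 : dirDeriv ![-0, t (3 * e - 1) * 0 - 0, 1]
        (dirDeriv ![1, 0 * 0 - t (3 * e - 1), -0] H) = 0 := by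
      have : H = coeff v (nfF e t) • nfG e t + (-coeff v (nfG e t)) • nfF e t := by
        rw [neg_smul, ← sub_eq_add_neg]
      rw [this, dirDeriv_add, dirDeriv_add, dirDeriv_smul_right, dirDeriv_smul_right, h2,
        dirDeriv_comm, dirDeriv_smul_right, h1, smul_zero, smul_zero, dirDeriv_zero, add_zero]
    have h4 := congrArg (coeff (expo 0 0 (e - 2))) h3
    have h5 := congrArg (coeff (expo 0 (e - 2) 0)) h3
    simp only [coeff_dirDeriv, Fin.sum_univ_three, expo_add_single_zero, expo_add_single_one,
      expo_add_single_two, coeff_zero, Matrix.cons_val, expo_zero, expo_one, expo_two,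
      show e - 2 + 1 = e - 1 by omega, hc] at h4 h5
    simp only [P, map_sub, map_mul, eval_C, eval_X, hH]
    have hne : (e : k) - 1 ≠ 0 := by
      rw [← hc]; exact Nat.cast_add_one_ne_zero _
    have h6 : coeff (expo 1 0 (e - 1)) H = t (3 * e - 1) * coeff (expo 0 1 (e - 1)) H :=
      mul_left_cancel₀ hne (by push_cast at h4; linear_combination h4)
    push_cast at h5
    rw [h6]
    linear_combination (-coeff (expo 0 1 (e - 1)) H) * h5
  · simp only [P, map_sub, map_mul, eval_C, eval_X, pluecker, hF, hG, v, coeff_add, coeff_X_pow_mul,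
      coeff_bin _ _ (show (0 : Fin 3) ≠ 2 by decide) (show (0 : Fin 3) ≠ 1 by decide)
      (show (2 : Fin 3) ≠ 1 by decide), expo_zero, expo_one, degree_expo]
    have hne : (e : k) - 1 ≠ 0 := by
      rw [← hc]; exact Nat.cast_add_one_ne_zero _
    have hne' : (e : k) ≠ 0 := Nat.cast_ne_zero.mpr (by omega)
    simp [show e ≠ 0 by omega, show e - 1 ≠ 0 by omega, show e - 2 ≠ 0 by omega,
      show 1 + (e - 1) = e by omega, show e ≠ 1 by omega, show e - 1 ≠ 1 by omega,
      show e - 2 ≠ e - 1 by omega, show 1 ≠ e - 1 by omega, show 1 ≠ e by omega, hne, hne']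
  · rw [ht, if_neg (by omega)]

/-- For `b = c = 0` the first form does not involve `X 2`, so a Plücker coordinate at two monomials
containing `X 2` vanishes. The witness is `X 0 ^ e + (X 1 + X 2) ^ e` and `X 2 ^ e`. -/
theorem not_nfSet_subset_closure_b [CharZero k] {e : ℕ} (he : 3 ≤ e) :
    ¬ nfSet k e (3 * e + 2) ⊆ closure (nfSet k e (3 * e + 1)) := by
  let t : ℕ → k := fun j => if j = 0 ∨ j = 3 * e + 1 then 1 else 0
  have ht : ∀ j, t j = if j = 0 ∨ j = 3 * e + 1 then 1 else 0 := fun _ => rfl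
  have hF : nfF e t = X 0 ^ e * X 1 ^ 0 * X 2 ^ 0 + bin (fun i => (e.choose i : k)) e (X 1) (X 2)
      := by
    rw [nfF_eq, Finset.sum_eq_single 0]
    · rw [show t 0 = 1 from if_pos (by omega), show t (3 * e + 1) = 1 from if_pos (by omega),
        show t (3 * e - 1) = 0 from if_neg (by omega), show t (3 * e + 2) = 0 from if_neg (by
            omega),
        C_1, C_0, one_mul, one_mul, zero_mul, zero_mul, zero_add, add_zero, pow_zero, one_mul,
        Nat.sub_zero, add_pow (X 1) (X 2), bin]
      simp only [map_natCast, mul_comm ((e.choose _ : ℕ) : Poly k)]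
      ring
    · intro i hi hne
      have hi := Finset.mem_range.mp hi
      rw [ht, if_neg (by omega), C_0, zero_mul]
    · intro h
      exact absurd (Finset.mem_range.mpr (by omega)) h
  have hG : nfG e t = X 0 ^ 0 * X 1 ^ 0 * X 2 ^ e := by
    rw [nfG_eq (by omega), Finset.sum_eq_zero, Finset.sum_eq_zero, ht, if_neg (by omega)]
    · simp
    · intro i hi
      have hi := Finset.mem_range.mp hi
      rw [ht, if_neg (by omega), C_0, zero_mul]
    · intro i hi
      have hi := Finset.mem_range.mp hi
      rw [ht, if_neg (by omega), C_0, zero_mul]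
  refine not_subset_closure_nfSet (isHomogeneous_X _ (expo 0 (e - 1) 1, expo 0 0 e)) one_ne_zero
    (fun t ht => ?_) (nfF_isHomogeneous e t) (nfG_isHomogeneous e t) ?_
    fun W hW => mem_nfSet.mpr ⟨_, fun j hj => ?_, hW⟩
  · have h1 := dirDeriv_shapeF (N := nfMat e t) (normalMat_mulVec_fst _ _ _ _)
      (fun i => if i < e then t i else 1) e
    rw [ht (3 * e + 1) (by omega), ht (3 * e + 2) (by omega)] at h1
    have h2 : pderiv 2 (nfF e t) = 0 := by
      have hv : ![-0, t (3 * e - 1) * 0 - 0, 1] = (Pi.single 2 1 : Fin 3 → k) := by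
        ext i; fin_cases i <;> simp
      rw [← dirDeriv_single, ← hv]
      exact h1
    rw [eval_X, pluecker, coeff_eq_zero_of_pderiv h2 (by simp),
      coeff_eq_zero_of_pderiv h2 (by simp; omega), zero_mul, zero_mul, sub_zero]
  · simp only [eval_X, pluecker, hF, hG, coeff_add, coeff_X_pow_mul,
      coeff_bin _ _ (show (1 : Fin 3) ≠ 2 by decide) (show (1 : Fin 3) ≠ 0 by decide)
      (show (2 : Fin 3) ≠ 0 by decide), expo_zero, expo_one, degree_expo]
    have hne' : (e : k) ≠ 0 := Nat.cast_ne_zero.mpr (by omega)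
    have h1 : e.choose (e - 1) = e := by
      rw [← Nat.choose_symm (by omega), show e - (e - 1) = 1 by omega, Nat.choose_one_right]
    simp [show e ≠ 0 by omega, show e - 1 ≠ 0 by omega, show e - 1 + 1 = e by omega,
      show 1 ≠ e by omega, h1, hne']
  · rw [ht, if_neg (by omega)]

/-- The sum of the coefficient minors of `(∂ᵢF, ∂ⱼG)` and `(∂ⱼF, ∂ᵢG)`, in terms of the Plücker
coordinates. -/
noncomputable def derivMinor (k : Type*) [Field k] (i j : Fin 3) (n n' : Fin 3 →₀ ℕ) :
    PlueckerPoly k :=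
  C (((n i : k) + 1) * ((n' j : k) + 1)) * X (n + Finsupp.single i 1, n' + Finsupp.single j 1) +
    C (((n j : k) + 1) * ((n' i : k) + 1)) * X (n + Finsupp.single j 1, n' + Finsupp.single i 1)

theorem derivMinor_isHomogeneous (i j : Fin 3) (n n' : Fin 3 →₀ ℕ) :
    (derivMinor k i j n n').IsHomogeneous 1 :=
  (isHomogeneous_C_mul_X _ _).add (isHomogeneous_C_mul_X _ _)

theorem eval_derivMinor (i j : Fin 3) (n n' : Fin 3 →₀ ℕ) (F G : Poly k) :
    eval (pluecker F G) (derivMinor k i j n n') =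
      pluecker (pderiv i F) (pderiv j G) (n, n') + pluecker (pderiv j F) (pderiv i G) (n, n') := by
  simp only [derivMinor, map_add, map_mul, eval_C, eval_X, pluecker, coeff_pderiv]
  ring

theorem isHomogeneous_det {σ R : Type*} [CommRing R] {n : ℕ}
    (M : Matrix (Fin n) (Fin n) (MvPolynomial σ R)) (hM : ∀ i j, (M i j).IsHomogeneous 1) :
    M.det.IsHomogeneous n := by
  rw [Matrix.det_apply]
  refine IsHomogeneous.sum _ _ _ fun s _ => ?_
  have h1 := IsHomogeneous.prod Finset.univ (fun i => M (s i) i) (fun _ => 1) fun i _ => hM _ _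
  rw [Finset.sum_const, Finset.card_univ, Fintype.card_fin, smul_eq_mul, mul_one] at h1
  rw [Units.smul_def, zsmul_eq_mul, ← map_intCast (C : R →+* MvPolynomial σ R)]
  exact h1.C_mul _

/-- For `c = 0` the first form is killed by `D = ∂₂ - b ∂₁`, so all minors of `DF` and `DG` vanish.
They are quadratic in `b`; three of them give a determinant with the left null vector `(1, -2b,
b²)`. The binary forms of the witness, in `X 1` and `X 2`, make it nonzero. -/
theorem not_family_subset_closure [CharZero k] {e : ℕ} (he : 5 ≤ e) :
    ¬ family k e ⊆ closure (nfSet k e (3 * e + 2)) := by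
  let p : Fin 3 → (Fin 3 →₀ ℕ) × (Fin 3 →₀ ℕ) := ![(expo 0 (e - 1) 0, expo 0 1 (e - 2)),
    (expo 0 (e - 1) 0, expo 0 0 (e - 1)), (expo 0 (e - 2) 1, expo 0 0 (e - 1))]
  let q : Fin 3 → Fin 3 × Fin 3 := ![(2, 2), (2, 1), (1, 1)]
  let M : Matrix (Fin 3) (Fin 3) (PlueckerPoly k) :=
    Matrix.of fun r c => derivMinor k (q r).1 (q r).2 (p c).1 (p c).2
  have hMap : ∀ (F G : Poly k) r c, M.map (eval (pluecker F G)) r c =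
      pluecker (pderiv (q r).1 F) (pderiv (q r).2 G) (p c) +
      pluecker (pderiv (q r).2 F) (pderiv (q r).1 G) (p c) :=
    fun F G r c => eval_derivMinor _ _ _ _ _ _
  have hM : ∀ r c, (M r c).IsHomogeneous 1 := fun r c => derivMinor_isHomogeneous _ _ _ _
  have hP : M.det.IsHomogeneous 3 := isHomogeneous_det _ hM
  have hev : ∀ F G : Poly k, eval (pluecker F G) M.det =
      (M.map (eval (pluecker F G))).det := fun F G => RingHom.map_det _ _
  let F : Poly k := X 0 ^ 0 * X 1 ^ (e - 1) * X 2 ^ 1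
  let G : Poly k := X 0 ^ 0 * X 1 ^ 1 * X 2 ^ (e - 1)
  have hom : ∀ a b : ℕ, a + b = e → (X 0 ^ 0 * X 1 ^ a * X 2 ^ b : Poly k).IsHomogeneous e := by
    intro a b h
    have h1 := (((isHomogeneous_X k (0 : Fin 3)).pow 0).mul
      ((isHomogeneous_X k (1 : Fin 3)).pow a)).mul ((isHomogeneous_X k (2 : Fin 3)).pow b)
    rwa [one_mul, one_mul, one_mul, zero_add, h] at h1
  refine not_subset_closure_nfSet hP three_ne_zero (fun t ht => ?_) (hom (e - 1) 1 (by omega))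
    (hom 1 (e - 1) (by omega)) ?_ fun W hW => mem_family_iff.mpr ⟨_, _, Pi.single 0 1, Pi.single 0
      1,
      hW, ?_, ?_, ?_, ?_⟩
  · have h1 := dirDeriv_shapeF (N := nfMat e t) (normalMat_mulVec_fst _ _ _ _)
      (fun i => if i < e then t i else 1) e
    rw [ht (3 * e + 2) (by omega)] at h1
    change dirDeriv _ (nfF e t) = 0 at h1
    have h2 : pderiv 2 (nfF e t) = t (3 * e + 1) • pderiv 1 (nfF e t) := by
      rw [dirDeriv_eq, Fin.sum_univ_three] at h1
      simp only [Matrix.cons_val, neg_zero, C_0, zero_mul, mul_zero, zero_sub, C_neg, C_1] at h1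
      rw [smul_eq_C_mul]
      linear_combination h1
    rw [hev, ← Matrix.exists_vecMul_eq_zero_iff]
    refine ⟨![1, -(2 * t (3 * e + 1)), t (3 * e + 1) ^ 2], fun h => by
      simpa using congrFun h 0, ?_⟩
    ext c
    simp only [Matrix.vecMul, dotProduct, Fin.sum_univ_three, hMap, q, Matrix.cons_val, h2,
      pluecker_smul_left, Pi.smul_apply, smul_eq_mul, Pi.zero_apply]
    ring
  · have hne : ((e - 1 : ℕ) : k) ≠ 0 := Nat.cast_ne_zero.mpr (by omega)
    have hF1 : pderiv 1 F = ((e - 1 : ℕ) : k) • (X 0 ^ 0 * X 1 ^ (e - 2) * X 2 ^ 1) := by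
      simp [F, Derivation.leibniz, Derivation.leibniz_pow, pderiv_X, smul_eq_C_mul,
        show e - 1 - 1 = e - 2 by omega]
      ring
    have hF2 : pderiv 2 F = X 0 ^ 0 * X 1 ^ (e - 1) * X 2 ^ 0 := by
      simp [F, Derivation.leibniz, Derivation.leibniz_pow, pderiv_X]
    have hG1 : pderiv 1 G = X 0 ^ 0 * X 1 ^ 0 * X 2 ^ (e - 1) := by
      simp [G, Derivation.leibniz, Derivation.leibniz_pow, pderiv_X]
    have hG2 : pderiv 2 G = ((e - 1 : ℕ) : k) • (X 0 ^ 0 * X 1 ^ 1 * X 2 ^ (e - 2)) := by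
      simp [G, Derivation.leibniz, Derivation.leibniz_pow, pderiv_X, smul_eq_C_mul,
        show e - 1 - 1 = e - 2 by omega]
      ring
    change eval (pluecker F G) M.det ≠ 0
    rw [hev, Matrix.det_fin_three]
    simp only [hMap, q, p, Matrix.cons_val, hF1, hF2, hG1, hG2, pluecker, coeff_smul,
      coeff_X_pow_mul, smul_eq_mul]
    simp [show e - 1 ≠ 0 by omega, show e - 2 ≠ 0 by omega, show e - 1 ≠ e - 2 by omega,
      show e - 2 ≠ e - 1 by omega, show e - 2 ≠ 1 by omega, show e - 1 ≠ 1 by omega,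
      show 1 ≠ e - 2 by omega, show 1 ≠ e - 1 by omega, hne]
  · simp
  · simp
  · rw [dirDeriv_single]
    simp [Derivation.leibniz, Derivation.leibniz_pow, pderiv_X]
  · rw [dirDeriv_single, dirDeriv_single]
    simp [Derivation.leibniz, Derivation.leibniz_pow, pderiv_X]

theorem le_topologicalKrullDim_family [CharZero k] {e : ℕ} (he : 5 ≤ e) :
    ((3 * (e + 1) : ℕ) : WithBot ℕ∞) ≤ topologicalKrullDim (family k e) := by
  refine le_topologicalKrullDim_of_chain
    (fun i => if i ≤ 3 * e + 2 then nfSet k e i else family k e) (fun i _ => ?_) (fun i _ => ?_)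
    (fun i hi => ?_) fun i hi => ?_
  · split_ifs
    exacts [nfSet_subset_family _ _, subset_rfl]
  · split_ifs
    exacts [nfSet_isIrreducible (by omega) _, family_isIrreducible (by omega)]
  · rw [if_pos (show i ≤ 3 * e + 2 by omega)]
    split_ifs
    exacts [nfSet_mono e (by omega), nfSet_subset_family _ _]
  · rw [if_pos (show i ≤ 3 * e + 2 by omega)]
    rcases lt_or_ge i (3 * e - 1) with h | h
    · rw [if_pos (by omega)]
      exact not_nfSet_subset_closure_of_coeff (by omega) h
    · obtain rfl | rfl | rfl | rfl : i = 3 * e - 1 ∨ i = 3 * e ∨ i = 3 * e + 1 ∨ i = 3 * e + 2 := by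
        omega
      · rw [if_pos (by omega), show 3 * e - 1 + 1 = 3 * e by omega]
        exact not_nfSet_subset_closure_a (by omega)
      · rw [if_pos (by omega)]
        exact not_nfSet_subset_closure_d (by omega)
      · rw [if_pos (by omega)]
        exact not_nfSet_subset_closure_b (by omega)
      · rw [if_neg (by omega)]
        exact not_family_subset_closure he

theorem topologicalKrullDim_family [CharZero k] {e : ℕ} (he : 5 ≤ e) :
    topologicalKrullDim (family k e) = ((3 * (e + 1) : ℕ) : WithBot ℕ∞) :=
  le_antisymm (topologicalKrullDim_family_le (by omega)) (le_topologicalKrullDim_family he)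

end

section

variable {k : Type*} [Field k]

/-! ### The generic `h`-vector -/

/-- Independence of the rows means that the columns span, and a basis can be chosen among the
columns. This holds for an arbitrary set of columns. -/
theorem exists_det_ne_zero {ι J : Type*} [Fintype ι] [DecidableEq ι] (v : ι → J → k)
    (h : ∀ c : ι → k, (∀ j, ∑ i, c i * v i j = 0) → c = 0) :
    ∃ f : ι → J, (Matrix.of fun i i' => v i (f i')).det ≠ 0 := by
  let w : J → ι → k := fun j i => v i j
  have hspan : Submodule.span k (Set.range w) = ⊤ := by
    by_contra hne
    obtain ⟨φ, hφ, hle⟩ := Submodule.exists_le_ker_of_lt_top _ (lt_top_iff_ne_top.mpr hne)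
    apply hφ
    have hsum : ∀ x : ι → k, φ x = ∑ i, φ (Pi.single i 1) * x i := fun x => by
      conv_lhs => rw [pi_eq_sum_univ' x, map_sum]
      refine Finset.sum_congr rfl fun i _ => ?_
      rw [map_smul, smul_eq_mul, mul_comm]
    have hc := h (fun i => φ (Pi.single i 1)) fun j => by
      rw [← hsum (w j)]
      exact LinearMap.mem_ker.mp (hle (Submodule.subset_span ⟨j, rfl⟩))
    ext x
    rw [LinearMap.comp_apply, LinearMap.zero_comp, LinearMap.zero_apply]
    exact congrFun hc x
  obtain ⟨b, hb, hbs, hbi⟩ := exists_linearIndependent k (Set.range w)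
  rw [hspan] at hbs
  let B := Module.Basis.mk hbi (by rw [Subtype.range_coe, hbs])
  have hfin : Finite b := Module.Finite.finite_basis B
  have := Fintype.ofFinite b
  let σ : ι ≃ b := (Pi.basisFun k ι).indexEquiv B
  choose f hf using fun i => hb (σ i).2
  refine ⟨f, ?_⟩
  have h1 : LinearIndependent k (Matrix.of fun i i' => v i (f i')).col := by
    have h2 := hbi.comp σ σ.injective
    have h3 : (Matrix.of fun i i' => v i (f i')).col = Subtype.val ∘ σ := by
      ext i' i
      rw [Function.comp_apply, ← hf]
      rfl
    rw [h3]
    exact h2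
  rw [Matrix.linearIndependent_cols_iff_isUnit, Matrix.isUnit_iff_isUnit_det] at h1
  exact h1.ne_zero

theorem expFactorial_ne_zero (m : Fin 3 →₀ ℕ) : expFactorial m ≠ 0 :=
  Finset.prod_ne_zero_iff.mpr fun _ _ => Nat.factorial_ne_zero _

/-- The vectors of the coefficients, up to nonzero factors, of `y^m ∘ F` and `y^m ∘ G`. -/
noncomputable def derivVec (F G : Poly k) (m : Fin 3 →₀ ℕ) (bn : Bool × (Fin 3 →₀ ℕ)) : k :=
  (expFactorial (bn.2 + m) : k) * coeff (bn.2 + m) (if bn.1 then G else F)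

/-- A linear relation among the classes of the monomials of `T` kills `F` and `G`, hence is a
relation among their derivatives. -/
theorem card_le_hilb_of_derivVec [CharZero k] {W : Submodule k (Poly k)} {F G : Poly k} (hF : F ∈ W)
    (hG : G ∈ W) {d : ℕ} {T : Finset (Fin 3 →₀ ℕ)} (hT : ∀ m ∈ T, m.degree = d)
    (h : ∀ c : T → k, (∀ j, ∑ i, c i * derivVec F G i j = 0) → c = 0) :
    T.card ≤ hilb (Ann W) d := by
  let v : T → gradedPart (Ann W) d := fun m => ⟨Ideal.Quotient.mkₐ k (Ann W) (monomial m.1 1),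
    Submodule.mem_map_of_mem (isHomogeneous_monomial _ (hT m m.2))⟩
  have hv : LinearIndependent k v := by
    rw [Fintype.linearIndependent_iff]
    intro c hc
    refine congrFun (h c fun bn => ?_)
    have h1 : Ideal.Quotient.mkₐ k (Ann W) (∑ i, monomial i.1 (c i)) = 0 := by
      have h2 := congrArg Subtype.val hc
      rw [AddSubmonoidClass.coe_finsetSum] at h2
      rw [map_sum]
      refine Eq.trans (Finset.sum_congr rfl fun i _ => ?_) h2
      rw [← mul_one (c i), ← smul_eq_mul, ← smul_monomial, map_smul]
      simp [v]
    have h2 : ∑ i, monomial i.1 (c i) ∈ Ann W := Ideal.Quotient.eq_zero_iff_mem.mp h1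
    have h3 : (if bn.1 then G else F) ∈ W := by split_ifs <;> assumption
    have h4 := congrArg (fun p => coeff bn.2 p * (expFactorial bn.2 : k)) (h2 _ h3)
    simp only [map_sum, LinearMap.sum_apply, coeff_sum, Finset.sum_mul, coeff_diff_monomial,
      coeff_zero, zero_mul] at h4
    rw [← h4]
    refine Finset.sum_congr rfl fun i _ => ?_
    rw [derivVec]
    ring
  have : Module.Finite k (gradedPart (Ann W) d) := Module.Finite.map (Forms k d) _
  have := hv.fintype_card_le_finrank
  rwa [Fintype.card_coe] at this

theorem hilb_Ann_eq_zero [CharZero k] {W : Submodule k (Poly k)} {d e : ℕ} (hW : W ≤ Forms k e) (h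
    : e < d) :
    hilb (Ann W) d = 0 := by
  have : gradedPart (Ann W) d = ⊥ := by
    rw [eq_bot_iff]
    rintro _ ⟨p, hp, rfl⟩
    exact Ideal.Quotient.eq_zero_iff_mem.mpr fun F hF => diff_eq_zero_of_lt hp (hW hF) h
  rw [hilb, this, finrank_bot]

/-- The determinant of coefficients of `y^m ∘ F'` and `y^m ∘ G'`, where `F'` and `G'` are the
contractions of the Plücker tensor with the coordinates `M₃` and `M₁`. -/
noncomputable def derivDet (M₁ M₃ : Fin 3 →₀ ℕ) {T : Finset (Fin 3 →₀ ℕ)}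
    (f : T → Bool × (Fin 3 →₀ ℕ)) : PlueckerPoly k :=
  (Matrix.of fun i i' : T => C (expFactorial ((f i').2 + i) : k) *
    X (if (f i').1 then (M₁, (f i').2 + i.1) else ((f i').2 + i.1, M₃))).det

theorem eval_derivDet (M₁ M₃ : Fin 3 →₀ ℕ) {T : Finset (Fin 3 →₀ ℕ)}
    (f : T → Bool × (Fin 3 →₀ ℕ)) (F G : Poly k) : eval (pluecker F G) (derivDet M₁ M₃ f) =
      (Matrix.of fun i i' : T => derivVec (coeff M₃ G • F - coeff M₃ F • G)
        (coeff M₁ F • G - coeff M₁ G • F) i.1 (f i')).det := by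
  rw [derivDet, RingHom.map_det]
  congr 1
  ext i i'
  simp only [RingHom.mapMatrix_apply, Matrix.map_apply, Matrix.of_apply, map_mul, eval_C, eval_X,
    derivVec]
  congr 1
  cases (f i').1 <;> simp [pluecker] <;> ring

theorem card_le_hilb_of_mem_basicOpen [CharZero k] {e d : ℕ} {W : Gr k e} {M₁ M₃ : Fin 3 →₀ ℕ}
    {T : Finset (Fin 3 →₀ ℕ)} (hT : ∀ m ∈ T, m.degree = d) {f : T → Bool × (Fin 3 →₀ ℕ)}
    (h : W ∈ basicOpen e (derivDet M₁ M₃ f)) : T.card ≤ hilb (Ann W.1) d := by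
  obtain ⟨F, G, hW, h⟩ := h
  rw [eval_derivDet] at h
  have hF : F ∈ W.1 := hW ▸ Submodule.subset_span (by simp)
  have hG : G ∈ W.1 := hW ▸ Submodule.subset_span (by simp)
  refine card_le_hilb_of_derivVec (F := coeff M₃ G • F - coeff M₃ F • G)
    (G := coeff M₁ F • G - coeff M₁ G • F) (Submodule.sub_mem _ (Submodule.smul_mem _ _ hF)
      (Submodule.smul_mem _ _ hG)) (Submodule.sub_mem _ (Submodule.smul_mem _ _ hG)
      (Submodule.smul_mem _ _ hF)) hT fun c hc => ?_
  by_contra hne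
  refine h (Matrix.exists_vecMul_eq_zero_iff.mp ⟨c, hne, ?_⟩)
  ext i'
  exact hc (f i')

/-- A criterion for the derivatives by the monomials in `T` of `y^{M₁} + y^{M₂}` and `y^{M₃}` to be
independent. -/
theorem derivVec_independent [CharZero k] {M₁ M₂ M₃ : Fin 3 →₀ ℕ} {T : Finset (Fin 3 →₀ ℕ)}
    (h12 : M₁ ≠ M₂)
    (hT : ∀ m ∈ T, m ≤ M₃ ∨ (m ≤ M₁ ∧ ∀ m' ∈ T, M₁ - m + m' = M₂ → m' ≤ M₃) ∨
      (m ≤ M₂ ∧ ∀ m' ∈ T, M₂ - m + m' = M₁ → m' ≤ M₃)) (c : T → k)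
    (hc : ∀ j, ∑ i, c i * derivVec (monomial M₁ 1 + monomial M₂ 1 : Poly k) (monomial M₃ 1) i j =
      0) :
    c = 0 := by
  -- The derivatives of `y^{M₃}` are distinct monomials up to factors, so a single coefficient
  -- isolates `c i`.
  have h3 : ∀ i : T, i.1 ≤ M₃ → c i = 0 := by
    intro i hi
    have h1 := hc (true, M₃ - i.1)
    rw [Finset.sum_eq_single i] at h1
    · simpa [derivVec, tsub_add_cancel_of_le hi, expFactorial_ne_zero] using h1
    · intro i' _ hne
      have : M₃ ≠ M₃ - i.1 + i'.1 := fun h => hne (Subtype.ext (by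
        have h2 := tsub_add_cancel_of_le hi
        rw [eq_comm] at h2
        exact (add_left_cancel (h2.symm.trans h)).symm))
      simp [derivVec, coeff_monomial, this]
    · simp
  -- A coefficient of the derivatives of the binomial can mix at most two exponents of `T`; by
  -- assumption the second divides `y^{M₃}`, and its coefficient is already known to vanish.
  have key : ∀ (A B : Fin 3 →₀ ℕ), A ≠ B → (∀ j, ∑ i, c i *
      derivVec (monomial A 1 + monomial B 1 : Poly k) (monomial M₃ 1) i j = 0) →
      ∀ i : T, i.1 ≤ A → (∀ m' ∈ T, A - i.1 + m' = B → m' ≤ M₃) → c i = 0 := by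
    intro A B hAB hc i hi hi'
    have h1 := hc (false, A - i.1)
    rw [Finset.sum_eq_single i] at h1
    · simpa [derivVec, tsub_add_cancel_of_le hi, expFactorial_ne_zero, coeff_monomial,
        hAB.symm] using h1
    · intro i' _ hne
      have h4 : A ≠ A - i.1 + i'.1 := fun h => hne (Subtype.ext (by
        have h2 := tsub_add_cancel_of_le hi
        rw [eq_comm] at h2
        exact (add_left_cancel (h2.symm.trans h)).symm))
      by_cases h5 : A - i.1 + i'.1 = B
      · rw [h3 i' (hi' _ i'.2 h5), zero_mul]
      · simp [derivVec, coeff_monomial, h4, Ne.symm h5]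
    · simp
  ext i
  rcases hT i i.2 with h | ⟨h, h'⟩ | ⟨h, h'⟩
  · exact h3 i h
  · exact key M₁ M₂ h12 hc i h h'
  · exact key M₂ M₁ h12.symm (by simpa only [add_comm (monomial M₁ (1 : k))] using hc) i h h'

theorem expo_le_expo {a b c a' b' c' : ℕ} :
    expo a b c ≤ expo a' b' c' ↔ a ≤ a' ∧ b ≤ b' ∧ c ≤ c' := by
  refine ⟨fun h => ⟨h 0, h 1, h 2⟩, fun h i => ?_⟩
  fin_cases i
  exacts [h.1, h.2.1, h.2.2]

theorem expo_sub (a b c a' b' c' : ℕ) :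
    expo a b c - expo a' b' c' = expo (a - a') (b - b') (c - c') := by
  ext i; fin_cases i <;> rfl

/-- Write `j = e - d`. The monomials containing `y₂` (set `B`) are those dividing `y^{M₃}`; for `d >
0` there are at least `min(d, j + 1)`. Those in `y₀, y₁` (set `A`) either divide `y^{M₃}` or are
seen by the binomial, which couples the exponents `p - s` and `q - s` for `0 ≤ s ≤ j`. Spacing `q,
m, p` near `e/3, e/2, 2e/3` makes the selection large enough. -/
theorem exists_monomials_independent {e d p q m : ℕ} (he : 1 ≤ e) (hd : d ≤ e)
    (hp : p = (2 * e + 1) / 3) (hq : q = e / 3) (hm : m = (e - 1) / 2) :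
    ∃ T : Finset (Fin 3 →₀ ℕ), (∀ m' ∈ T, m'.degree = d) ∧ hSeq e d ≤ T.card ∧
      ∀ n ∈ T, n ≤ expo m (e - 1 - m) 1 ∨ (n ≤ expo p (e - p) 0 ∧ ∀ m' ∈ T,
        expo p (e - p) 0 - n + m' = expo q (e - q) 0 → m' ≤ expo m (e - 1 - m) 1) ∨
      (n ≤ expo q (e - q) 0 ∧ ∀ m' ∈ T,
        expo q (e - q) 0 - n + m' = expo p (e - p) 0 → m' ≤ expo m (e - 1 - m) 1) := by
  classical
  let j := e - d
  have hj : j = e - d := rfl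
  let A : Finset ℕ := (Finset.range (d + 1)).filter fun a => (a ≤ m ∧ m < a + j) ∨
    (m < a ∧ a ≤ p ∧ p ≤ a + j) ∨ (a + p ≤ m + q ∧ q ≤ a + j)
  let B : Finset ℕ := (Finset.range d).filter fun a => a ≤ m ∧ m ≤ a + j
  have hA : ∀ a, a ∈ A ↔ a < d + 1 ∧ ((a ≤ m ∧ m < a + j) ∨
    (m < a ∧ a ≤ p ∧ p ≤ a + j) ∨ (a + p ≤ m + q ∧ q ≤ a + j)) := fun a => by simp [A]
  have hB : ∀ a, a ∈ B ↔ a < d ∧ a ≤ m ∧ m ≤ a + j := fun a => by simp [B]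
  let T₁ := A.image fun a => expo a (d - a) 0
  let T₂ := B.image fun a => expo a (d - 1 - a) 1
  have hT : ∀ n, n ∈ T₁ ∪ T₂ ↔ (∃ a ∈ A, expo a (d - a) 0 = n) ∨
      ∃ a ∈ B, expo a (d - 1 - a) 1 = n := fun n => by
    rw [Finset.mem_union, Finset.mem_image, Finset.mem_image]
  have hcard : (T₁ ∪ T₂).card = A.card + B.card := by
    rw [Finset.card_union_of_disjoint, Finset.card_image_of_injective,
        Finset.card_image_of_injective]
    · exact fun a b h => (expo_inj.mp h).1
    · exact fun a b h => (expo_inj.mp h).1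
    · rw [Finset.disjoint_left]
      intro n h1 h2
      obtain ⟨a, -, rfl⟩ := Finset.mem_image.mp h1
      obtain ⟨b, -, h⟩ := Finset.mem_image.mp h2
      exact absurd (expo_inj.mp h).2.2 (by omega)
  refine ⟨T₁ ∪ T₂, fun n hn => ?_, ?_, fun n hn => ?_⟩
  · rcases (hT n).mp hn with ⟨a, ha, rfl⟩ | ⟨a, ha, rfl⟩
    · rw [hA] at ha
      rw [degree_expo]
      omega
    · rw [hB] at ha
      rw [degree_expo]
      omega
  · rw [hcard]
    have hB' : min m (d - 1) + 1 - (m - j) ≤ B.card ∨ d = 0 := by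
      rcases Nat.eq_zero_or_pos d with h | h
      · exact Or.inr h
      · left
        rw [← Nat.card_Icc]
        refine Finset.card_le_card fun a ha => ?_
        rw [Finset.mem_Icc] at ha
        rw [hB]
        omega
    by_cases h : e ≤ 3 * j
    · have hA' : d + 1 ≤ A.card := by
        rw [← Finset.card_range (d + 1)]
        refine Finset.card_le_card fun a ha => ?_
        rw [Finset.mem_range] at ha
        rw [hA]
        omega
      rw [hSeq]
      omega
    · have hA' : 2 * j + 1 ≤ A.card := by
        rw [← Finset.card_range (2 * j + 1)]
        refine Finset.card_le_card_of_injOn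
          -- The first `j` values give divisors of `y^{M₃}`. The other `j + 1` choose from each
          -- coupled pair `p - s`, `q - s` the first if it exceeds `m`, and otherwise the second.
          (fun i => if i < j then m + 1 - j + i else if m + (i - j) < p then p - (i - j)
            else q - (i - j)) (fun i hi => ?_) fun i hi i' hi' hii' => ?_
        · rw [Finset.mem_coe, Finset.mem_range] at hi
          rw [Finset.mem_coe, hA]
          dsimp only
          split_ifs <;> omega
        · rw [Finset.mem_coe, Finset.mem_range] at hi hi'
          dsimp only at hii'
          split_ifs at hii' <;> omega
      rw [hSeq]
      omega
  · rcases (hT n).mp hn with ⟨a, ha, rfl⟩ | ⟨a, ha, rfl⟩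
    · rw [hA] at ha
      rcases ha with ⟨ha, h | h | h⟩
      · left
        rw [expo_le_expo]
        omega
      · right; left
        refine ⟨by rw [expo_le_expo]; omega, fun m' hm' h' => ?_⟩
        rcases (hT m').mp hm' with ⟨a', ha', rfl⟩ | ⟨a', ha', rfl⟩
        · rw [expo_sub, expo_add, expo_inj] at h'
          rw [hA] at ha'
          rw [expo_le_expo]
          omega
        · rw [expo_sub, expo_add, expo_inj] at h'
          omega
      · right; right
        refine ⟨by rw [expo_le_expo]; omega, fun m' hm' h' => ?_⟩
        rcases (hT m').mp hm' with ⟨a', ha', rfl⟩ | ⟨a', ha', rfl⟩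
        · rw [expo_sub, expo_add, expo_inj] at h'
          rw [hA] at ha'
          rw [expo_le_expo]
          omega
        · rw [expo_sub, expo_add, expo_inj] at h'
          omega
    · left
      rw [hB] at ha
      rw [expo_le_expo]
      omega

/-- The open set is cut out by one nonvanishing determinant for each degree, giving lower bounds
that meet `hilb_le_hSeq`. One member of the family in it suffices, since the family is irreducible.
-/
theorem hasHVector_generic (k : Type*) [Field k] [CharZero k] {e : ℕ} (he : 1 ≤ e) :
    ∃ U : Set (Gr k e), IsOpen U ∧ (U ∩ family k e).Nonempty ∧
      family k e ⊆ closure (U ∩ family k e) ∧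
      ∀ W ∈ U ∩ family k e, HasHVector (Ann W.1) e (hSeq e) := by
  obtain ⟨p, hp⟩ : ∃ p, p = (2 * e + 1) / 3 := ⟨_, rfl⟩
  obtain ⟨q, hq⟩ : ∃ q, q = e / 3 := ⟨_, rfl⟩
  obtain ⟨m, hm⟩ : ∃ m, m = (e - 1) / 2 := ⟨_, rfl⟩
  choose! T hTd hTc hT using fun (d : ℕ) (hd : d ≤ e) =>
    exists_monomials_independent he hd hp hq hm
  let M₁ := expo p (e - p) 0
  let M₂ := expo q (e - q) 0
  let M₃ := expo m (e - 1 - m) 1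
  have h12 : M₁ ≠ M₂ := fun h => by
    have := (expo_inj.mp h).1
    omega
  have h13 : M₁ ≠ M₃ := fun h => absurd (expo_inj.mp h).2.2 (by omega)
  have h23 : M₂ ≠ M₃ := fun h => absurd (expo_inj.mp h).2.2 (by omega)
  let F : Poly k := monomial M₁ 1 + monomial M₂ 1
  let G : Poly k := monomial M₃ 1
  choose! f hf using fun (d : ℕ) (hd : d ≤ e) =>
    exists_det_ne_zero (fun i : T d => derivVec F G i.1) (derivVec_independent h12 (hT d hd))
  have hF : F.IsHomogeneous e := (isHomogeneous_monomial _ (by rw [degree_expo]; omega)).add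
    (isHomogeneous_monomial _ (by rw [degree_expo]; omega))
  have hG : G.IsHomogeneous e := isHomogeneous_monomial _ (by rw [degree_expo]; omega)
  have c11 : coeff M₁ F = 1 := by simp [F, coeff_monomial, h12.symm]
  have c13 : coeff M₃ F = 0 := by simp [F, coeff_monomial, h13, h23]
  have c21 : coeff M₁ G = 0 := by simp [G, coeff_monomial, h13.symm]
  have c23 : coeff M₃ G = 1 := by simp [G]
  obtain ⟨W₀, hW₀⟩ := exists_gr_of_pluecker_ne_zero hF hG (mn := (M₁, M₃)) (by
    simp [pluecker, c11, c13, c21, c23])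
  let U : Set (Gr k e) := ⋂ d ∈ Finset.range (e + 1), basicOpen e (derivDet M₁ M₃ (f d))
  have hU : IsOpen U := isOpen_biInter_finset fun d _ => isOpen_basicOpen e _
  have hW₀U : W₀ ∈ U := by
    refine Set.mem_iInter₂.mpr fun d hd => ⟨F, G, hW₀, ?_⟩
    -- For the example, contraction of the Plücker tensor with `M₃` and `M₁` returns `F` and `G`
    -- themselves.
    rw [eval_derivDet, c11, c13, c21, c23, one_smul, one_smul, zero_smul, zero_smul, sub_zero,
      sub_zero]
    exact hf d (by simpa [Nat.lt_succ_iff] using hd)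
  have hW₀F : W₀ ∈ family k e := by
    refine mem_family_iff.mpr ⟨F, G, Pi.single 2 1, Pi.single 2 1, hW₀, by simp, by simp, ?_, ?_⟩
    · rw [dirDeriv_single]
      simp [F, pderiv_monomial, M₁, M₂]
    · rw [dirDeriv_single, dirDeriv_single]
      simp [G, pderiv_monomial, M₃]
  refine ⟨U, hU, ⟨W₀, hW₀U, hW₀F⟩, fun W hW => ?_, fun W hW => ⟨fun d hd => ?_, fun d hd => ?_, ?_⟩⟩
  · rw [mem_closure_iff]
    intro V hV hWV
    obtain ⟨W', h1, h2, h3⟩ := (family_isIrreducible he).2 V U hV hU ⟨W, hW, hWV⟩ ⟨W₀, hW₀F, hW₀U⟩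
    exact ⟨W', h2, h3, h1⟩
  · refine le_antisymm ?_ ((hTc d hd).trans (card_le_hilb_of_mem_basicOpen (hTd d hd)
      (Set.mem_iInter₂.mp hW.1 d (by simpa [Nat.lt_succ_iff] using hd))))
    obtain ⟨F', G', l₁, l₂, hW', n1, h1, n2, h2, h3, h4⟩ := hW.2
    have := hilb_le_hSeq h1 n1 h2 n2 h3 h4 hd (hW' ▸ W.2.1)
    rwa [← hW'] at this
  · exact hilb_Ann_eq_zero W.2.1 hd
  · rw [hSeq]
    omega

end

section

variable {k : Type*} [Field k]

/-! ### Closedness of the family -/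

theorem eval_homogeneousComponent {σ : Type*} [Fintype σ] [DecidableEq σ] (p : MvPolynomial σ k) (n
    : ℕ)
    (x : σ → k) : eval x (homogeneousComponent n p) =
      ∑ m : Finset.univ.finsuppAntidiag (ι := σ) n, coeff m.1 p * ∏ i, x i ^ m.1 i := by
  rw [eval_eq', Finset.sum_coe_sort (Finset.univ.finsuppAntidiag n)
    fun m : σ →₀ ℕ => coeff m p * ∏ i, x i ^ m i]
  have hmem : ∀ m : σ →₀ ℕ, m ∈ Finset.univ.finsuppAntidiag n ↔ m.degree = n := fun m => by
    rw [Finset.mem_finsuppAntidiag, Finsupp.degree_eq_sum]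
    simp
  refine (Finset.sum_subset_zero_on_sdiff (fun m hm => ?_) (fun m hm => ?_) fun m hm => ?_)
  · rw [hmem]
    by_contra h
    rw [mem_support_iff, coeff_homogeneousComponent, if_neg h] at hm
    exact hm rfl
  · rw [Finset.mem_sdiff, hmem, mem_support_iff, not_not, coeff_homogeneousComponent] at hm
    rw [if_pos hm.1] at hm
    rw [hm.2, zero_mul]
  · rw [mem_support_iff, coeff_homogeneousComponent] at hm
    rw [coeff_homogeneousComponent]
    split_ifs at hm ⊢ with h
    · rfl
    · exact absurd rfl hm

/-- By the Nullstellensatz all variables lie in the radical, and a power of the radical lies in the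
ideal. -/
theorem pow_irrelevant_le [IsAlgClosed k] {σ : Type*} [Fintype σ] {S : Type*}
    (g : S → MvPolynomial σ k) (h : ∀ x : σ → k, (∀ s, eval x (g s) = 0) → x = 0) :
    ∃ N : ℕ, N ≠ 0 ∧ ∀ m : σ →₀ ℕ, m.degree = N → monomial m 1 ∈ Ideal.span (Set.range g) := by
  let I := Ideal.span (Set.range g)
  obtain ⟨N, hN⟩ := Ideal.exists_radical_pow_le_of_fg I (IsNoetherian.noetherian _)
  have hX : ∀ i, (X i : MvPolynomial σ k) ∈ I.radical := by
    intro i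
    rw [← vanishingIdeal_zeroLocus_eq_radical (K := k)]
    intro x hx
    have : x = 0 := h x fun s => by
      have := hx (g s) (Ideal.subset_span ⟨s, rfl⟩)
      rwa [aeval_eq_eval] at this
    simp [this]
  have hm : ∀ (N : ℕ) (m : σ →₀ ℕ), m.degree = N →
      (monomial m 1 : MvPolynomial σ k) ∈ I.radical ^ N := by
    rintro _ m rfl
    rw [monomial_eq, C_1, one_mul, Finsupp.prod_fintype _ _ (by simp), Finsupp.degree_eq_sum,
      ← Finset.prod_pow_eq_pow_sum]
    exact Ideal.prod_mem_prod fun i _ => Ideal.pow_mem_pow (hX i) _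
  exact ⟨N + 1, by omega, fun m hmN => hN (Ideal.pow_le_pow_right (by omega) (hm _ _ hmN))⟩

/-- The projection from a projective space is closed: near a point over which the homogeneous
polynomials `f s` have no common nonzero zero, they have none. -/
theorem exists_eval_ne_zero_forall_eq_zero [IsAlgClosed k] {σ τ S : Type*} [Fintype σ]
    (f : S → MvPolynomial σ (MvPolynomial τ k)) (d : S → ℕ) (hf : ∀ s, (f s).IsHomogeneous (d s))
    (v₀ : τ → k) (h₀ : ∀ x : σ → k, (∀ s, eval x (map (eval v₀) (f s)) = 0) → x = 0) :
    ∃ P : MvPolynomial τ k, eval v₀ P ≠ 0 ∧ ∀ v, eval v P ≠ 0 →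
      ∀ x : σ → k, (∀ s, eval x (map (eval v) (f s)) = 0) → x = 0 := by
  classical
  obtain ⟨N, hN0, hN⟩ := pow_irrelevant_le (fun s => map (eval v₀) (f s)) h₀
  let ι := Finset.univ.finsuppAntidiag (ι := σ) N
  have hι : ∀ m : σ →₀ ℕ, m ∈ ι ↔ m.degree = N := fun m => by
    rw [Finset.mem_finsuppAntidiag, Finsupp.degree_eq_sum]
    simp
  choose c hc using fun m : ι =>
    (Finsupp.mem_ideal_span_range_iff_exists_finsupp).mp (hN m.1 ((hι m.1).mp m.2))
  let Q : ι → MvPolynomial σ (MvPolynomial τ k) := fun m =>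
    (c m).sum fun s a => map C a * f s
  have hQ : ∀ v m, map (eval v) (Q m) = (c m).sum fun s a => a * map (eval v) (f s) := fun v m => by
    simp only [Q, Finsupp.sum, map_sum, map_mul, map_map]
    refine Finset.sum_congr rfl fun s _ => ?_
    have : (eval v).comp C = RingHom.id k := by ext; simp
    rw [this, map_id]
  -- At `v₀` the combinations `Q m` are the monomials of degree `N`, so `A` is the identity there.
  -- Where `det A ≠ 0`, the degree `N` parts of the `Q m` still span all monomials of degree `N`, so
  -- at a common zero every such monomial vanishes.
  let A : Matrix ι ι (MvPolynomial τ k) := Matrix.of fun m m' => coeff m'.1 (Q m)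
  have hA : ∀ v, eval v A.det = (Matrix.of fun m m' : ι => coeff m'.1 (map (eval v) (Q m))).det :=
    fun v => by
      rw [RingHom.map_det]
      congr 1
  refine ⟨A.det, ?_, fun v hv x hx => ?_⟩
  · have : (Matrix.of fun m m' : ι => coeff m'.1 (map (eval v₀) (Q m))) = 1 := by
      ext m m'
      rw [Matrix.of_apply, hQ, hc, coeff_monomial, Matrix.one_apply]
      simp only [Subtype.ext_iff]
    rw [hA, this, Matrix.det_one]
    exact one_ne_zero
  · have h1 : ∀ m, eval x (homogeneousComponent N (map (eval v) (Q m))) = 0 := by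
      intro m
      by_contra hne
      obtain ⟨s, -, hs⟩ := exists_eval_smul_ne_zero _ _ hne
      apply hs
      rw [hQ, Finsupp.sum, map_sum]
      refine Finset.sum_eq_zero fun i _ => ?_
      rw [map_mul, eval_smul_of_isHomogeneous ((hf i).map _), hx, mul_zero, mul_zero]
    have h2 : (fun m : ι => ∏ i, x i ^ m.1 i) = 0 := by
      by_contra hne
      rw [hA] at hv
      refine hv (Matrix.exists_mulVec_eq_zero_iff.mp ⟨_, hne, ?_⟩)
      ext m
      rw [Pi.zero_apply, ← h1 m, eval_homogeneousComponent]
      rfl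
    ext i
    have h3 := congrFun h2 ⟨Finsupp.single i N, (hι _).mpr (by simp)⟩
    rw [Pi.zero_apply, Finset.prod_eq_single i (by
      intro j _ hj
      rw [Finsupp.single_eq_of_ne hj, pow_zero]) (by simp), Finsupp.single_eq_same] at h3
    exact eq_zero_of_pow_eq_zero h3

/-- The coefficient of `y^n` in the derivative along `x` of the contraction with `y^m` of the
Plücker tensor, as a linear form in `x`. -/
noncomputable def contractDeriv (k : Type*) [Field k] (m n : Fin 3 →₀ ℕ) :
    MvPolynomial (Fin 3) (PlueckerPoly k) :=
  ∑ i, C (X (n + Finsupp.single i 1, m) * C ((n i : k) + 1)) * X i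

/-- The minors of the coefficients of the derivatives of the two forms along `x`, as quadratic
forms in `x`. -/
noncomputable def derivPluecker (k : Type*) [Field k] (n n' : Fin 3 →₀ ℕ) :
    MvPolynomial (Fin 3) (PlueckerPoly k) :=
  ∑ i, ∑ j, C (X (n + Finsupp.single i 1, n' + Finsupp.single j 1) *
    C (((n i : k) + 1) * ((n' j : k) + 1))) * (X i * X j)

/-- The maximal minors of the matrix of the derivatives along `x` and the coordinate vectors, as
cubic forms in `x`. -/
noncomputable def hessianMinor (k : Type*) [Field k]
    (r : Fin 3 → (Fin 3 →₀ ℕ) × (Fin 3 →₀ ℕ)) : MvPolynomial (Fin 3) (PlueckerPoly k) :=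
  (Matrix.of fun i j => contractDeriv k (r j).1 ((r j).2 + Finsupp.single i 1) *
    C (C (((r j).2 i : k) + 1))).det

theorem contractDeriv_isHomogeneous (m n : Fin 3 →₀ ℕ) : (contractDeriv k m n).IsHomogeneous 1 :=
  IsHomogeneous.sum _ _ _ fun _ _ => isHomogeneous_C_mul_X _ _

theorem derivPluecker_isHomogeneous (n n' : Fin 3 →₀ ℕ) : (derivPluecker k n n').IsHomogeneous 2 :=
  IsHomogeneous.sum _ _ _ fun _ _ => IsHomogeneous.sum _ _ _ fun _ _ =>
    ((isHomogeneous_X _ _).mul (isHomogeneous_X _ _)).C_mul _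

theorem hessianMinor_isHomogeneous (r : Fin 3 → (Fin 3 →₀ ℕ) × (Fin 3 →₀ ℕ)) :
    (hessianMinor k r).IsHomogeneous 3 :=
  isHomogeneous_det _ fun _ _ => (contractDeriv_isHomogeneous _ _).mul (isHomogeneous_C _ _)

theorem eval_contractDeriv (m n : Fin 3 →₀ ℕ) (F G : Poly k) (x : Fin 3 → k) :
    eval x (map (eval (pluecker F G)) (contractDeriv k m n)) =
      coeff n (dirDeriv x (coeff m G • F - coeff m F • G)) := by
  rw [coeff_dirDeriv, contractDeriv, map_sum, map_sum]
  refine Finset.sum_congr rfl fun i _ => ?_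
  simp only [map_mul, map_C, map_X, eval_C, eval_X, pluecker, coeff_sub, coeff_smul, smul_eq_mul]
  ring

theorem eval_derivPluecker (n n' : Fin 3 →₀ ℕ) (F G : Poly k) (x : Fin 3 → k) :
    eval x (map (eval (pluecker F G)) (derivPluecker k n n')) =
      pluecker (dirDeriv x F) (dirDeriv x G) (n, n') := by
  simp only [derivPluecker, map_sum, map_mul, map_C, map_X, eval_C, eval_X]
  simp only [pluecker, coeff_dirDeriv, Fin.sum_univ_three]
  ring

theorem eval_hessianMinor (r : Fin 3 → (Fin 3 →₀ ℕ) × (Fin 3 →₀ ℕ)) (F G : Poly k) (x : Fin 3 → k) :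
    eval x (map (eval (pluecker F G)) (hessianMinor k r)) =
      (Matrix.of fun i j => coeff (r j).2 (pderiv i
        (dirDeriv x (coeff (r j).1 G • F - coeff (r j).1 F • G)))).det := by
  rw [hessianMinor, RingHom.map_det, RingHom.map_det]
  congr 1
  ext i j
  simp only [RingHom.mapMatrix_apply, Matrix.map_apply, Matrix.of_apply, map_mul,
    eval_contractDeriv, map_C, eval_C, coeff_pderiv]

theorem dirDeriv_sub (a : Fin 3 → k) (F G : Poly k) :
    dirDeriv a (F - G) = dirDeriv a F - dirDeriv a G := map_sub _ _ _

theorem eq_zero_of_smul_sub_eq_zero {V : Type*} [AddCommGroup V] [Module k V] {u w : V}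
    {a b c d : k} (h : a * d - b * c ≠ 0) (h1 : a • u - b • w = 0) (h2 : c • u - d • w = 0) :
    u = 0 ∧ w = 0 := by
  constructor
  · refine (smul_eq_zero_iff_right h).mp ?_
    have : (a * d - b * c) • u = d • (a • u - b • w) - b • (c • u - d • w) := by module
    rw [this, h1, h2, smul_zero, smul_zero, sub_zero]
  · refine (smul_eq_zero_iff_right h).mp ?_
    have : (a * d - b * c) • w = c • (a • u - b • w) - a • (c • u - d • w) := by module
    rw [this, h1, h2, smul_zero, smul_zero, sub_zero]

/-- A direction `x` can serve as `l₁` exactly when the derivatives of `F` and `G` along `x` are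
dependent and some nonzero direction `μ` kills both. These are vanishing conditions on the minors
`derivPluecker` and `hessianMinor`, forms in `x` with coefficients in the Plücker coordinates, so
elimination applies. -/
theorem isClosed_family [CharZero k] [IsAlgClosed k] (e : ℕ) : IsClosed (family k e) := by
  rw [← isOpen_compl_iff, isOpen_iff_forall_mem_open]
  intro W hW
  obtain ⟨F, G, hFG⟩ := exists_span_pair_of_finrank_two W.2.2
  have hr := W.2.2
  rw [hFG, finrank_span_pair_eq_two_iff_pluecker] at hr
  obtain ⟨mn, hmn⟩ := hr
  let S := ((Fin 3 →₀ ℕ) × (Fin 3 →₀ ℕ)) ⊕ (Fin 3 → (Fin 3 →₀ ℕ) × (Fin 3 →₀ ℕ))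
  let f : S → MvPolynomial (Fin 3) (PlueckerPoly k) :=
    Sum.elim (fun p => derivPluecker k p.1 p.2) (hessianMinor k)
  let d : S → ℕ := Sum.elim (fun _ => 2) fun _ => 3
  have hf : ∀ s, (f s).IsHomogeneous (d s) := by
    rintro (p | r)
    exacts [derivPluecker_isHomogeneous _ _, hessianMinor_isHomogeneous _]
  have h₀ : ∀ x : Fin 3 → k, (∀ s, eval x (map (eval (pluecker F G)) (f s)) = 0) → x = 0 := by
    intro x hx
    by_contra hne
    have h1 : ¬ LinearIndependent k ![dirDeriv x F, dirDeriv x G] := by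
      rw [← finrank_span_pair_eq_two_iff, finrank_span_pair_eq_two_iff_pluecker]
      push Not
      intro p
      rw [← eval_derivPluecker]
      exact hx (Sum.inl p)
    -- If all maximal minors vanish, the three rows are dependent; the coefficients of the
    -- dependence form the second direction.
    obtain ⟨μ, hμ, hμ0⟩ : ∃ μ : Fin 3 → k, (∀ j : (Fin 3 →₀ ℕ) × (Fin 3 →₀ ℕ), ∑ i, μ i * coeff j.2
        (pderiv i (dirDeriv x (coeff j.1 G • F - coeff j.1 F • G))) = 0) ∧ μ ≠ 0 := by
      by_contra! h2
      obtain ⟨r, hr⟩ := exists_det_ne_zero _ h2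
      refine hr ?_
      rw [← eval_hessianMinor]
      exact hx (Sum.inr r)
    have h2 : ∀ m, coeff m G • dirDeriv μ (dirDeriv x F) - coeff m F • dirDeriv μ (dirDeriv x G) =
        0 := by
      intro m
      have h7 : dirDeriv μ (dirDeriv x (coeff m G • F - coeff m F • G)) =
          coeff m G • dirDeriv μ (dirDeriv x F) - coeff m F • dirDeriv μ (dirDeriv x G) := by
        rw [dirDeriv_sub, dirDeriv_sub, dirDeriv_smul_right, dirDeriv_smul_right,
          dirDeriv_smul_right, dirDeriv_smul_right]
      rw [← h7, dirDeriv_eq]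
      ext n
      rw [coeff_sum, coeff_zero, ← hμ (m, n)]
      exact Finset.sum_congr rfl fun i _ => coeff_C_mul _ _ _
    -- The contractions at the two exponents of a nonzero Plücker coordinate span the plane, so what
    -- kills both of them kills `F` and `G`.
    obtain ⟨h3, h4⟩ := eq_zero_of_smul_sub_eq_zero (by
      rw [pluecker] at hmn
      intro h0
      apply hmn
      linear_combination -h0) (h2 mn.1) (h2 mn.2)
    rw [LinearIndependent.pair_iff] at h1
    push Not at h1
    obtain ⟨a, b, hab, h5⟩ := h1
    apply hW
    have h6 : dirDeriv x (a • F + b • G) = 0 := by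
      rw [dirDeriv_add, dirDeriv_smul_right, dirDeriv_smul_right, hab]
    by_cases ha : a = 0
    · have hb := h5 ha
      refine mem_family_iff.mpr ⟨a • F + b • G, F, x, μ, ?_, hne, hμ0, h6, ?_⟩
      · rw [ha, zero_smul, zero_add, span_smul_pair _ _ hb, Set.pair_comm, hFG]
      · rw [dirDeriv_comm, h3]
    · refine mem_family_iff.mpr ⟨a • F + b • G, G, x, μ, ?_, hne, hμ0, h6, ?_⟩
      · have h7 := span_pair_normalize G F (-(b * a⁻¹)) one_ne_zero ha
        rw [one_smul, smul_sub, smul_smul, mul_neg, mul_left_comm, mul_inv_cancel₀ ha, mul_one,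
          neg_smul, sub_neg_eq_add] at h7
        rw [hFG, Set.pair_comm, Set.pair_comm _ G, h7]
      · rw [dirDeriv_comm, h4]
  obtain ⟨P, hP, hP'⟩ := exists_eval_ne_zero_forall_eq_zero f d hf (pluecker F G) h₀
  refine ⟨basicOpen e P, fun W' hW' hfam => ?_, isOpen_basicOpen e P, F, G, hFG, hP⟩
  obtain ⟨F', G', h1, h2⟩ := hW'
  obtain ⟨F₁, G₁, a, b, h3, ha, hb, h4, h5⟩ := mem_family_iff.mp hfam
  refine ha (hP' _ h2 a ?_)
  have hFG₁ : ∀ H ∈ W'.1, dirDeriv b (dirDeriv a H) = 0 := by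
    intro H hH
    rw [h3, Submodule.mem_span_pair] at hH
    obtain ⟨s, t, rfl⟩ := hH
    rw [dirDeriv_comm, dirDeriv_add, dirDeriv_add, dirDeriv_smul_right, dirDeriv_smul_right,
      dirDeriv_smul_right, dirDeriv_smul_right, h5, dirDeriv_comm, h4, dirDeriv_zero, smul_zero,
      smul_zero, add_zero]
  have hF' : F' ∈ W'.1 := h1 ▸ Submodule.subset_span (by simp)
  have hG' : G' ∈ W'.1 := h1 ▸ Submodule.subset_span (by simp)
  rintro (p | r)
  · have hF₁ : F₁ ∈ Submodule.span k {F', G'} := h1 ▸ h3 ▸ Submodule.subset_span (by simp)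
    obtain ⟨s, t, rfl⟩ := Submodule.mem_span_pair.mp hF₁
    change eval a (map _ (derivPluecker k p.1 p.2)) = 0
    rw [eval_derivPluecker]
    by_contra hne
    have h6 := finrank_span_pair_eq_two_iff_pluecker.mpr ⟨_, hne⟩
    rw [finrank_span_pair_eq_two_iff, LinearIndependent.pair_iff] at h6
    rw [dirDeriv_add, dirDeriv_smul_right, dirDeriv_smul_right] at h4
    obtain ⟨rfl, rfl⟩ := h6 s t h4
    have h7 := W'.2.2
    rw [h3, finrank_span_pair_eq_two_iff_pluecker] at h7
    simp [pluecker] at h7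
  · change eval a (map _ (hessianMinor k r)) = 0
    rw [eval_hessianMinor, ← Matrix.exists_vecMul_eq_zero_iff]
    refine ⟨b, hb, ?_⟩
    ext j
    have h6 := congrArg (coeff (r j).2) (hFG₁ _ (Submodule.sub_mem _
      (Submodule.smul_mem _ (coeff (r j).1 G') hF') (Submodule.smul_mem _ (coeff (r j).1 F') hG')))
    rw [dirDeriv_eq, coeff_sum, coeff_zero] at h6
    rw [Pi.zero_apply, ← h6]
    simp only [Matrix.vecMul, dotProduct, Matrix.of_apply, coeff_C_mul]

end

end LevelAlg

theorem theorem3p2 (k : Type*) [Field k] [CharZero k] :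
    -- the generic member of the family has `h`-vector `h^(e)`
    (∀ e : ℕ, 1 ≤ e → ∃ U : Set (LevelAlg.Gr k e), IsOpen U ∧
      (U ∩ LevelAlg.family k e).Nonempty ∧
      LevelAlg.family k e ⊆ closure (U ∩ LevelAlg.family k e) ∧
      ∀ W ∈ U ∩ LevelAlg.family k e,
        LevelAlg.HasHVector (LevelAlg.Ann W.1) e (LevelAlg.hSeq e)) ∧
    -- every level algebra with `h`-vector `h^(e)` is in the family
    (∀ e : ℕ, 6 ≤ e → ∀ I : Ideal (LevelAlg.Poly k), LevelAlg.IsLevel I e →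
      LevelAlg.HasHVector I e (LevelAlg.hSeq e) →
      ∃ W ∈ LevelAlg.family k e, I = LevelAlg.Ann W.1) ∧
    -- the family is an irreducible variety of dimension `3(e+1)`
    (∀ e : ℕ, 6 ≤ e → IsIrreducible (LevelAlg.family k e) ∧
      topologicalKrullDim (LevelAlg.family k e) = ((3 * (e + 1) : ℕ) : WithBot ℕ∞) ∧
      (IsAlgClosed k → IsClosed (LevelAlg.family k e))) ∧
    -- failure of the Weak Lefschetz Property
    (∀ e : ℕ, (Odd e ∧ 9 ≤ e) ∨ (Even e ∧ 12 ≤ e) →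
      ∀ I : Ideal (LevelAlg.Poly k), LevelAlg.IsLevel I e →
        LevelAlg.HasHVector I e (LevelAlg.hSeq e) → ¬ LevelAlg.HasWLP I e) := by
  refine ⟨fun e he => LevelAlg.hasHVector_generic k he,
    fun e he I hI hh => LevelAlg.exists_mem_family_eq_Ann he hI hh,
    fun e he => ⟨LevelAlg.family_isIrreducible (by omega),
      LevelAlg.topologicalKrullDim_family (by omega), fun _ => LevelAlg.isClosed_family e⟩,
    fun e he I hI hh => LevelAlg.not_hasWLP he hI hh⟩
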